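/- Let $\mathfrak g$ be the Lie algebra of a compact semisimple Lie group, with generators $t^1,\dots,t^n$ such that $[t^a,t^b]=f^{abc}t^c$ and $\mathrm{tr}(t^at^b)=-2\delta^{ab}$, where $\mathrm{tr}$ is the Killing form. Let $(M,g)$ be a smooth Riemannian manifold of dimension $d$ and $U\subset M$ a convex open coordinate domain (any two points of $U$ are joined by a geodesic inside $U$, which is unique and depends smoothly on the end points); points of $U$ are identified with their coordinates. Let $B_\mu=B^a_\mu t^a$ be the components of a smooth $\mathfrak g$-valued 1-form on $U$. Write $B_\mu$ also for the matrix with entries $f^{adb}B^d_\mu$, put $$F^a_{\mu\nu}=\partial_\mu B^a_\nu-\partial_\nu B^a_\mu+f^{abc}B^b_\mu B^c_\nu ,$$ write $F_{\mu\nu}$ for the matrix with entries $f^{adb}F^d_{\mu\nu}$, and let $\mathfrak D_\mu H=\partial_\mu H+[B_\mu,H]$ for matrix-valued functions $H$. For matrix-valued connection components $A_\mu$ on $U$ the ordered exponential is $$\Phi_A(x,y)=\mathbf 1+\sum_{k\ge1}(-1)^k\int_0^1ds_1\cdots\int_0^{s_{k-1}}ds_k\,\dot\gamma^{\mu_1}(s_1)A_{\mu_1}(\gamma(s_1))\cdots\dot\gamma^{\mu_k}(s_k)A_{\mu_k}(\gamma(s_k)),$$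 where $\gamma:[0,1]\to U$ is the geodesic with $\gamma(0)=y$, $\gamma(1)=x$. Put $\Phi=\Phi_B$ and $$f_\sigma(x-z,z)=\Phi(z,x)\big(\partial_{x^\sigma}+B_\sigma(x)\big)\Phi(x,z).$$ Then $x\mapsto\Phi(x,z)$ is continuously differentiable on $U$ for every $z\in U$, the series defining the ordered exponentials of $B$ and of $f(\cdot-z,z)$ converge, and for all $x,y,z\in U$ $$\Phi(z,x)\Phi(x,y)\Phi(y,z)=\Phi_{f(\cdot-z,z)}(x,y).$$ Moreover, suppose that $g_{\mu\nu}=\delta_{\mu\nu}$ on $U$, and let $z\in U$. Then $$f_\sigma(x-z,z)=\sum_{k=1}^{\infty}\frac{(x-z)^{\mu_1}\cdots(x-z)^{\mu_k}}{(k-1)!\,(k+1)}\,\mathfrak D_{\mu_1}\cdots\mathfrak D_{\mu_{k-1}}F_{\mu_k\sigma}(z)$$ as a Taylor series at $x=z$: for every $N\ge0$ the difference of the left-hand side and the sum of the terms with $k\le N$ is $O(|x-z|^{N+1})$ as $x\to z$; if moreover the functions $B^a_\mu$ are real-analytic at $z$, then the series converges to $f_\sigma(x-z,z)$ for all $x$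 in a neighbourhood of $z$. Finally, as $(x,y)\to(z,z)$, $$\begin{aligned}\Phi(z,x)\Phi(x,y)\Phi(y,z)=\mathbf 1&+\tfrac12(x-z)^\nu(y-z)^\mu F_{\nu\mu}(z)+\tfrac16(z-y)^\nu(z-x)^\sigma(y-x)^\mu\,\mathfrak D_{(\nu}F_{\sigma)\mu}(z)\\&+\tfrac18(x-z)^\nu(x-z)^\sigma(y-z)^\mu(y-z)^\rho F_{\nu\mu}(z)F_{\sigma\rho}(z)\\&-\tfrac1{24}(y-x)^\mu(y-x)^\nu(y-x)^\sigma(x-z)^\rho\,\mathfrak D_\mu\mathfrak D_\nu F_{\sigma\rho}(z)\\&-\tfrac1{16}(x-z)^\mu(x-z)^\rho(y-x)^\sigma(y-z)^\nu\,\mathfrak D_{(\mu}\mathfrak D_{\nu)}F_{\sigma\rho}(z)+O\big((|x-z|+|y-z|)^5\big),\end{aligned}$$ where parentheses around indices denote symmetrization without division by the factorial. -/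

import Mathlib

open Set Filter Topology Asymptotics
open scoped Manifold ContDiff Matrix

noncomputable section

namespace OrderedExponential

/-! ### Geodesics in a coordinate domain -/

/-- The partial derivative `∂h / ∂x^μ`. -/
def pd {d : ℕ} (μ : Fin d) (h : EuclideanSpace ℝ (Fin d) → ℝ) (x : EuclideanSpace ℝ (Fin d)) : ℝ :=
  fderiv ℝ h x (EuclideanSpace.single μ 1)

/-- The entrywise partial derivative of a matrix-valued function. -/
def pdMat {d n : ℕ} (μ : Fin d) (H : EuclideanSpace ℝ (Fin d) → Matrix (Fin n) (Fin n) ℝ)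
    (x : EuclideanSpace ℝ (Fin d)) : Matrix (Fin n) (Fin n) ℝ :=
  Matrix.of fun a b => pd μ (fun p => H p a b) x

/-- The components `g_{μν}` of a Riemannian metric in the chart `φ`, as functions of the
coordinates: the values of the metric on the coordinate vector fields of the chart. -/
def metricComponents {d : ℕ} {M : Type*} [TopologicalSpace M]
    [ChartedSpace (EuclideanSpace ℝ (Fin d)) M] [IsManifold (𝓡 d) ∞ M]
    (g : Bundle.ContMDiffRiemannianMetric (𝓡 d) ∞ (EuclideanSpace ℝ (Fin d))
      (fun x : M => TangentSpace (𝓡 d) x))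
    (φ : OpenPartialHomeomorph M (EuclideanSpace ℝ (Fin d)))
    (p : EuclideanSpace ℝ (Fin d)) : Matrix (Fin d) (Fin d) ℝ :=
  Matrix.of fun μ ν => g.inner (φ.symm p)
    (mfderiv (𝓡 d) (𝓡 d) φ.symm p (EuclideanSpace.single μ (1 : ℝ) : EuclideanSpace ℝ (Fin d)))
    (mfderiv (𝓡 d) (𝓡 d) φ.symm p (EuclideanSpace.single ν (1 : ℝ) : EuclideanSpace ℝ (Fin d)))

/-- The Christoffel symbols of the second kind `Γ^ρ_{μν}` of the metric components `g`. -/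
def christoffel {d : ℕ} (g : EuclideanSpace ℝ (Fin d) → Matrix (Fin d) (Fin d) ℝ)
    (ρ μ ν : Fin d) (x : EuclideanSpace ℝ (Fin d)) : ℝ :=
  ∑ α, (g x)⁻¹ ρ α / 2 *
    (pd ν (fun p => g p α μ) x + pd μ (fun p => g p α ν) x - pd α (fun p => g p μ ν) x)

/-- `γ : [0,1] → V` is a parametrized geodesic with `γ 0 = y` and `γ 1 = x`. -/
structure IsGeodesic {d : ℕ} (g : EuclideanSpace ℝ (Fin d) → Matrix (Fin d) (Fin d) ℝ)
    (V : Set (EuclideanSpace ℝ (Fin d))) (γ : ℝ → EuclideanSpace ℝ (Fin d))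
    (y x : EuclideanSpace ℝ (Fin d)) : Prop where
  contDiffOn : ContDiffOn ℝ 2 γ (Icc 0 1)
  mem : ∀ s ∈ Icc (0 : ℝ) 1, γ s ∈ V
  source : γ 0 = y
  target : γ 1 = x
  equation : ∀ s ∈ Icc (0 : ℝ) 1, ∀ ρ,
    iteratedDerivWithin 2 γ (Icc 0 1) s ρ +
      ∑ μ, ∑ ν, christoffel g ρ μ ν (γ s) *
        derivWithin γ (Icc 0 1) s μ * derivWithin γ (Icc 0 1) s ν = 0

/-- The coordinate domain `V` is a convex domain for the metric `g`: it is open, and any two of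
its points are joined by a geodesic inside `V` which is unique and depends smoothly on the end
points (equivalently, `V` is a normal neighbourhood of each of its points). -/
def IsConvexDomain {d : ℕ} (g : EuclideanSpace ℝ (Fin d) → Matrix (Fin d) (Fin d) ℝ)
    (V : Set (EuclideanSpace ℝ (Fin d))) : Prop :=
  IsOpen V ∧
  ∃ c : ℝ → EuclideanSpace ℝ (Fin d) → EuclideanSpace ℝ (Fin d) → EuclideanSpace ℝ (Fin d),
    ContDiffOn ℝ ∞
      (fun p : ℝ × EuclideanSpace ℝ (Fin d) × EuclideanSpace ℝ (Fin d) => c p.1 p.2.1 p.2.2)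
      (Icc 0 1 ×ˢ V ×ˢ V) ∧
    ∀ y ∈ V, ∀ x ∈ V, IsGeodesic g V (fun s => c s y x) y x ∧
      ∀ γ, IsGeodesic g V γ y x → EqOn γ (fun s => c s y x) (Icc 0 1)

/-! ### Ordered exponentials -/

/-- The iterated integral
`∫_0^u ds₁ ∫_0^{s₁} ds₂ … ∫_0^{s_{k-1}} ds_k γ'(s₁)^{μ₁} A_{μ₁}(γ(s₁)) ⋯ γ'(s_k)^{μ_k} A_{μ_k}(γ(s_k))`
of a matrix-valued connection form `A` along `γ`. -/
def iterInt {d n : ℕ} (A : Fin d → EuclideanSpace ℝ (Fin d) → Matrix (Fin n) (Fin n) ℝ)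
    (γ : ℝ → EuclideanSpace ℝ (Fin d)) : ℕ → ℝ → Matrix (Fin n) (Fin n) ℝ
  | 0, _ => 1
  | k + 1, u => Matrix.of fun a b => ∫ s in (0 : ℝ)..u,
      ((∑ μ, derivWithin γ (Icc 0 1) s μ • A μ (γ s)) * iterInt A γ k s) a b

open Classical in
/-- The ordered exponential `Φ(x, y)` of the connection `A`: the sum of the series
`1 + ∑_{k ≥ 1} (-1)^k iterInt k` along the geodesic of `V` from `y` to `x`. -/
def orderedExp {d n : ℕ} (g : EuclideanSpace ℝ (Fin d) → Matrix (Fin d) (Fin d) ℝ)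
    (V : Set (EuclideanSpace ℝ (Fin d)))
    (A : Fin d → EuclideanSpace ℝ (Fin d) → Matrix (Fin n) (Fin n) ℝ)
    (x y : EuclideanSpace ℝ (Fin d)) : Matrix (Fin n) (Fin n) ℝ :=
  if h : ∃ γ, IsGeodesic g V γ y x then
    ∑' k : ℕ, (-1 : ℝ) ^ k • iterInt A h.choose k 1
  else 1

/-- The gauge-transformed connection
`f_σ(x - z, z) = Φ(z, x) (∂_{x^σ} + A_σ(x)) Φ(x, z)`, as a function of `x`. -/
def fockSchwinger {d n : ℕ} (g : EuclideanSpace ℝ (Fin d) → Matrix (Fin d) (Fin d) ℝ)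
    (V : Set (EuclideanSpace ℝ (Fin d)))
    (A : Fin d → EuclideanSpace ℝ (Fin d) → Matrix (Fin n) (Fin n) ℝ)
    (z : EuclideanSpace ℝ (Fin d)) (σ : Fin d) (x : EuclideanSpace ℝ (Fin d)) :
    Matrix (Fin n) (Fin n) ℝ :=
  orderedExp g V A z x *
    (pdMat σ (fun p => orderedExp g V A p z) x + A σ x * orderedExp g V A x z)

/-! ### Structure constants, field strength and covariant derivatives -/

/-- The structure constants `f^{abc}` of a Lie algebra in the basis `t`:
`[t^a, t^b] = f^{abc} t^c`. -/
def structConst {n : ℕ} {𝔤 : Type*} [LieRing 𝔤] [LieAlgebra ℝ 𝔤] (t : Module.Basis (Fin n) ℝ 𝔤)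
    (a b c : Fin n) : ℝ :=
  t.repr ⁅t a, t b⁆ c

/-- The matrix `f^{adb} h^d` by which `h = h^d t^d` acts in the adjoint representation. -/
def adMat {n : ℕ} {𝔤 : Type*} [LieRing 𝔤] [LieAlgebra ℝ 𝔤] (t : Module.Basis (Fin n) ℝ 𝔤)
    (h : Fin n → ℝ) : Matrix (Fin n) (Fin n) ℝ :=
  Matrix.of fun a b => ∑ c, structConst t a c b * h c

/-- The components `F^a_{μν} = ∂_μ B^a_ν - ∂_ν B^a_μ + f^{abc} B^b_μ B^c_ν` of the field strength
of `B_μ = B^a_μ t^a`. -/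
def fieldStrength {d n : ℕ} {𝔤 : Type*} [LieRing 𝔤] [LieAlgebra ℝ 𝔤]
    (t : Module.Basis (Fin n) ℝ 𝔤) (B : Fin d → EuclideanSpace ℝ (Fin d) → Fin n → ℝ)
    (μ ν : Fin d) (x : EuclideanSpace ℝ (Fin d)) (a : Fin n) : ℝ :=
  pd μ (fun p => B ν p a) x - pd ν (fun p => B μ p a) x
    + ∑ b, ∑ c, structConst t a b c * B μ x b * B ν x c

/-- The derivative `𝔇_μ H = ∂_μ H + [A_μ, H]` of a matrix-valued function. -/
def covD {d n : ℕ} (A : Fin d → EuclideanSpace ℝ (Fin d) → Matrix (Fin n) (Fin n) ℝ) (μ : Fin d)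
    (H : EuclideanSpace ℝ (Fin d) → Matrix (Fin n) (Fin n) ℝ) (x : EuclideanSpace ℝ (Fin d)) :
    Matrix (Fin n) (Fin n) ℝ :=
  pdMat μ H x + (A μ x * H x - H x * A μ x)

/-- The iterated derivative `𝔇_{μ₁} ⋯ 𝔇_{μ_j} H` along the list `[μ₁, …, μ_j]`. -/
def iterCovD {d n : ℕ} (A : Fin d → EuclideanSpace ℝ (Fin d) → Matrix (Fin n) (Fin n) ℝ)
    (l : List (Fin d)) (H : EuclideanSpace ℝ (Fin d) → Matrix (Fin n) (Fin n) ℝ) :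
    EuclideanSpace ℝ (Fin d) → Matrix (Fin n) (Fin n) ℝ :=
  l.foldr (covD A) H

/-- The term with `k = j + 1` factors of `x - z` in the expansion of `f_σ(x - z, z)`:
`(x-z)^{μ₁} ⋯ (x-z)^{μ_k} / ((k-1)! (k+1)) 𝔇_{μ₁} ⋯ 𝔇_{μ_{k-1}} F_{μ_k σ}(z)`,
summed over all `μ₁, …, μ_k`. -/
def fockSchwingerTerm {d n : ℕ}
    (A : Fin d → EuclideanSpace ℝ (Fin d) → Matrix (Fin n) (Fin n) ℝ)
    (F : Fin d → Fin d → EuclideanSpace ℝ (Fin d) → Matrix (Fin n) (Fin n) ℝ)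
    (z : EuclideanSpace ℝ (Fin d)) (σ : Fin d) (x : EuclideanSpace ℝ (Fin d)) (j : ℕ) :
    Matrix (Fin n) (Fin n) ℝ :=
  ∑ m : Fin (j + 1) → Fin d,
    ((∏ i, (x - z) (m i)) / ((j.factorial : ℝ) * ((j : ℝ) + 2))) •
      iterCovD A (List.ofFn fun i : Fin j => m i.castSucc) (F (m (Fin.last j)) σ) z

/-- The explicit monomials of degree at most four in the expansion of
`Φ(z, x) Φ(x, y) Φ(y, z)` around `z`. -/
def tripleExpansion {d n : ℕ}
    (A : Fin d → EuclideanSpace ℝ (Fin d) → Matrix (Fin n) (Fin n) ℝ)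
    (F : Fin d → Fin d → EuclideanSpace ℝ (Fin d) → Matrix (Fin n) (Fin n) ℝ)
    (x y z : EuclideanSpace ℝ (Fin d)) : Matrix (Fin n) (Fin n) ℝ :=
  1 + (1 / 2 : ℝ) • (∑ ν, ∑ μ, ((x - z) ν * (y - z) μ) • F ν μ z)
    + (1 / 6 : ℝ) • (∑ ν, ∑ σ, ∑ μ, ((z - y) ν * (z - x) σ * (y - x) μ) •
        (covD A ν (F σ μ) z + covD A σ (F ν μ) z))
    + (1 / 8 : ℝ) • (∑ ν, ∑ σ, ∑ μ, ∑ ρ,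
        ((x - z) ν * (x - z) σ * (y - z) μ * (y - z) ρ) • (F ν μ z * F σ ρ z))
    - (1 / 24 : ℝ) • (∑ μ, ∑ ν, ∑ σ, ∑ ρ,
        ((y - x) μ * (y - x) ν * (y - x) σ * (x - z) ρ) • covD A μ (covD A ν (F σ ρ)) z)
    - (1 / 16 : ℝ) • (∑ μ, ∑ ρ, ∑ σ, ∑ ν,
        ((x - z) μ * (x - z) ρ * (y - x) σ * (y - z) ν) •
        (covD A μ (covD A ν (F σ ρ)) z + covD A ν (covD A μ (F σ ρ)) z))

end OrderedExponential

end

/-! Along a path `γ` the ordered exponential is the value at time 1 of the solution of `P' = -a P`,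
`P 0 = 1`, with `a = A(γ')`. Every identity between ordered exponentials therefore reduces to
uniqueness for a linear ODE in the Banach algebra of matrices (`eq_transport_mul`). Reversing the
path inverts the solution, so `Φ(z,x)` is the inverse of `P(x) = Φ(x,z)`, and the definition of `f`
reads `dP + A P = P f`. If `T` is the transport of `f` along the geodesic from `y` to `x`, then
`P(γ) T` solves the transport equation of `A`, whence `Φ(x,z) Φ_f(x,y) = Φ(x,y) Φ(y,z)`. This is
`triple_product`; the analytic input is that `P` is continuously differentiable in its end point
(`hasFDerivAt_transport`), which rests on Duhamel's formula.

For a flat metric geodesics are segments. With `w = x - z` and `P(s)` the transport along the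
segment from `z` to `x`, an integration by parts gives `f(v) = ∫₀¹ s P(s)⁻¹ F(w,v) P(s) ds`, where
`F` is evaluated at `z + s w` (`gaugePotential_eq`). Conjugation by `P(s)` turns the covariant
derivative along `w` into `d/ds`, so the Taylor coefficients of the integrand are the iterated
covariant derivatives of `F(w,v)` at `z`, and the weight is `∫₀¹ s^(j+1)/j! ds = 1/(j!(j+2))`. For
an analytic connection, Cauchy estimates bound `j` covariant derivatives by `C (3K)^j j!`
(`covBound_le`), so the remainders decay geometrically near `z`.

For the last expansion put `u = x - z`, `v = y - z`, `e = u - v`. On the segment from `y` to `x` the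
first argument of `F` is `v + s e`, and `F(e,e) = 0`, so only the derivatives depend on `s`: up to
fifth order the coefficient is a quadratic polynomial in `s`, and up to third order the constant `κ
= F(v,e)/2`. Its transport is `1 - ∫φ + κ²/2` up to fifth order (`exists_norm_transport_sub_le`),
and multilinear algebra identifies this with the stated monomials (`holonomyExpansion_eq`).

The field strength acts as the curvature of the matrix connection because the matrices `f^{adb} h^d`
represent the Lie algebra; this uses cyclicity of the structure constants, that is, invariance of
the Killing form. -/

set_option linter.unusedSectionVars false

noncomputable section

/-! ### Calculus on the unit interval -/

namespace UnitIntervalCalculus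

open MeasureTheory intervalIntegral

variable {E : Type*} [NormedAddCommGroup E] [NormedSpace ℝ E]

lemma intervalIntegrable_of_continuousOn {g : ℝ → E} (hg : ContinuousOn g (Icc 0 1)) {u : ℝ}
    (hu : u ∈ Icc (0 : ℝ) 1) : IntervalIntegrable g volume 0 u := by
  apply ContinuousOn.intervalIntegrable
  rw [uIcc_of_le hu.1]
  exact hg.mono (Icc_subset_Icc_right hu.2)

lemma integral_congr_of_eqOn {g h : ℝ → E} (hgh : EqOn g h (Icc 0 1)) {u : ℝ}
    (hu : u ∈ Icc (0 : ℝ) 1) : ∫ s in (0 : ℝ)..u, g s = ∫ s in (0 : ℝ)..u, h s := by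
  apply intervalIntegral.integral_congr
  rw [uIcc_of_le hu.1]
  exact hgh.mono (Icc_subset_Icc_right hu.2)

lemma hasDerivWithinAt_primitive [CompleteSpace E] {g : ℝ → E} (hg : ContinuousOn g (Icc 0 1))
    {u : ℝ} (hu : u ∈ Icc (0 : ℝ) 1) :
    HasDerivWithinAt (fun u => ∫ s in (0 : ℝ)..u, g s) (g u) (Icc 0 1) u := by
  -- The constant extension beyond the end points is continuous on the line, so the fundamental
  -- theorem of calculus also covers `u = 0` and `u = 1`.
  set g' : ℝ → E := IccExtend (zero_le_one (α := ℝ)) ((Icc (0 : ℝ) 1).domRestrict g) with hg'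
  have hc : Continuous g' := (continuousOn_iff_continuous_domRestrict.1 hg).Icc_extend'
  have he : EqOn g' g (Icc 0 1) := fun s hs => by
    simp [hg', IccExtend_of_mem _ _ hs]
  have h1 : HasDerivAt (fun u => ∫ s in (0 : ℝ)..u, g' s) (g' u) u :=
    hc.integral_hasStrictDerivAt 0 u |>.hasDerivAt
  rw [he hu] at h1
  refine h1.hasDerivWithinAt.congr (fun v hv => ?_) ?_
  · exact (integral_congr_of_eqOn he hv).symm
  · exact (integral_congr_of_eqOn he hu).symm

lemma integral_eq_sub_of_hasDerivWithinAt [CompleteSpace E] {G g : ℝ → E}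
    (h : ∀ s ∈ Icc (0 : ℝ) 1, HasDerivWithinAt G (g s) (Icc 0 1) s)
    (hg : ContinuousOn g (Icc 0 1)) {u : ℝ} (hu : u ∈ Icc (0 : ℝ) 1) :
    ∫ s in (0 : ℝ)..u, g s = G u - G 0 := by
  apply intervalIntegral.integral_eq_sub_of_hasDerivAt_of_le hu.1
  · exact fun s hs => ((h s ⟨hs.1, hs.2.trans hu.2⟩).continuousWithinAt).mono
      (Icc_subset_Icc_right hu.2)
  · intro s hs
    exact (h s ⟨hs.1.le, hs.2.le.trans hu.2⟩).hasDerivAt (Icc_mem_nhds hs.1 (hs.2.trans_le hu.2))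
  · exact intervalIntegrable_of_continuousOn hg hu

lemma eq_of_hasDerivWithinAt_zero [CompleteSpace E] {G : ℝ → E}
    (h : ∀ s ∈ Icc (0 : ℝ) 1, HasDerivWithinAt G 0 (Icc 0 1) s) {u : ℝ}
    (hu : u ∈ Icc (0 : ℝ) 1) : G u = G 0 := by
  have := integral_eq_sub_of_hasDerivWithinAt h continuousOn_const hu
  rw [intervalIntegral.integral_zero] at this
  exact sub_eq_zero.1 this.symm

lemma norm_integral_le_of_norm_le {g : ℝ → E} {C : ℝ}
    (h : ∀ s ∈ Icc (0 : ℝ) 1, ‖g s‖ ≤ C) {u : ℝ} (hu : u ∈ Icc (0 : ℝ) 1) :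
    ‖∫ s in (0 : ℝ)..u, g s‖ ≤ C := by
  have hC : 0 ≤ C := (norm_nonneg _).trans (h 0 ⟨le_rfl, zero_le_one⟩)
  have := intervalIntegral.norm_integral_le_of_norm_le_const (a := 0) (b := u) (f := g) (C := C)
    (fun s hs => by
      rw [uIoc_of_le hu.1] at hs
      exact h s ⟨hs.1.le, hs.2.trans hu.2⟩)
  refine this.trans ?_
  rw [sub_zero, abs_of_nonneg hu.1]
  exact mul_le_of_le_one_right hC hu.2

omit [NormedSpace ℝ E] in
lemma exists_norm_le {g : ℝ → E} (hg : ContinuousOn g (Icc 0 1)) :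
    ∃ M, 0 ≤ M ∧ ∀ s ∈ Icc (0 : ℝ) 1, ‖g s‖ ≤ M := by
  obtain ⟨M, hM⟩ := isCompact_Icc.exists_bound_of_continuousOn hg
  exact ⟨M, (norm_nonneg _).trans (hM 0 ⟨le_rfl, zero_le_one⟩), hM⟩

end UnitIntervalCalculus

/-! ### Linear ordinary differential equations in a Banach algebra -/

namespace LinearODE

open MeasureTheory UnitIntervalCalculus

variable {E : Type*} [NormedRing E] [NormedAlgebra ℝ E]

/-- The iterated integrals `∫_0^u ds₁ a(s₁) ∫_0^{s₁} ds₂ a(s₂) ⋯`. -/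
def picardIter (a : ℝ → E) : ℕ → ℝ → E
  | 0, _ => 1
  | k + 1, u => ∫ s in (0 : ℝ)..u, a s * picardIter a k s

/-- The solution of `P' = -a P`, `P 0 = 1` as a time-ordered exponential. -/
def transport (a : ℝ → E) (u : ℝ) : E := ∑' k : ℕ, (-1 : ℝ) ^ k • picardIter a k u

lemma picardIter_congr {a b : ℝ → E} (h : EqOn a b (Icc 0 1)) (k : ℕ) :
    EqOn (picardIter a k) (picardIter b k) (Icc 0 1) := by
  induction k with
  | zero => intro u _; rfl
  | succ k ih =>
    intro u hu
    exact integral_congr_of_eqOn (fun s hs => by simp only [h hs, ih hs]) hu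

lemma transport_congr {a b : ℝ → E} (h : EqOn a b (Icc 0 1)) :
    EqOn (transport a) (transport b) (Icc 0 1) := fun u hu => by
  simp only [transport, picardIter_congr h _ hu]

variable [CompleteSpace E]

lemma continuousOn_picardIter {a : ℝ → E} (ha : ContinuousOn a (Icc 0 1)) (k : ℕ) :
    ContinuousOn (picardIter a k) (Icc 0 1) := by
  induction k with
  | zero => exact continuousOn_const
  | succ k ih =>
    exact fun u hu => (hasDerivWithinAt_primitive (ha.mul ih) hu).continuousWithinAt

/-- The integration domain is an ordered simplex of volume `u ^ k / k!`, which is why the series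
converges for every bound `M`. The factor `‖(1 : E)‖` is kept because the unit is not assumed to
have norm 1. -/
lemma norm_picardIter_le {a : ℝ → E} {M : ℝ} (hM : ∀ s ∈ Icc (0 : ℝ) 1, ‖a s‖ ≤ M) (k : ℕ) :
    ∀ u ∈ Icc (0 : ℝ) 1, ‖picardIter a k u‖ ≤ ‖(1 : E)‖ * (M * u) ^ k / k.factorial := by
  have hM0 : 0 ≤ M := (norm_nonneg _).trans (hM 0 ⟨le_rfl, zero_le_one⟩)
  induction k with
  | zero => intro u _; simp [picardIter]
  | succ k ih =>
    intro u hu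
    have h1 : ‖picardIter a (k + 1) u‖ ≤
        ∫ s in (0 : ℝ)..u, M * (‖(1 : E)‖ * (M * s) ^ k / k.factorial) := by
      apply intervalIntegral.norm_integral_le_of_norm_le hu.1
      · refine ae_of_all _ fun s hs => ?_
        have hs' : s ∈ Icc (0 : ℝ) 1 := ⟨hs.1.le, hs.2.trans hu.2⟩
        exact (norm_mul_le _ _).trans
          (mul_le_mul (hM s hs') (ih s hs') (norm_nonneg _) hM0)
      · exact Continuous.intervalIntegrable (by fun_prop) _ _
    refine h1.trans (le_of_eq ?_)
    have h2 : ∀ s : ℝ, M * (‖(1 : E)‖ * (M * s) ^ k / k.factorial) =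
        (‖(1 : E)‖ * M ^ (k + 1) / k.factorial) * s ^ k := fun s => by
      rw [mul_pow, pow_succ]; ring
    simp only [h2]
    rw [intervalIntegral.integral_const_mul, integral_pow, Nat.factorial_succ, mul_pow]
    have : ((k : ℝ) + 1) ≠ 0 := by positivity
    have : (k.factorial : ℝ) ≠ 0 := by positivity
    push_cast
    field_simp
    simp

lemma norm_neg_one_pow_smul_picardIter_le {a : ℝ → E} {M : ℝ}
    (hM : ∀ s ∈ Icc (0 : ℝ) 1, ‖a s‖ ≤ M) (k : ℕ) {u : ℝ} (hu : u ∈ Icc (0 : ℝ) 1) :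
    ‖(-1 : ℝ) ^ k • picardIter a k u‖ ≤ ‖(1 : E)‖ * (M ^ k / k.factorial) := by
  have hM0 : 0 ≤ M := (norm_nonneg _).trans (hM 0 ⟨le_rfl, zero_le_one⟩)
  rw [norm_smul, norm_pow, norm_neg, norm_one, one_pow, one_mul]
  refine (norm_picardIter_le hM k u hu).trans ?_
  rw [mul_div_assoc]
  gcongr
  exact mul_nonneg hM0 hu.1
  exact mul_le_of_le_one_right hM0 hu.2

lemma hasSum_transport {a : ℝ → E} (ha : ContinuousOn a (Icc 0 1)) {u : ℝ}
    (hu : u ∈ Icc (0 : ℝ) 1) :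
    HasSum (fun k : ℕ => (-1 : ℝ) ^ k • picardIter a k u) (transport a u) := by
  obtain ⟨M, -, hM⟩ := exists_norm_le ha
  exact (Summable.of_norm_bounded ((Real.summable_pow_div_factorial M).mul_left _)
    fun k => norm_neg_one_pow_smul_picardIter_le hM k hu).hasSum

lemma norm_transport_le {a : ℝ → E} {M : ℝ} (hM : ∀ s ∈ Icc (0 : ℝ) 1, ‖a s‖ ≤ M) {u : ℝ}
    (hu : u ∈ Icc (0 : ℝ) 1) : ‖transport a u‖ ≤ ‖(1 : E)‖ * Real.exp M := by
  have h : HasSum (fun k : ℕ => ‖(1 : E)‖ * (M ^ k / k.factorial)) (‖(1 : E)‖ * Real.exp M) := by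
    rw [Real.exp_eq_exp_ℝ]
    exact (NormedSpace.expSeries_div_hasSum_exp M).mul_left _
  exact tsum_of_norm_bounded h fun k => norm_neg_one_pow_smul_picardIter_le hM k hu

@[simp]
lemma transport_zero (a : ℝ → E) : transport a 0 = 1 := by
  rw [transport, tsum_eq_single 0]
  · simp [picardIter]
  · intro k hk
    obtain ⟨k, rfl⟩ := Nat.exists_eq_succ_of_ne_zero hk
    simp [picardIter]

lemma continuousOn_transport {a : ℝ → E} (ha : ContinuousOn a (Icc 0 1)) :
    ContinuousOn (transport a) (Icc 0 1) := by
  obtain ⟨M, -, hM⟩ := exists_norm_le ha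
  exact continuousOn_tsum (fun k => (continuousOn_picardIter ha k).const_smul _)
    ((Real.summable_pow_div_factorial M).mul_left _)
    fun k u hu => norm_neg_one_pow_smul_picardIter_le hM k hu

/-- Integrating the series multiplied by `a` term by term, which domination by an exponential series
permits, shifts the index by one and changes the sign. -/
lemma transport_eq {a : ℝ → E} (ha : ContinuousOn a (Icc 0 1)) {u : ℝ}
    (hu : u ∈ Icc (0 : ℝ) 1) :
    transport a u = 1 - ∫ s in (0 : ℝ)..u, a s * transport a s := by
  obtain ⟨M, hM0, hM⟩ := exists_norm_le ha
  have h1 : HasSum (fun k : ℕ => ∫ s in (0 : ℝ)..u, a s * ((-1 : ℝ) ^ k • picardIter a k s))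
      (∫ s in (0 : ℝ)..u, a s * transport a s) := by
    apply intervalIntegral.hasSum_integral_of_dominated_convergence
      (fun (k : ℕ) _ => M * (‖(1 : E)‖ * (M ^ k / k.factorial)))
    · intro k
      rw [uIoc_of_le hu.1]
      exact ((ha.mul ((continuousOn_picardIter ha k).const_smul _)).mono
        (fun s hs => ⟨hs.1.le, hs.2.trans hu.2⟩)).aestronglyMeasurable measurableSet_Ioc
    · intro k
      refine ae_of_all _ fun s hs => ?_
      rw [uIoc_of_le hu.1] at hs
      have hs' : s ∈ Icc (0 : ℝ) 1 := ⟨hs.1.le, hs.2.trans hu.2⟩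
      exact (norm_mul_le _ _).trans (mul_le_mul (hM s hs')
        (norm_neg_one_pow_smul_picardIter_le hM k hs') (norm_nonneg _) hM0)
    · exact ae_of_all _ fun s _ =>
        ((Real.summable_pow_div_factorial M).mul_left _).mul_left _
    · exact intervalIntegrable_const
    · refine ae_of_all _ fun s hs => ?_
      rw [uIoc_of_le hu.1] at hs
      exact (hasSum_transport ha ⟨hs.1.le, hs.2.trans hu.2⟩).mul_left _
  have h2 : ∀ k : ℕ, (-1 : ℝ) ^ (k + 1) • picardIter a (k + 1) u =
      -∫ s in (0 : ℝ)..u, a s * ((-1 : ℝ) ^ k • picardIter a k s) := fun k => by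
    simp only [mul_smul_comm]
    rw [intervalIntegral.integral_smul, pow_succ]
    simp [picardIter]
  have h3 := (hasSum_transport ha hu).tsum_eq
  rw [(hasSum_transport ha hu).summable.tsum_eq_zero_add] at h3
  simp only [h2, tsum_neg, h1.tsum_eq] at h3
  rw [← h3]
  simp [picardIter, sub_eq_add_neg]

lemma hasDerivWithinAt_transport {a : ℝ → E} (ha : ContinuousOn a (Icc 0 1)) {u : ℝ}
    (hu : u ∈ Icc (0 : ℝ) 1) :
    HasDerivWithinAt (transport a) (-(a u * transport a u)) (Icc 0 1) u :=
  ((hasDerivWithinAt_primitive (ha.mul (continuousOn_transport ha)) hu).const_sub 1).congr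
    (fun _ hv => transport_eq ha hv) (transport_eq ha hu)

/-- The solution of `Q' = Q a`, `Q 0 = 1`. -/
def transportInv (a : ℝ → E) (u : ℝ) : E :=
  -- In the opposite algebra `Q' = Q a` becomes a transport equation with coefficient `-op a`, so
  -- all results on `transport` apply.
  MulOpposite.unop (transport (fun s => -MulOpposite.op (a s)) u)

lemma continuousOn_neg_op {a : ℝ → E} (ha : ContinuousOn a (Icc 0 1)) :
    ContinuousOn (fun s => -MulOpposite.op (a s)) (Icc 0 1) :=
  (MulOpposite.continuous_op.comp_continuousOn ha).neg

@[simp]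
lemma transportInv_zero (a : ℝ → E) : transportInv a 0 = 1 := by simp [transportInv]

lemma hasDerivWithinAt_transportInv {a : ℝ → E} (ha : ContinuousOn a (Icc 0 1)) {u : ℝ}
    (hu : u ∈ Icc (0 : ℝ) 1) :
    HasDerivWithinAt (transportInv a) (transportInv a u * a u) (Icc 0 1) u := by
  have h := hasDerivWithinAt_transport (continuousOn_neg_op ha) hu
  have h2 := ((MulOpposite.opContinuousLinearEquiv ℝ (M := E)).symm : Eᵐᵒᵖ →L[ℝ] E).hasFDerivAt
    |>.comp_hasDerivWithinAt u h
  convert! h2 using 1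
  simp [transportInv]

lemma continuousOn_transportInv {a : ℝ → E} (ha : ContinuousOn a (Icc 0 1)) :
    ContinuousOn (transportInv a) (Icc 0 1) :=
  fun _ hu => (hasDerivWithinAt_transportInv ha hu).continuousWithinAt

lemma norm_transportInv_le {a : ℝ → E} {M : ℝ} (hM : ∀ s ∈ Icc (0 : ℝ) 1, ‖a s‖ ≤ M) {u : ℝ}
    (hu : u ∈ Icc (0 : ℝ) 1) : ‖transportInv a u‖ ≤ ‖(1 : E)‖ * Real.exp M := by
  have := norm_transport_le (a := fun s => -MulOpposite.op (a s)) (M := M)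
    (fun s hs => by rw [norm_neg]; exact hM s hs) hu
  exact this

lemma transportInv_congr {a b : ℝ → E} (h : EqOn a b (Icc 0 1)) :
    EqOn (transportInv a) (transportInv b) (Icc 0 1) := fun u hu => by
  simp only [transportInv]
  rw [transport_congr (b := fun s => -MulOpposite.op (b s)) (fun s hs => by simp only [h hs]) hu]

/-- The two differential equations give `(Q P)' = Q a P - Q a P = 0`. The opposite product `P Q` is
not constant for so direct a reason; it is obtained from Dedekind finiteness of the algebra. -/
lemma transportInv_mul_transport {a : ℝ → E} (ha : ContinuousOn a (Icc 0 1)) {u : ℝ}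
    (hu : u ∈ Icc (0 : ℝ) 1) : transportInv a u * transport a u = 1 := by
  have := eq_of_hasDerivWithinAt_zero (G := fun u => transportInv a u * transport a u)
    (fun s hs => by
      convert! (hasDerivWithinAt_transportInv ha hs).mul (hasDerivWithinAt_transport ha hs) using 1
      noncomm_ring) hu
  simpa using this

lemma transport_mul_transportInv [IsDedekindFiniteMonoid E] {a : ℝ → E}
    (ha : ContinuousOn a (Icc 0 1)) {u : ℝ} (hu : u ∈ Icc (0 : ℝ) 1) :
    transport a u * transportInv a u = 1 :=
  mul_eq_one_symm (transportInv_mul_transport ha hu)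

/-- Uniqueness of solutions: `transportInv a * W` has zero derivative. -/
lemma eq_transport_mul [IsDedekindFiniteMonoid E] {a W : ℝ → E} (ha : ContinuousOn a (Icc 0 1))
    (hW : ∀ s ∈ Icc (0 : ℝ) 1, HasDerivWithinAt W (-(a s * W s)) (Icc 0 1) s) {u : ℝ}
    (hu : u ∈ Icc (0 : ℝ) 1) : W u = transport a u * W 0 := by
  have h := eq_of_hasDerivWithinAt_zero (G := fun u => transportInv a u * W u)
    (fun s hs => by
      convert! (hasDerivWithinAt_transportInv ha hs).mul (hW s hs) using 1
      noncomm_ring) hu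
  simp only [transportInv_zero, one_mul] at h
  rw [← h, ← mul_assoc, transport_mul_transportInv ha hu, one_mul]

/-- Reversing the path inverts the transport. -/
lemma transport_reverse [IsDedekindFiniteMonoid E] {a : ℝ → E} (ha : ContinuousOn a (Icc 0 1)) :
    transport (fun s => -a (1 - s)) 1 = transportInv a 1 := by
  have hmaps : MapsTo (fun s : ℝ => 1 - s) (Icc 0 1) (Icc 0 1) := fun s hs =>
    ⟨by linarith [hs.2], by linarith [hs.1]⟩
  have h1 : (1 : ℝ) ∈ Icc (0 : ℝ) 1 := ⟨zero_le_one, le_rfl⟩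
  have hb : ContinuousOn (fun s => -a (1 - s)) (Icc 0 1) :=
    (ha.comp (by fun_prop) hmaps).neg
  -- The reversed solution starts at `transport a 1`, ends at `1`, and satisfies the equation with
  -- coefficient `-a (1 - s)`; uniqueness exhibits the reversed transport as a left inverse of
  -- `transport a 1`.
  have h := eq_transport_mul (W := fun s => transport a (1 - s)) hb (fun s hs => by
    have h2 := (hasDerivWithinAt_transport ha (hmaps hs)).scomp s
      ((hasDerivWithinAt_id s (Icc 0 1)).const_sub 1) hmaps
    convert! h2 using 1
    simp) h1
  simp only [sub_self, transport_zero, sub_zero] at h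
  rw [← mul_one (transport _ 1), ← transport_mul_transportInv ha h1, ← mul_assoc, ← h, one_mul]

/-- Duhamel's formula, from `(P_a⁻¹ P_b)' = P_a⁻¹ (a - b) P_b`. It is exact, so it serves both for
Lipschitz bounds and for derivatives in a parameter. -/
lemma transport_sub_transport [IsDedekindFiniteMonoid E] {a b : ℝ → E}
    (ha : ContinuousOn a (Icc 0 1)) (hb : ContinuousOn b (Icc 0 1)) {u : ℝ}
    (hu : u ∈ Icc (0 : ℝ) 1) :
    transport b u - transport a u =
      transport a u * ∫ s in (0 : ℝ)..u, transportInv a s * (a s - b s) * transport b s := by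
  have h := integral_eq_sub_of_hasDerivWithinAt (G := fun u => transportInv a u * transport b u)
    (g := fun s => transportInv a s * (a s - b s) * transport b s)
    (fun s hs => by
      convert! (hasDerivWithinAt_transportInv ha hs).mul (hasDerivWithinAt_transport hb hs) using 1
      noncomm_ring)
    (((continuousOn_transportInv ha).mul (ha.sub hb)).mul (continuousOn_transport hb)) hu
  rw [h, mul_sub, ← mul_assoc, transport_mul_transportInv ha hu]
  simp

end LinearODE

namespace LinearODE

open MeasureTheory UnitIntervalCalculus

variable {E : Type*} [NormedRing E] [NormedAlgebra ℝ E]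
variable {X : Type*} [NormedAddCommGroup X] [NormedSpace ℝ X]

/-! ### Differentiable dependence of the transport on a parameter -/

/-- A family of coefficients that is continuously differentiable in the parameter. -/
structure IsC1Family (V : Set X) (a : X → ℝ → E) (a' : X → ℝ → X →L[ℝ] E) : Prop where
  isOpen : IsOpen V
  continuousOn : ContinuousOn (fun p : X × ℝ => a p.1 p.2) (V ×ˢ Icc 0 1)
  continuousOn_deriv : ContinuousOn (fun p : X × ℝ => a' p.1 p.2) (V ×ˢ Icc 0 1)
  hasFDerivAt : ∀ x ∈ V, ∀ s ∈ Icc (0 : ℝ) 1, HasFDerivAt (fun x => a x s) (a' x s) x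

/-- A tube argument: compactness of `[0,1]` makes a bound near each `(x₀, s)` uniform in `s` for `x`
near `x₀`. -/
lemma eventually_norm_le {Y : Type*} [NormedAddCommGroup Y] {V : Set X} (hV : IsOpen V)
    {h : X → ℝ → Y} (hh : ContinuousOn (fun p : X × ℝ => h p.1 p.2) (V ×ˢ Icc 0 1)) {x₀ : X}
    (hx₀ : x₀ ∈ V) : ∃ M, 0 ≤ M ∧ ∀ᶠ x in 𝓝 x₀, x ∈ V ∧ ∀ s ∈ Icc (0 : ℝ) 1, ‖h x s‖ ≤ M := by
  have hsec : ContinuousOn (h x₀) (Icc 0 1) :=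
    hh.comp (f := fun s => (x₀, s)) (by fun_prop) fun s hs => ⟨hx₀, hs⟩
  obtain ⟨M, hM0, hM⟩ := exists_norm_le hsec
  refine ⟨M + 1, by positivity, ?_⟩
  have h1 : ∀ᶠ x in 𝓝 x₀, ∀ s ∈ Icc (0 : ℝ) 1, x ∈ V → s ∈ Icc (0 : ℝ) 1 → ‖h x s‖ ≤ M + 1 := by
    apply isCompact_Icc.eventually_forall_of_forall_eventually
    intro s hs
    have h2 := (hh (x₀, s) ⟨hx₀, hs⟩).norm.eventually_lt_const
      (show ‖h x₀ s‖ < M + 1 by linarith [hM s hs])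
    rw [eventually_nhdsWithin_iff] at h2
    exact h2.mono fun p hp hp1 hp2 => (hp ⟨hp1, hp2⟩).le
  filter_upwards [h1, hV.mem_nhds hx₀] with x hx hxV
  exact ⟨hxV, fun s hs => hx s hs hxV hs⟩

/-- As `g` vanishes at `x₀`, the product rule needs only continuity of `h`: split `g h - g' h(x₀)`
as `(g - g') h + g' (h - h(x₀))`. In Duhamel's formula this avoids presupposing that the transport
is differentiable. -/
lemma hasFDerivAt_mul_of_eq_zero {g h : X → E} {g' : X →L[ℝ] E} {x₀ : X}
    (hg : HasFDerivAt g g' x₀) (hg0 : g x₀ = 0) (hh : ContinuousAt h x₀) :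
    HasFDerivAt (fun x => g x * h x) ((ContinuousLinearMap.mul ℝ E).flip (h x₀) ∘L g') x₀ := by
  rw [hasFDerivAt_iff_isLittleO_nhds_zero] at hg ⊢
  have hh' : Tendsto (fun v => h (x₀ + v)) (𝓝 0) (𝓝 (h x₀)) := by
    have : Tendsto (fun v => x₀ + v) (𝓝 0) (𝓝 x₀) := by
      have : Continuous fun v : X => x₀ + v := by fun_prop
      simpa using this.tendsto 0
    exact hh.tendsto.comp this
  have h1 : (fun v => (g (x₀ + v) - g x₀ - g' v) * h (x₀ + v)) =o[𝓝 0] fun v => v := by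
    have := hg.norm_norm.mul_isBigO (hh'.norm.isBigO_one ℝ)
    refine IsLittleO.of_norm_norm (((isBigO_of_le _ fun v => ?_).trans_isLittleO this).trans_isBigO ?_)
    · simpa using norm_mul_le _ _
    · simpa using isBigO_refl _ _
  have h2 : (fun v => g' v * (h (x₀ + v) - h x₀)) =o[𝓝 0] fun v => v := by
    have h3 : (fun v => h (x₀ + v) - h x₀) =o[𝓝 0] fun _ => (1 : ℝ) := by
      rw [isLittleO_one_iff]
      simpa using hh'.sub_const (h x₀)
    have := (g'.isBigO_id (𝓝 0)).norm_norm.mul_isLittleO h3.norm_left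
    refine IsLittleO.of_norm_norm (((isBigO_of_le _ fun v => ?_).trans_isLittleO this).trans_isBigO ?_)
    · simpa using norm_mul_le _ _
    · simpa using isBigO_refl _ _
  refine (h1.add h2).congr_left fun v => ?_
  simp [hg0]
  noncomm_ring

variable [CompleteSpace E] [IsDedekindFiniteMonoid E]

namespace IsC1Family

variable {V : Set X} {a : X → ℝ → E} {a' : X → ℝ → X →L[ℝ] E}

lemma continuousOn_section (h : IsC1Family V a a') {x : X} (hx : x ∈ V) :
    ContinuousOn (a x) (Icc 0 1) :=
  h.continuousOn.comp (f := fun s => (x, s)) (by fun_prop) fun _ hs => ⟨hx, hs⟩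

lemma continuousOn_deriv_section (h : IsC1Family V a a') {x : X} (hx : x ∈ V) :
    ContinuousOn (a' x) (Icc 0 1) :=
  h.continuousOn_deriv.comp (f := fun s => (x, s)) (by fun_prop) fun _ hs => ⟨hx, hs⟩

lemma exists_lipschitz (h : IsC1Family V a a') {x₀ : X} (hx₀ : x₀ ∈ V) :
    ∃ L, 0 ≤ L ∧ ∀ᶠ x in 𝓝 x₀, ∀ s ∈ Icc (0 : ℝ) 1, ‖a x s - a x₀ s‖ ≤ L * ‖x - x₀‖ := by
  obtain ⟨L, hL0, hL⟩ := eventually_norm_le h.isOpen h.continuousOn_deriv hx₀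
  obtain ⟨ε, hε, hball⟩ := Metric.eventually_nhds_iff_ball.1 hL
  refine ⟨L, hL0, ?_⟩
  filter_upwards [Metric.ball_mem_nhds x₀ hε] with x hx s hs
  exact (convex_ball x₀ ε).norm_image_sub_le_of_norm_hasFDerivWithin_le
    (f := fun x => a x s) (f' := fun x => a' x s)
    (fun y hy => (h.hasFDerivAt y (hball y hy).1 s hs).hasFDerivWithinAt)
    (fun y hy => (hball y hy).2 s hs) (Metric.mem_ball_self hε) hx

lemma eventually_bound (h : IsC1Family V a a') {x₀ : X} (hx₀ : x₀ ∈ V) :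
    ∃ C, 0 ≤ C ∧ ∀ᶠ x in 𝓝 x₀, x ∈ V ∧ ∀ s ∈ Icc (0 : ℝ) 1, ‖a' x s‖ ≤ C ∧
      ‖transport (a x) s‖ ≤ C ∧ ‖transportInv (a x) s‖ ≤ C ∧
      ‖a x s - a x₀ s‖ ≤ C * ‖x - x₀‖ := by
  obtain ⟨L, hL0, hL⟩ := h.exists_lipschitz hx₀
  obtain ⟨M, hM0, hM⟩ := eventually_norm_le h.isOpen h.continuousOn hx₀
  obtain ⟨M', hM'0, hM'⟩ := eventually_norm_le h.isOpen h.continuousOn_deriv hx₀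
  have h1 : 0 ≤ ‖(1 : E)‖ * Real.exp M := by positivity
  refine ⟨L + M' + ‖(1 : E)‖ * Real.exp M, by positivity, ?_⟩
  filter_upwards [hL, hM, hM'] with x hx1 hx2 hx3
  refine ⟨hx2.1, fun s hs => ⟨?_, ?_, ?_, ?_⟩⟩
  · linarith [hx3.2 s hs]
  · linarith [norm_transport_le hx2.2 hs]
  · linarith [norm_transportInv_le hx2.2 hs]
  · refine (hx1 s hs).trans ?_
    gcongr
    linarith

/-- Duhamel's formula bounds the difference of transports by four factors `C`. The inverses follow
from the resolvent identity `Q - Q₀ = -Q (P - P₀) Q₀`, which costs two more. -/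
lemma eventually_lipschitz_transport (h : IsC1Family V a a') {x₀ : X} (hx₀ : x₀ ∈ V) :
    ∃ C, ∀ᶠ x in 𝓝 x₀, ∀ s ∈ Icc (0 : ℝ) 1,
      ‖transport (a x) s - transport (a x₀) s‖ ≤ C * ‖x - x₀‖ ∧
      ‖transportInv (a x) s - transportInv (a x₀) s‖ ≤ C * ‖x - x₀‖ := by
  obtain ⟨C, hC0, hC⟩ := h.eventually_bound hx₀
  have hC' := hC.self_of_nhds
  refine ⟨C ^ 4 + C ^ 6, ?_⟩
  filter_upwards [hC] with x hx s hs
  have ha := h.continuousOn_section hx₀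
  have hb := h.continuousOn_section hx.1
  have h1 : ‖transport (a x) s - transport (a x₀) s‖ ≤ C ^ 4 * ‖x - x₀‖ := by
    rw [transport_sub_transport ha hb hs]
    have h2 : ∀ r ∈ Icc (0 : ℝ) 1,
        ‖transportInv (a x₀) r * (a x₀ r - a x r) * transport (a x) r‖ ≤
          C * (C * ‖x - x₀‖) * C := fun r hr => by
      refine (norm_mul₃_le).trans ?_
      rw [norm_sub_rev (a x₀ r)]
      gcongr
      · exact (hC'.2 r hr).2.2.1
      · exact (hx.2 r hr).2.2.2
      · exact (hx.2 r hr).2.1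
    calc _ ≤ C * (C * (C * ‖x - x₀‖) * C) :=
          norm_mul_le_of_le (hC'.2 s hs).2.1 (norm_integral_le_of_norm_le h2 hs)
      _ = _ := by ring
  have h3 : transportInv (a x) s - transportInv (a x₀) s =
      -(transportInv (a x) s * (transport (a x) s - transport (a x₀) s) *
        transportInv (a x₀) s) := by
    rw [mul_sub, sub_mul, transportInv_mul_transport hb hs, mul_assoc,
      transport_mul_transportInv ha hs]
    simp
  refine ⟨h1.trans ?_, ?_⟩
  · gcongr
    exact le_add_of_nonneg_right (by positivity)
  · rw [h3, norm_neg]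
    calc _ ≤ C * (C ^ 4 * ‖x - x₀‖) * C := by
          refine (norm_mul₃_le).trans ?_
          gcongr
          · exact (hx.2 s hs).2.2.1
          · exact (hC'.2 s hs).2.2.1
      _ = C ^ 6 * ‖x - x₀‖ := by ring
      _ ≤ _ := by
          gcongr
          exact le_add_of_nonneg_left (by positivity)

lemma continuousAt_of_eventually_norm_sub_le {Y : Type*} [NormedAddCommGroup Y] {f : X → Y}
    {x₀ : X} {C : ℝ} (h : ∀ᶠ x in 𝓝 x₀, ‖f x - f x₀‖ ≤ C * ‖x - x₀‖) : ContinuousAt f x₀ := by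
  rw [ContinuousAt, tendsto_iff_norm_sub_tendsto_zero]
  refine squeeze_zero' (Eventually.of_forall fun _ => norm_nonneg _) h ?_
  have : Continuous fun x => C * ‖x - x₀‖ := by fun_prop
  simpa using this.tendsto x₀

lemma continuousAt_transport (h : IsC1Family V a a') {x₀ : X} (hx₀ : x₀ ∈ V) {s : ℝ}
    (hs : s ∈ Icc (0 : ℝ) 1) : ContinuousAt (fun x => transport (a x) s) x₀ := by
  obtain ⟨C, hC⟩ := h.eventually_lipschitz_transport hx₀
  exact continuousAt_of_eventually_norm_sub_le (hC.mono fun x hx => (hx s hs).1)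

lemma continuousAt_transportInv (h : IsC1Family V a a') {x₀ : X} (hx₀ : x₀ ∈ V) {s : ℝ}
    (hs : s ∈ Icc (0 : ℝ) 1) : ContinuousAt (fun x => transportInv (a x) s) x₀ := by
  obtain ⟨C, hC⟩ := h.eventually_lipschitz_transport hx₀
  exact continuousAt_of_eventually_norm_sub_le (hC.mono fun x hx => (hx s hs).2)

/-- The integral `∫_0^1 P(s)⁻¹ a'(s) P(s) ds` of the variation of the coefficients. -/
def variation (a : X → ℝ → E) (a' : X → ℝ → X →L[ℝ] E) (x : X) : X →L[ℝ] E :=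
  ∫ s in (0 : ℝ)..1,
    (ContinuousLinearMap.mulLeftRight ℝ E (transportInv (a x) s) (transport (a x) s)) ∘L a' x s

lemma continuousOn_variation_integrand (h : IsC1Family V a a') {x : X} (hx : x ∈ V) :
    ContinuousOn (fun s => (ContinuousLinearMap.mulLeftRight ℝ E (transportInv (a x) s)
      (transport (a x) s)) ∘L a' x s) (Icc 0 1) := by
  have ha := h.continuousOn_section hx
  exact (((ContinuousLinearMap.mulLeftRight ℝ E).continuous.comp_continuousOn
    (continuousOn_transportInv ha)).clm_apply (continuousOn_transport ha)).clm_comp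
      (h.continuousOn_deriv_section hx)

lemma variation_apply (h : IsC1Family V a a') {x : X} (hx : x ∈ V) (v : X) :
    variation a a' x v =
      ∫ s in (0 : ℝ)..1, transportInv (a x) s * a' x s v * transport (a x) s := by
  rw [variation, ContinuousLinearMap.intervalIntegral_apply
    (intervalIntegrable_of_continuousOn (h.continuousOn_variation_integrand hx) ⟨zero_le_one, le_rfl⟩)]
  rfl

lemma continuousOn_variation (h : IsC1Family V a a') : ContinuousOn (variation a a') V := by
  intro x₀ hx₀
  apply ContinuousAt.continuousWithinAt
  obtain ⟨C, hC0, hC⟩ := h.eventually_bound hx₀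
  have hsub : uIoc (0 : ℝ) 1 ⊆ Icc 0 1 := by
    rw [uIoc_of_le zero_le_one]; exact Ioc_subset_Icc_self
  apply intervalIntegral.continuousAt_of_dominated_interval
    (bound := fun _ => C * C * C)
  · filter_upwards [hC] with x hx
    exact ((h.continuousOn_variation_integrand hx.1).mono hsub).aestronglyMeasurable
      measurableSet_uIoc
  · filter_upwards [hC] with x hx
    refine ae_of_all _ fun s hs => ?_
    obtain ⟨h1, h2, h3, -⟩ := hx.2 s (hsub hs)
    refine (ContinuousLinearMap.opNorm_comp_le _ _).trans ?_
    gcongr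
    refine (ContinuousLinearMap.opNorm_mulLeftRight_apply_apply_le ℝ E _ _).trans ?_
    gcongr
  · exact intervalIntegrable_const
  · refine ae_of_all _ fun s hs => ?_
    have hs' := hsub hs
    have h1 : ContinuousAt (fun x => a' x s) x₀ :=
      (h.continuousOn_deriv.comp (f := fun x => (x, s)) (by fun_prop)
        fun x hx => ⟨hx, hs'⟩).continuousAt (h.isOpen.mem_nhds hx₀)
    exact (((ContinuousLinearMap.mulLeftRight ℝ E).continuous.continuousAt.comp
      (h.continuousAt_transportInv hx₀ hs')).clm_apply
        (h.continuousAt_transport hx₀ hs')).clm_comp h1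

/-- Duhamel's formula writes `P_x - P_{x₀}` as `P_{x₀}` times an integral whose integrand vanishes
at `x = x₀`. The integrand is differentiable there as soon as `P_x` is continuous in `x`, and the
Lipschitz bound permits differentiation under the integral. -/
lemma hasFDerivAt_transport (h : IsC1Family V a a') {x₀ : X} (hx₀ : x₀ ∈ V) :
    HasFDerivAt (fun x => transport (a x) 1)
      (-(ContinuousLinearMap.mul ℝ E (transport (a x₀) 1) ∘L variation a a' x₀)) x₀ := by
  have h1 : (1 : ℝ) ∈ Icc (0 : ℝ) 1 := ⟨zero_le_one, le_rfl⟩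
  have hsub : Ioc (0 : ℝ) 1 ⊆ Icc 0 1 := Ioc_subset_Icc_self
  obtain ⟨C, hC0, hC⟩ := h.eventually_bound hx₀
  have hC' := hC.self_of_nhds
  have ha := h.continuousOn_section hx₀
  set F : X → ℝ → E := fun x s =>
    transportInv (a x₀) s * (a x₀ s - a x s) * transport (a x) s with hF
  have hFc : ∀ x ∈ V, ContinuousOn (F x) (Icc 0 1) := fun x hx =>
    ((continuousOn_transportInv ha).mul (ha.sub (h.continuousOn_section hx))).mul
      (continuousOn_transport (h.continuousOn_section hx))
  have key : HasFDerivAt (fun x => ∫ s in (0 : ℝ)..1, F x s) (-variation a a' x₀) x₀ := by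
    simp only [variation, intervalIntegral.integral_of_le zero_le_one]
    rw [← MeasureTheory.integral_neg]
    refine (hasFDerivAt_integral_of_dominated_loc_of_lip' (𝕜 := ℝ) (F := F)
      (bound := fun _ => C * C * C) hC ?_ ?_ ?_ ?_ ?_ ?_).2
    · exact fun x hx => ((hFc x hx.1).mono hsub).aestronglyMeasurable measurableSet_Ioc
    · have : F x₀ = fun _ => 0 := by ext s; simp [hF]
      rw [this]
      exact integrable_zero _ _ _
    · exact ((h.continuousOn_variation_integrand hx₀).neg.mono hsub).aestronglyMeasurable
        measurableSet_Ioc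
    · refine (ae_restrict_iff' measurableSet_Ioc).2 (ae_of_all _ fun s hs x hx => ?_)
      have hs' := hsub hs
      have : F x₀ s = 0 := by simp [hF]
      rw [this, sub_zero]
      calc ‖F x s‖ ≤ C * (C * ‖x - x₀‖) * C := by
            refine (norm_mul₃_le).trans ?_
            rw [norm_sub_rev (a x₀ s)]
            gcongr
            · exact (hC'.2 s hs').2.2.1
            · exact (hx.2 s hs').2.2.2
            · exact (hx.2 s hs').2.1
        _ = _ := by ring
    · exact integrable_const _
    · refine (ae_restrict_iff' measurableSet_Ioc).2 (ae_of_all _ fun s hs => ?_)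
      have hs' := hsub hs
      have h2 := ((h.hasFDerivAt x₀ hx₀ s hs').const_sub (a x₀ s))
      have h3 := (ContinuousLinearMap.mul ℝ E (transportInv (a x₀) s)).hasFDerivAt.comp x₀ h2
      have h4 := hasFDerivAt_mul_of_eq_zero h3 (by simp)
        (h.continuousAt_transport hx₀ hs')
      convert! h4 using 1
      ext v
      simp
  have h5 := ((ContinuousLinearMap.mul ℝ E (transport (a x₀) 1)).hasFDerivAt.comp x₀
    key).add_const (transport (a x₀) 1)
  have h6 : -(ContinuousLinearMap.mul ℝ E (transport (a x₀) 1) ∘L variation a a' x₀) =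
      ContinuousLinearMap.mul ℝ E (transport (a x₀) 1) ∘L (-variation a a' x₀) := by
    ext v; simp
  rw [h6]
  refine h5.congr_of_eventuallyEq ?_
  filter_upwards [h.isOpen.mem_nhds hx₀] with x hx
  simp only [Function.comp, ContinuousLinearMap.mul_apply']
  rw [← transport_sub_transport ha (h.continuousOn_section hx) h1]
  simp

lemma continuousOn_transport_one (h : IsC1Family V a a') :
    ContinuousOn (fun x => transport (a x) 1) V := fun _ hx =>
  (h.hasFDerivAt_transport hx).continuousAt.continuousWithinAt

lemma continuousOn_transportInv_one (h : IsC1Family V a a') :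
    ContinuousOn (fun x => transportInv (a x) 1) V := fun _ hx =>
  (h.continuousAt_transportInv hx ⟨zero_le_one, le_rfl⟩).continuousWithinAt

lemma continuousOn_fderiv_transport (h : IsC1Family V a a') :
    ContinuousOn (fderiv ℝ fun x => transport (a x) 1) V := by
  have : ContinuousOn (fun x => -(ContinuousLinearMap.mul ℝ E (transport (a x) 1) ∘L
      variation a a' x)) V :=
    (((ContinuousLinearMap.mul ℝ E).continuous.comp_continuousOn
      h.continuousOn_transport_one).clm_comp h.continuousOn_variation).neg
  exact this.congr fun x hx => (h.hasFDerivAt_transport hx).fderiv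

lemma contDiffOn_transport (h : IsC1Family V a a') :
    ContDiffOn ℝ 1 (fun x => transport (a x) 1) V := by
  have h1 : (1 : WithTop ℕ∞) = 0 + 1 := by simp
  rw [h1, contDiffOn_succ_iff_fderiv_of_isOpen h.isOpen, contDiffOn_zero]
  refine ⟨fun x hx => (h.hasFDerivAt_transport hx).differentiableAt.differentiableWithinAt,
    by simp, h.continuousOn_fderiv_transport⟩

end IsC1Family

/-- A jointly `C¹` coefficient function is a `C¹` family. -/
lemma isC1Family_of_contDiffOn {V : Set X} (hV : IsOpen V) {h : X × ℝ → E}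
    (hh : ContDiffOn ℝ 1 h (V ×ˢ Icc 0 1)) :
    IsC1Family V (fun x s => h (x, s)) (fun x s =>
      (fderivWithin ℝ h (V ×ˢ Icc 0 1) (x, s)) ∘L ContinuousLinearMap.inl ℝ X ℝ) where
  isOpen := hV
  continuousOn := hh.continuousOn
  continuousOn_deriv := by
    have hu : UniqueDiffOn ℝ (V ×ˢ Icc (0 : ℝ) 1) :=
      hV.uniqueDiffOn.prod (uniqueDiffOn_Icc zero_lt_one)
    exact (hh.continuousOn_fderivWithin hu le_rfl).clm_comp continuousOn_const
  hasFDerivAt := fun x hx s hs => by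
    have h1 := (hh.differentiableOn one_ne_zero (x, s) ⟨hx, hs⟩).hasFDerivWithinAt
    have h2 : HasFDerivWithinAt (fun y : X => (y, s)) (ContinuousLinearMap.inl ℝ X ℝ) V x :=
      (hasFDerivAt_prodMk_left x s).hasFDerivWithinAt
    exact (h1.comp x h2 fun y hy => mk_mem_prod hy hs).hasFDerivAt (hV.mem_nhds hx)

end LinearODE

namespace OrderedExponential

open LinearODE UnitIntervalCalculus MeasureTheory

/-! ### The Banach algebra of square matrices -/

/-- Square real matrices with the `ℓ^∞` operator norm. -/
def NMat (n : ℕ) : Type := Matrix (Fin n) (Fin n) ℝ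

/-- The normed ring structure. It is deliberately not reducible, so that instances on `NMat n` are
never unfolded to those on matrices. -/
def NMat.normedRing (n : ℕ) : NormedRing (NMat n) := Matrix.linftyOpNormedRing

attribute [instance] NMat.normedRing

/-- The normed algebra structure. -/
def NMat.normedAlgebra (n : ℕ) : NormedAlgebra ℝ (NMat n) := Matrix.linftyOpNormedAlgebra

attribute [instance] NMat.normedAlgebra

instance (n : ℕ) : FiniteDimensional ℝ (NMat n) :=
  inferInstanceAs (FiniteDimensional ℝ (Matrix (Fin n) (Fin n) ℝ))
instance (n : ℕ) : CompleteSpace (NMat n) := FiniteDimensional.complete ℝ _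
instance (n : ℕ) : IsDedekindFiniteMonoid (NMat n) :=
  inferInstanceAs (IsDedekindFiniteMonoid (Matrix (Fin n) (Fin n) ℝ))

/-- The linear isomorphism of matrices with arrays of entries. -/
def entries (n : ℕ) : NMat n ≃L[ℝ] (Fin n → Fin n → ℝ) :=
  LinearEquiv.toContinuousLinearEquiv (LinearEquiv.refl ℝ (Fin n → Fin n → ℝ))

/-- The entries of a matrix as continuous linear maps. -/
def entry {n : ℕ} (i j : Fin n) : NMat n →L[ℝ] ℝ :=
  (ContinuousLinearMap.proj j : (Fin n → ℝ) →L[ℝ] ℝ) ∘L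
    (ContinuousLinearMap.proj i : (Fin n → Fin n → ℝ) →L[ℝ] (Fin n → ℝ)) ∘L
      (entries n : NMat n →L[ℝ] (Fin n → Fin n → ℝ))

/-- The topology of the operator norm and the entrywise topology agree by definition. -/
lemma hasSum_matrix {n : ℕ} {ι : Type*} {u : ι → NMat n} {v : NMat n} (h : HasSum u v) :
    HasSum (fun k => (u k : Matrix (Fin n) (Fin n) ℝ)) v := h

/-! ### Connection forms -/

variable {d n : ℕ}

local notation "𝕏" => EuclideanSpace ℝ (Fin d)

/-- The matrix-valued one-form with components `A μ`. -/
def form (A : Fin d → 𝕏 → NMat n) (p : 𝕏) : 𝕏 →L[ℝ] NMat n :=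
  ∑ μ, (EuclideanSpace.proj μ : 𝕏 →L[ℝ] ℝ).smulRight (A μ p)

lemma form_apply (A : Fin d → 𝕏 → NMat n) (p v : 𝕏) : form A p v = ∑ μ, v μ • A μ p := by
  simp [form]

lemma form_single (A : Fin d → 𝕏 → NMat n) (p : 𝕏) (μ : Fin d) :
    form A p (EuclideanSpace.single μ 1) = A μ p := by
  rw [form_apply, Finset.sum_eq_single μ]
  · simp
  · intro ν _ h; simp [h]
  · simp

lemma continuousOn_form {A : Fin d → 𝕏 → NMat n} {V : Set 𝕏} (hA : ∀ μ, ContinuousOn (A μ) V) :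
    ContinuousOn (form A) V := by
  unfold form
  exact continuousOn_finsetSum _ fun μ _ =>
    ((ContinuousLinearMap.smulRightL ℝ 𝕏 (NMat n) (EuclideanSpace.proj μ)).continuous
      |>.comp_continuousOn (hA μ))

lemma contDiffOn_form {A : Fin d → 𝕏 → NMat n} {V : Set 𝕏} {N : WithTop ℕ∞}
    (hA : ∀ μ, ContDiffOn ℝ N (A μ) V) : ContDiffOn ℝ N (form A) V := by
  unfold form
  exact ContDiffOn.sum fun μ _ =>
    ((ContinuousLinearMap.smulRightL ℝ 𝕏 (NMat n) (EuclideanSpace.proj μ)).contDiff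
      |>.comp_contDiffOn (hA μ))

/-- The iterated integrals of a connection as elements of `NMat n`. -/
def iterIntN (A : Fin d → 𝕏 → NMat n) (γ : ℝ → 𝕏) (k : ℕ) (u : ℝ) : NMat n :=
  iterInt (n := n) A γ k u

/-- The ordered exponential as an element of `NMat n`. -/
def orderedExpN (G : 𝕏 → Matrix (Fin d) (Fin d) ℝ) (V : Set 𝕏) (A : Fin d → 𝕏 → NMat n)
    (x y : 𝕏) : NMat n :=
  orderedExp (n := n) G V A x y

/-- The coefficient of the transport equation along a path. -/
def formAlong (𝒜 : 𝕏 → 𝕏 →L[ℝ] NMat n) (γ : ℝ → 𝕏) (s : ℝ) : NMat n :=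
  𝒜 (γ s) (derivWithin γ (Icc 0 1) s)

lemma formAlong_congr (𝒜 : 𝕏 → 𝕏 →L[ℝ] NMat n) {γ γ' : ℝ → 𝕏} (h : EqOn γ γ' (Icc 0 1)) :
    EqOn (formAlong 𝒜 γ) (formAlong 𝒜 γ') (Icc 0 1) := fun s hs => by
  simp only [formAlong]
  rw [h hs, derivWithin_congr h (h hs)]

variable {G : EuclideanSpace ℝ (Fin d) → Matrix (Fin d) (Fin d) ℝ}
  {V : Set (EuclideanSpace ℝ (Fin d))} {γ : ℝ → EuclideanSpace ℝ (Fin d)}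
  {x y z : EuclideanSpace ℝ (Fin d)}

lemma IsGeodesic.continuousOn (h : IsGeodesic G V γ y x) : ContinuousOn γ (Icc 0 1) :=
  h.contDiffOn.continuousOn

lemma IsGeodesic.continuousOn_derivWithin (h : IsGeodesic G V γ y x) :
    ContinuousOn (derivWithin γ (Icc 0 1)) (Icc 0 1) :=
  h.contDiffOn.continuousOn_derivWithin (uniqueDiffOn_Icc zero_lt_one) (by norm_num)

lemma IsGeodesic.continuousOn_formAlong (h : IsGeodesic G V γ y x) {𝒜 : 𝕏 → 𝕏 →L[ℝ] NMat n}
    (h𝒜 : ContinuousOn 𝒜 V) : ContinuousOn (formAlong 𝒜 γ) (Icc 0 1) :=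
  (h𝒜.comp h.continuousOn h.mem).clm_apply h.continuousOn_derivWithin

/-- One side integrates entry by entry, the other in the Banach algebra; the entries are continuous
linear functionals and so commute with the integral. -/
lemma iterInt_eq_picardIter {A : Fin d → 𝕏 → NMat n}
    (ha : ContinuousOn (formAlong (form A) γ) (Icc 0 1)) (k : ℕ) {u : ℝ}
    (hu : u ∈ Icc (0 : ℝ) 1) :
    iterIntN A γ k u = picardIter (formAlong (form A) γ) k u := by
  induction k generalizing u with
  | zero => rfl
  | succ k ih =>
    have hint := intervalIntegrable_of_continuousOn
      (ha.mul (continuousOn_picardIter ha k)) hu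
    refine Matrix.ext fun i j => ?_
    have h1 := (entry i j).intervalIntegral_comp_comm hint
    refine Eq.trans ?_ h1
    refine integral_congr_of_eqOn (fun s hs => ?_) hu
    have e : entry i j (formAlong (form A) γ s * picardIter (formAlong (form A) γ) k s) =
        entry i j ((∑ μ, derivWithin γ (Icc 0 1) s μ • A μ (γ s)) * iterIntN A γ k s) := by
      rw [ih hs, ← form_apply]
      rfl
    exact e.symm

lemma IsGeodesic.hasSum_iterInt (h : IsGeodesic G V γ y x) {A : Fin d → 𝕏 → NMat n}
    (hA : ∀ μ, ContinuousOn (A μ) V) :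
    HasSum (fun k : ℕ => ((-1 : ℝ) ^ k • iterIntN A γ k 1 : NMat n))
      (transport (formAlong (form A) γ) 1) := by
  have ha := h.continuousOn_formAlong (continuousOn_form hA)
  have h1 : (1 : ℝ) ∈ Icc (0 : ℝ) 1 := ⟨zero_le_one, le_rfl⟩
  convert! hasSum_transport ha h1 using 3 with k
  exact iterInt_eq_picardIter ha k h1

lemma IsConvexDomain.eqOn (hV : IsConvexDomain G V) {γ' : ℝ → 𝕏} (hy : y ∈ V) (hx : x ∈ V)
    (h : IsGeodesic G V γ y x) (h' : IsGeodesic G V γ' y x) : EqOn γ γ' (Icc 0 1) := by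
  obtain ⟨-, c, -, hc⟩ := hV
  exact ((hc y hy x hx).2 γ h).trans ((hc y hy x hx).2 γ' h').symm

lemma orderedExp_of_exists
    {A : Fin d → EuclideanSpace ℝ (Fin d) → Matrix (Fin n) (Fin n) ℝ}
    (h : ∃ γ, IsGeodesic G V γ y x) :
    orderedExp G V A x y = ∑' k : ℕ, (-1 : ℝ) ^ k • iterInt A h.choose k 1 := by
  rw [orderedExp, dif_pos h]

/-- The geodesic chosen in the definition does not matter, because geodesics with given end points
are unique in a convex domain. -/
lemma IsConvexDomain.orderedExp_eq (hV : IsConvexDomain G V) (hy : y ∈ V) (hx : x ∈ V)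
    (h : IsGeodesic G V γ y x) {A : Fin d → 𝕏 → NMat n} (hA : ∀ μ, ContinuousOn (A μ) V) :
    orderedExpN G V A x y = transport (formAlong (form A) γ) 1 := by
  have hex : ∃ γ, IsGeodesic G V γ y x := ⟨γ, h⟩
  have h1 : (1 : ℝ) ∈ Icc (0 : ℝ) 1 := ⟨zero_le_one, le_rfl⟩
  have h2 := hasSum_matrix (hex.choose_spec.hasSum_iterInt hA)
  rw [transport_congr (formAlong_congr _ (hV.eqOn hy hx h hex.choose_spec)) h1]
  exact (orderedExp_of_exists hex).trans h2.tsum_eq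

/-! ### Reversal of geodesics -/

lemma mapsTo_one_sub : MapsTo (fun s : ℝ => 1 - s) (Icc 0 1) (Icc 0 1) := fun s hs =>
  ⟨by linarith [hs.2], by linarith [hs.1]⟩

lemma derivWithin_comp_one_sub {γ : ℝ → 𝕏} (h : DifferentiableOn ℝ γ (Icc 0 1)) {s : ℝ}
    (hs : s ∈ Icc (0 : ℝ) 1) :
    derivWithin (fun s => γ (1 - s)) (Icc 0 1) s = -derivWithin γ (Icc 0 1) (1 - s) := by
  have h1 := (h (1 - s) (mapsTo_one_sub hs)).hasDerivWithinAt.scomp s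
    ((hasDerivWithinAt_id s (Icc 0 1)).const_sub 1) mapsTo_one_sub
  refine (h1.derivWithin (uniqueDiffOn_Icc zero_lt_one s hs)).trans ?_
  simp

lemma iteratedDerivWithin_two (γ : ℝ → 𝕏) (s : ℝ) :
    iteratedDerivWithin 2 γ (Icc 0 1) s =
      derivWithin (derivWithin γ (Icc 0 1)) (Icc 0 1) s := by
  rw [iteratedDerivWithin_succ, iteratedDerivWithin_one]

/-- The second derivative and the quadratic term in the velocity are both even under `s ↦ 1 - s`. -/
lemma IsGeodesic.reverse (h : IsGeodesic G V γ y x) :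
    IsGeodesic G V (fun s => γ (1 - s)) x y where
  contDiffOn := h.contDiffOn.comp (by fun_prop) mapsTo_one_sub
  mem := fun s hs => h.mem _ (mapsTo_one_sub hs)
  source := by simp [h.target]
  target := by simp [h.source]
  equation := fun s hs ρ => by
    have hu := uniqueDiffOn_Icc (zero_lt_one (α := ℝ))
    have h1 : EqOn (derivWithin (fun s => γ (1 - s)) (Icc 0 1))
        (fun s => -derivWithin γ (Icc 0 1) (1 - s)) (Icc 0 1) := fun r hr =>
      derivWithin_comp_one_sub (h.contDiffOn.differentiableOn (by norm_num)) hr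
    have hd : DifferentiableOn ℝ (derivWithin γ (Icc 0 1)) (Icc 0 1) :=
      (h.contDiffOn.derivWithin hu (m := 1) (by norm_num)).differentiableOn (by norm_num)
    have h2 : derivWithin (fun s => -derivWithin γ (Icc 0 1) (1 - s)) (Icc 0 1) s =
        iteratedDerivWithin 2 γ (Icc 0 1) (1 - s) := by
      rw [iteratedDerivWithin_two, derivWithin.fun_neg, derivWithin_comp_one_sub hd hs, neg_neg]
    rw [iteratedDerivWithin_two, derivWithin_congr h1 (h1 hs), h2, h1 hs]
    simpa using h.equation _ (mapsTo_one_sub hs) ρ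

lemma IsConvexDomain.orderedExp_reverse (hV : IsConvexDomain G V) (hy : y ∈ V) (hx : x ∈ V)
    (h : IsGeodesic G V γ y x) {A : Fin d → 𝕏 → NMat n} (hA : ∀ μ, ContinuousOn (A μ) V) :
    orderedExpN G V A y x = transportInv (formAlong (form A) γ) 1 := by
  rw [hV.orderedExp_eq hx hy h.reverse hA,
    ← transport_reverse (h.continuousOn_formAlong (continuousOn_form hA))]
  refine transport_congr (fun s hs => ?_) ⟨zero_le_one, le_rfl⟩
  simp only [formAlong]
  rw [derivWithin_comp_one_sub (h.contDiffOn.differentiableOn (by norm_num)) hs, map_neg]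

/-! ### Smooth dependence on the end point -/

/-- The velocity is a partial derivative of the jointly smooth family of geodesics, so the
coefficient is jointly `C¹` in end point and time. It agrees with `formAlong` only for `x ∈ V` and
`s ∈ [0,1]`, hence the existential form. -/
lemma isC1Family_formAlong {c : ℝ → 𝕏 → 𝕏} (hVo : IsOpen V)
    (hc : ContDiffOn ℝ ∞ (fun p : 𝕏 × ℝ => c p.2 p.1) (V ×ˢ Icc 0 1))
    (hmem : ∀ x ∈ V, ∀ s ∈ Icc (0 : ℝ) 1, c s x ∈ V) {𝒜 : 𝕏 → 𝕏 →L[ℝ] NMat n}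
    (h𝒜 : ContDiffOn ℝ ∞ 𝒜 V) :
    ∃ a a', IsC1Family V a a' ∧
      ∀ x ∈ V, EqOn (a x) (formAlong 𝒜 fun s => c s x) (Icc 0 1) := by
  have hu : UniqueDiffOn ℝ (V ×ˢ Icc (0 : ℝ) 1) :=
    hVo.uniqueDiffOn.prod (uniqueDiffOn_Icc zero_lt_one)
  set h : 𝕏 × ℝ → NMat n := fun p => 𝒜 (c p.2 p.1)
    (fderivWithin ℝ (fun p : 𝕏 × ℝ => c p.2 p.1) (V ×ˢ Icc 0 1) p (0, 1)) with hh
  have hsm : ContDiffOn ℝ 1 h (V ×ˢ Icc 0 1) := by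
    have h1 : ContDiffOn ℝ 1 (fun p : 𝕏 × ℝ => 𝒜 (c p.2 p.1)) (V ×ˢ Icc 0 1) :=
      (h𝒜.of_le (mod_cast le_top)).comp (hc.of_le (mod_cast le_top)) fun p hp => hmem _ hp.1 _ hp.2
    have h2 := hc.fderivWithin hu (m := 1) (WithTop.coe_le_coe.2 le_top)
    exact h1.clm_apply (h2.clm_apply contDiffOn_const)
  refine ⟨_, _, isC1Family_of_contDiffOn hVo hsm, fun x hx s hs => ?_⟩
  have h3 := (hc.differentiableOn (by simp) (x, s) ⟨hx, hs⟩).hasFDerivWithinAt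
  have h4 : HasDerivWithinAt (fun s : ℝ => (x, s)) ((0 : 𝕏), (1 : ℝ)) (Icc 0 1) s :=
    (hasDerivWithinAt_const s _ x).prodMk (hasDerivWithinAt_id s _)
  have h5 := h3.comp_hasDerivWithinAt s h4 fun r hr => mk_mem_prod hx hr
  have h6 : derivWithin (fun s => c s x) (Icc 0 1) s = _ :=
    h5.derivWithin (uniqueDiffOn_Icc zero_lt_one s hs)
  simp only [formAlong, hh]
  rw [h6]

lemma IsConvexDomain.exists_isC1Family (hV : IsConvexDomain G V) {A : Fin d → 𝕏 → NMat n}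
    (hA : ∀ μ, ContDiffOn ℝ ∞ (A μ) V) (hz : z ∈ V) :
    ∃ a a', IsC1Family V a a' ∧
      (∀ x ∈ V, orderedExpN G V A x z = transport (a x) 1) ∧
      ∀ x ∈ V, orderedExpN G V A z x = transportInv (a x) 1 := by
  have hAc : ∀ μ, ContinuousOn (A μ) V := fun μ => (hA μ).continuousOn
  have h1 : (1 : ℝ) ∈ Icc (0 : ℝ) 1 := ⟨zero_le_one, le_rfl⟩
  obtain ⟨hVo, c, hc, hgeo⟩ := id hV
  obtain ⟨a, a', hfam, ha⟩ := isC1Family_formAlong (c := fun s x => c s z x) hVo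
    (hc.comp (f := fun p : 𝕏 × ℝ => (p.2, z, p.1)) (by fun_prop)
      fun p hp => ⟨hp.2, hz, hp.1⟩)
    (fun x hx s hs => (hgeo z hz x hx).1.mem s hs) (contDiffOn_form hA)
  refine ⟨a, a', hfam, fun x hx => ?_, fun x hx => ?_⟩
  · rw [hV.orderedExp_eq hz hx (hgeo z hz x hx).1 hAc, transport_congr (ha x hx) h1]
  · rw [hV.orderedExp_reverse hz hx (hgeo z hz x hx).1 hAc, transportInv_congr (ha x hx) h1]

end OrderedExponential

namespace OrderedExponential

open LinearODE UnitIntervalCalculus MeasureTheory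

variable {d n : ℕ}

local notation "𝕏" => EuclideanSpace ℝ (Fin d)

variable {G : EuclideanSpace ℝ (Fin d) → Matrix (Fin d) (Fin d) ℝ}
  {V : Set (EuclideanSpace ℝ (Fin d))} {γ : ℝ → EuclideanSpace ℝ (Fin d)}
  {x y z : EuclideanSpace ℝ (Fin d)}

/-! ### The gauge-transformed connection and the triple product -/

/-- The entrywise partial derivative as an element of `NMat n`. -/
def pdN (μ : Fin d) (H : 𝕏 → NMat n) (x : 𝕏) : NMat n := pdMat (n := n) μ H x

lemma pdN_eq {x : 𝕏} {H : 𝕏 → NMat n} (hH : DifferentiableAt ℝ H x) (μ : Fin d) :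
    pdN μ H x = fderiv ℝ H x (EuclideanSpace.single μ 1) := by
  refine Matrix.ext fun i j => ?_
  have h := (entry i j).hasFDerivAt.comp x hH.hasFDerivAt
  exact congrArg (fun L : 𝕏 →L[ℝ] ℝ => L (EuclideanSpace.single μ 1)) h.fderiv

/-- The gauge-transformed connection as an element of `NMat n`. -/
def fockSchwingerN (G : 𝕏 → Matrix (Fin d) (Fin d) ℝ) (V : Set 𝕏) (A : Fin d → 𝕏 → NMat n)
    (z : 𝕏) (σ : Fin d) (x : 𝕏) : NMat n :=
  fockSchwinger (n := n) G V A z σ x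

lemma fockSchwingerN_def (G : 𝕏 → Matrix (Fin d) (Fin d) ℝ) (V : Set 𝕏) (A : Fin d → 𝕏 → NMat n)
    (z : 𝕏) (σ : Fin d) (x : 𝕏) :
    fockSchwingerN G V A z σ x = orderedExpN G V A z x *
      (pdN σ (fun p => orderedExpN G V A p z) x + A σ x * orderedExpN G V A x z) := rfl

lemma map_eq_sum_single {Y : Type*} [NormedAddCommGroup Y] [NormedSpace ℝ Y] (L : 𝕏 →L[ℝ] Y)
    (v : 𝕏) : L v = ∑ μ, v μ • L (EuclideanSpace.single μ 1) := by
  have hv : v = ∑ μ, v μ • EuclideanSpace.single μ (1 : ℝ) := by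
    ext ν
    simp [Finset.sum_apply, Pi.single_apply]
  conv_lhs => rw [hv]
  simp

lemma fockSchwingerN_eq {A : Fin d → 𝕏 → NMat n} {a : 𝕏 → ℝ → NMat n}
    {a' : 𝕏 → ℝ → 𝕏 →L[ℝ] NMat n} (hfam : IsC1Family V a a')
    (h1 : ∀ x ∈ V, orderedExpN G V A x z = transport (a x) 1)
    (h2 : ∀ x ∈ V, orderedExpN G V A z x = transportInv (a x) 1) (hx : x ∈ V) (v : 𝕏) :
    form (fockSchwingerN G V A z) x v = transportInv (a x) 1 *
      (fderiv ℝ (fun x => transport (a x) 1) x v + form A x v * transport (a x) 1) := by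
  have he : (fun p => orderedExpN G V A p z) =ᶠ[𝓝 x] fun x => transport (a x) 1 := by
    filter_upwards [hfam.isOpen.mem_nhds hx] with p hp using h1 p hp
  have hd := (hfam.hasFDerivAt_transport hx).differentiableAt
  have h3 : ∀ σ, fockSchwingerN G V A z σ x = transportInv (a x) 1 *
      (fderiv ℝ (fun x => transport (a x) 1) x (EuclideanSpace.single σ 1) +
        A σ x * transport (a x) 1) := fun σ => by
    rw [fockSchwingerN_def, pdN_eq (hd.congr_of_eventuallyEq he), he.fderiv_eq, h1 x hx, h2 x hx]
  rw [form_apply, form_apply, map_eq_sum_single (fderiv ℝ (fun x => transport (a x) 1) x) v]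
  simp only [h3, Finset.sum_mul, ← Finset.sum_add_distrib, Finset.mul_sum, smul_mul_assoc,
    ← smul_add, mul_smul_comm]

lemma IsConvexDomain.continuousOn_fockSchwingerN (hV : IsConvexDomain G V)
    {A : Fin d → 𝕏 → NMat n} (hA : ∀ μ, ContDiffOn ℝ ∞ (A μ) V) (hz : z ∈ V) (σ : Fin d) :
    ContinuousOn (fockSchwingerN G V A z σ) V := by
  obtain ⟨a, a', hfam, h1, h2⟩ := hV.exists_isC1Family hA hz
  have h3 : ContinuousOn (fun x => transportInv (a x) 1 *
      (fderiv ℝ (fun x => transport (a x) 1) x (EuclideanSpace.single σ 1) +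
        A σ x * transport (a x) 1)) V :=
    hfam.continuousOn_transportInv_one.mul
      ((hfam.continuousOn_fderiv_transport.clm_apply continuousOn_const).add
        ((hA σ).continuousOn.mul hfam.continuousOn_transport_one))
  refine h3.congr fun x hx => ?_
  rw [← form_single (fockSchwingerN G V A z), fockSchwingerN_eq hfam h1 h2 hx, form_single]

lemma IsConvexDomain.exists_isGeodesic (hV : IsConvexDomain G V) (hy : y ∈ V) (hx : x ∈ V) :
    ∃ γ, IsGeodesic G V γ y x := by
  obtain ⟨-, c, -, hc⟩ := hV
  exact ⟨_, (hc y hy x hx).1⟩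

lemma IsConvexDomain.contDiffOn_orderedExpN (hV : IsConvexDomain G V)
    {A : Fin d → 𝕏 → NMat n} (hA : ∀ μ, ContDiffOn ℝ ∞ (A μ) V) (hz : z ∈ V) :
    ContDiffOn ℝ 1 (fun x => orderedExpN G V A x z) V := by
  obtain ⟨a, a', hfam, h1, -⟩ := hV.exists_isC1Family hA hz
  exact hfam.contDiffOn_transport.congr h1

/-- With `P(p) = Φ(p,z)` the definition of `f` says `dP + A P = P f`. For the transport `T` of `f`
along the geodesic, `(P T)' = (P f - A P) T - P f T = -A P T`, so `P T` is the transport of `A`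
applied to the initial value `Φ(y,z)`. -/
lemma IsConvexDomain.triple_product (hV : IsConvexDomain G V)
    {A : Fin d → 𝕏 → NMat n} (hA : ∀ μ, ContDiffOn ℝ ∞ (A μ) V) (hx : x ∈ V) (hy : y ∈ V)
    (hz : z ∈ V) :
    orderedExpN G V A z x * orderedExpN G V A x y * orderedExpN G V A y z =
      orderedExpN G V (fockSchwingerN G V A z) x y := by
  obtain ⟨a, a', hfam, hP, hQ⟩ := hV.exists_isC1Family hA hz
  obtain ⟨γ, hγ⟩ := hV.exists_isGeodesic hy hx
  have h1 : (1 : ℝ) ∈ Icc (0 : ℝ) 1 := ⟨zero_le_one, le_rfl⟩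
  have hAc : ∀ μ, ContinuousOn (A μ) V := fun μ => (hA μ).continuousOn
  have hfc := hV.continuousOn_fockSchwingerN hA hz
  have hα := hγ.continuousOn_formAlong (continuousOn_form hAc)
  have hβ := hγ.continuousOn_formAlong (continuousOn_form hfc)
  rw [hV.orderedExp_eq hy hx hγ hAc, hV.orderedExp_eq hy hx hγ hfc, hQ x hx, hP y hy]
  have key := eq_transport_mul (W := fun s => transport (a (γ s)) 1 *
      transport (formAlong (form (fockSchwingerN G V A z)) γ) s) hα (fun s hs => by
    have hd := (hfam.hasFDerivAt_transport (hγ.mem s hs)).differentiableAt.hasFDerivAt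
    have hγd := ((hγ.contDiffOn.differentiableOn (by norm_num)) s hs).hasDerivWithinAt
    have h3 := (hd.comp_hasDerivWithinAt s hγd).mul (hasDerivWithinAt_transport hβ hs)
    convert! h3 using 1
    simp only [formAlong, Function.comp]
    rw [fockSchwingerN_eq hfam hP hQ (hγ.mem s hs)]
    -- The factor `Φ(z,x)` in the definition of `f` cancels against `P`.
    have h4 := transport_mul_transportInv (hfam.continuousOn_section (hγ.mem s hs)) h1
    simp only [mul_neg, ← mul_assoc, h4, one_mul]
    noncomm_ring) h1
  simp only [hγ.source, hγ.target, transport_zero, mul_one] at key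
  rw [mul_assoc, ← key, ← mul_assoc,
    transportInv_mul_transport (hfam.continuousOn_section hx) h1, one_mul]

end OrderedExponential

namespace FockSchwingerGauge

open LinearODE UnitIntervalCalculus MeasureTheory

variable {E : Type*} [NormedRing E] [NormedAlgebra ℝ E]
variable {X : Type*} [NormedAddCommGroup X] [NormedSpace ℝ X]

/-! ### Curvature and covariant derivatives -/

/-- The wedge product `(α, β) ↦ ((u, v) ↦ α u * β v)` of algebra-valued one-forms. -/
def formMul (α β : X →L[ℝ] E) : X →L[ℝ] X →L[ℝ] E :=
  ((ContinuousLinearMap.compL ℝ X E E).flip β) ∘L (ContinuousLinearMap.mul ℝ E ∘L α)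

/-- The curvature `d𝒜 + 𝒜 ∧ 𝒜` of a connection form. -/
def curvature (𝒜 : X → X →L[ℝ] E) (p : X) : X →L[ℝ] X →L[ℝ] E :=
  fderiv ℝ 𝒜 p - (fderiv ℝ 𝒜 p).flip + (formMul (𝒜 p) (𝒜 p) - (formMul (𝒜 p) (𝒜 p)).flip)

lemma curvature_apply (𝒜 : X → X →L[ℝ] E) (p u v : X) :
    curvature 𝒜 p u v = fderiv ℝ 𝒜 p u v - fderiv ℝ 𝒜 p v u +
      (𝒜 p u * 𝒜 p v - 𝒜 p v * 𝒜 p u) := rfl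

/-- The covariant derivative of an algebra-valued function in the direction `w`. -/
def cov (𝒜 : X → X →L[ℝ] E) (w : X) (H : X → E) (p : X) : E :=
  fderiv ℝ H p w + (𝒜 p w * H p - H p * 𝒜 p w)

lemma contDiff_flip {M : WithTop ℕ∞} :
    ContDiff ℝ M fun T : X →L[ℝ] X →L[ℝ] E => T.flip := by
  have h : IsBoundedLinearMap ℝ fun T : X →L[ℝ] X →L[ℝ] E => T.flip :=
    { map_add := fun _ _ => rfl
      map_smul := fun _ _ => rfl
      bound := ⟨1, one_pos, fun T => by rw [ContinuousLinearMap.opNorm_flip, one_mul]⟩ }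
  exact h.contDiff

lemma contDiffOn_formMul {𝒜 ℬ : X → X →L[ℝ] E} {V : Set X} {M : WithTop ℕ∞}
    (h : ContDiffOn ℝ M 𝒜 V) (h' : ContDiffOn ℝ M ℬ V) :
    ContDiffOn ℝ M (fun p => formMul (𝒜 p) (ℬ p)) V := by
  have h1 : ContDiffOn ℝ M (fun p => (ContinuousLinearMap.compL ℝ X E E).flip (ℬ p)) V :=
    ContDiff.comp_contDiffOn (g := fun β : X →L[ℝ] E => (ContinuousLinearMap.compL ℝ X E E).flip β)
      (by exact ContinuousLinearMap.contDiff _) h'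
  have h2 : ContDiffOn ℝ M (fun p => ContinuousLinearMap.mul ℝ E ∘L 𝒜 p) V :=
    contDiffOn_const.clm_comp h
  exact h1.clm_comp h2

lemma contDiffOn_curvature {𝒜 : X → X →L[ℝ] E} {V : Set X} {N M : WithTop ℕ∞} (hV : IsOpen V)
    (h : ContDiffOn ℝ N 𝒜 V) (hN : M + 1 ≤ N) : ContDiffOn ℝ M (curvature 𝒜) V := by
  have h1 : ContDiffOn ℝ M (fderiv ℝ 𝒜) V := h.fderiv_of_isOpen hV hN
  have h2 : ContDiffOn ℝ M 𝒜 V := h.of_le (le_self_add.trans hN)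
  have h3 := contDiffOn_formMul h2 h2
  have h4 : ContDiffOn ℝ M (fun p => (fderiv ℝ 𝒜 p).flip) V := contDiff_flip.comp_contDiffOn h1
  have h5 : ContDiffOn ℝ M (fun p => (formMul (𝒜 p) (𝒜 p)).flip) V :=
    contDiff_flip.comp_contDiffOn h3
  unfold curvature
  exact ContDiffOn.add (ContDiffOn.sub h1 h4) (ContDiffOn.sub h3 h5)

lemma contDiffOn_cov {𝒜 : X → X →L[ℝ] E} {V : Set X} (hV : IsOpen V)
    (h : ContDiffOn ℝ ∞ 𝒜 V) (w : X) {H : X → E} (hH : ContDiffOn ℝ ∞ H V) :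
    ContDiffOn ℝ ∞ (cov 𝒜 w H) V := by
  have h1 : ContDiffOn ℝ ∞ (fderiv ℝ H) V := hH.fderiv_of_isOpen hV (by simp)
  have h2 := h.clm_apply (contDiffOn_const (c := w))
  exact (h1.clm_apply contDiffOn_const).add ((h2.mul hH).sub (hH.mul h2))

lemma contDiffOn_cov_iterate {𝒜 : X → X →L[ℝ] E} {V : Set X} (hV : IsOpen V)
    (h : ContDiffOn ℝ ∞ 𝒜 V) (w : X) {H : X → E} (hH : ContDiffOn ℝ ∞ H V) (j : ℕ) :
    ContDiffOn ℝ ∞ ((cov 𝒜 w)^[j] H) V := by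
  induction j with
  | zero => exact hH
  | succ j ih =>
    rw [Function.iterate_succ_apply']
    exact contDiffOn_cov hV h w ih

variable [CompleteSpace E] [IsDedekindFiniteMonoid E]

/-! ### Transport along straight lines -/

/-- The coefficient of the transport equation along the segment from `z` to `x`. -/
def radial (𝒜 : X → X →L[ℝ] E) (z x : X) (s : ℝ) : E := 𝒜 (z + s • (x - z)) (x - z)

/-- The derivative of `radial` with respect to the end point. -/
def radialDeriv (𝒜 : X → X →L[ℝ] E) (z x : X) (s : ℝ) : X →L[ℝ] E :=
  s • (fderiv ℝ 𝒜 (z + s • (x - z))).flip (x - z) + 𝒜 (z + s • (x - z))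

lemma isC1Family_radial {𝒜 : X → X →L[ℝ] E} {V : Set X} (hV : IsOpen V)
    (h : ContDiffOn ℝ ∞ 𝒜 V) {z : X}
    (hz : ∀ x ∈ V, ∀ s ∈ Icc (0 : ℝ) 1, z + s • (x - z) ∈ V) :
    IsC1Family V (radial 𝒜 z) (radialDeriv 𝒜 z) := by
  have hmaps : MapsTo (fun p : X × ℝ => z + p.2 • (p.1 - z)) (V ×ˢ Icc 0 1) V :=
    fun p hp => hz _ hp.1 _ hp.2
  have hline : ContinuousOn (fun p : X × ℝ => z + p.2 • (p.1 - z)) (V ×ˢ Icc 0 1) := by fun_prop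
  have h𝒜 := h.continuousOn.comp hline hmaps
  have hd𝒜 := (h.continuousOn_fderiv_of_isOpen hV (by simp)).comp hline hmaps
  refine ⟨hV, ?_, ?_, fun x hx s hs => ?_⟩
  · exact h𝒜.clm_apply (by fun_prop)
  · have hflip := (ContinuousLinearMap.flipₗᵢ ℝ X X E).continuous.comp_continuousOn hd𝒜
    exact (continuousOn_snd.smul (hflip.clm_apply (by fun_prop))).add h𝒜
  · have h1 : HasFDerivAt (fun x => z + s • (x - z)) (s • ContinuousLinearMap.id ℝ X) x := by
      simpa using (((hasFDerivAt_id x).sub_const z).const_smul s).const_add z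
    have h2 := ((h.differentiableOn (by simp) _ (hz x hx s hs)).differentiableAt
      (hV.mem_nhds (hz x hx s hs))).hasFDerivAt.comp x h1
    have h3 := h2.clm_apply ((hasFDerivAt_id x).sub_const z)
    convert! h3 using 1
    ext v
    simp [radialDeriv, add_comm]

lemma hasDerivWithinAt_line (z w : X) (s : ℝ) :
    HasDerivWithinAt (fun s : ℝ => z + s • w) w (Icc 0 1) s := by
  simpa using ((hasDerivWithinAt_id s (Icc 0 1)).smul_const w).const_add z

/-- Conjugating by the transport turns the covariant derivative into an ordinary one. -/
lemma hasDerivWithinAt_conj {𝒜 : X → X →L[ℝ] E} {z x : X} {H : X → E} {s : ℝ}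
    (ha : ContinuousOn (radial 𝒜 z x) (Icc 0 1)) (hs : s ∈ Icc (0 : ℝ) 1)
    (hH : DifferentiableAt ℝ H (z + s • (x - z))) :
    HasDerivWithinAt (fun s => transportInv (radial 𝒜 z x) s * H (z + s • (x - z)) *
        transport (radial 𝒜 z x) s)
      (transportInv (radial 𝒜 z x) s * cov 𝒜 (x - z) H (z + s • (x - z)) *
        transport (radial 𝒜 z x) s) (Icc 0 1) s := by
  have h1 := hH.hasFDerivAt.comp_hasDerivWithinAt s (hasDerivWithinAt_line z (x - z) s)
  convert! ((hasDerivWithinAt_transportInv ha hs).mul h1).mul (hasDerivWithinAt_transport ha hs)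
    using 1
  simp only [cov, radial, Function.comp, Pi.mul_apply]
  noncomm_ring

/-- The connection in Fock–Schwinger gauge in terms of the curvature. -/
def gaugePotential (𝒜 : X → X →L[ℝ] E) (z x v : X) : E :=
  ∫ s in (0 : ℝ)..1, s • (transportInv (radial 𝒜 z x) s *
    curvature 𝒜 (z + s • (x - z)) (x - z) v * transport (radial 𝒜 z x) s)

/-- Integration by parts. With `w = x - z`, the variation formula gives `Q dP(v) = -∫ Q (s ∂_v𝒜(w) +
𝒜(v)) P`, whereas `(s Q 𝒜(v) P)' = Q (𝒜(v) + s (∂_w𝒜(v) + [𝒜(w), 𝒜(v)])) P`. The two integrands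
combine to `s Q F(w,v) P`, and the boundary value at `s = 1` is the term `Q 𝒜(v) P` of the gauge
transform. -/
lemma gaugePotential_eq {𝒜 : X → X →L[ℝ] E} {V : Set X} (hV : IsOpen V)
    (h : ContDiffOn ℝ ∞ 𝒜 V) {z : X}
    (hz : ∀ x ∈ V, ∀ s ∈ Icc (0 : ℝ) 1, z + s • (x - z) ∈ V) {x : X} (hx : x ∈ V) (v : X) :
    transportInv (radial 𝒜 z x) 1 *
      (fderiv ℝ (fun x => transport (radial 𝒜 z x) 1) x v +
        𝒜 x v * transport (radial 𝒜 z x) 1) = gaugePotential 𝒜 z x v := by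
  have h1 : (1 : ℝ) ∈ Icc (0 : ℝ) 1 := ⟨zero_le_one, le_rfl⟩
  have hfam := isC1Family_radial hV h hz
  have ha := hfam.continuousOn_section hx
  have hQ := continuousOn_transportInv ha
  have hP := continuousOn_transport ha
  have hline : ContinuousOn (fun s : ℝ => z + s • (x - z)) (Icc 0 1) := by fun_prop
  have hcurv : ContinuousOn (fun s : ℝ => curvature 𝒜 (z + s • (x - z)) (x - z) v) (Icc 0 1) :=
    (((contDiffOn_curvature hV h (M := 0) (by simp)).continuousOn.comp hline
      (hz x hx)).clm_apply continuousOn_const).clm_apply continuousOn_const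
  have hvar : ContinuousOn (fun s : ℝ => radialDeriv 𝒜 z x s v) (Icc 0 1) :=
    (hfam.continuousOn_deriv_section hx).clm_apply continuousOn_const
  set P := transport (radial 𝒜 z x) with hPdef
  set Q := transportInv (radial 𝒜 z x) with hQdef
  have hi1 : IntervalIntegrable (fun s => Q s * radialDeriv 𝒜 z x s v * P s) volume 0 1 :=
    intervalIntegrable_of_continuousOn ((hQ.mul hvar).mul hP) h1
  have hi2 : IntervalIntegrable (fun s => s • (Q s *
      curvature 𝒜 (z + s • (x - z)) (x - z) v * P s)) volume 0 1 :=
    intervalIntegrable_of_continuousOn (continuousOn_id.smul ((hQ.mul hcurv).mul hP)) h1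
  have hftc := integral_eq_sub_of_hasDerivWithinAt
    (G := fun s => s • (Q s * 𝒜 (z + s • (x - z)) v * P s))
    (g := fun s => Q s * radialDeriv 𝒜 z x s v * P s + s • (Q s *
      curvature 𝒜 (z + s • (x - z)) (x - z) v * P s)) (fun s hs => by
    have hd := (h.differentiableOn (by simp) _ (hz x hx s hs)).differentiableAt
      (hV.mem_nhds (hz x hx s hs))
    have h2 : DifferentiableAt ℝ (fun p => 𝒜 p v) (z + s • (x - z)) :=
      hd.clm_apply (differentiableAt_const v)
    have h3 := (hasDerivWithinAt_id s (Icc 0 1)).smul (hasDerivWithinAt_conj ha hs h2)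
    convert! h3 using 1
    have h4 : fderiv ℝ (fun p => 𝒜 p v) (z + s • (x - z)) (x - z) =
        fderiv ℝ 𝒜 (z + s • (x - z)) (x - z) v := by
      have := (hd.hasFDerivAt.clm_apply (hasFDerivAt_const v _)).fderiv
      rw [this]
      simp
    simp only [curvature_apply, cov, h4, radialDeriv, id, add_apply,
      smul_apply, ContinuousLinearMap.flip_apply, one_smul, ← hPdef, ← hQdef]
    simp only [mul_add, add_mul, mul_sub, sub_mul, smul_add, smul_sub, mul_smul_comm,
      smul_mul_assoc]
    abel) (((hQ.mul hvar).mul hP).add (continuousOn_id.smul ((hQ.mul hcurv).mul hP))) h1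
  rw [intervalIntegral.integral_add hi1 hi2, ← hfam.variation_apply hx] at hftc
  simp only [one_smul, add_sub_cancel, zero_smul, sub_zero] at hftc
  rw [(hfam.hasFDerivAt_transport hx).fderiv]
  simp only [neg_apply, ContinuousLinearMap.comp_apply,
    ContinuousLinearMap.mul_apply', mul_add, mul_neg, ← mul_assoc, ← hPdef]
  rw [transportInv_mul_transport ha h1, one_mul, ← hftc, gaugePotential]
  abel

end FockSchwingerGauge

/-! ### Taylor's formula with remainder on the unit interval. -/

namespace UnitIntervalCalculus

open MeasureTheory

variable {E : Type*} [NormedAddCommGroup E] [NormedSpace ℝ E] [CompleteSpace E]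

/-- Taylor's formula for a function given together with all its derivatives. -/
lemma norm_sub_taylor_le (N : ℕ) {D : ℕ → ℝ → E}
    (h : ∀ j, ∀ s ∈ Icc (0 : ℝ) 1, HasDerivWithinAt (D j) (D (j + 1) s) (Icc 0 1) s) {C : ℝ}
    (hC : ∀ s ∈ Icc (0 : ℝ) 1, ‖D N s‖ ≤ C) : ∀ s ∈ Icc (0 : ℝ) 1,
      ‖D 0 s - ∑ j ∈ Finset.range N, (s ^ j / j.factorial) • D j 0‖ ≤ C * s ^ N / N.factorial := by
  induction N generalizing D with
  | zero => intro s hs; simpa using hC s hs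
  | succ N ih =>
    intro s hs
    have hcont : ∀ j, ContinuousOn (D j) (Icc 0 1) := fun j s hs => (h j s hs).continuousWithinAt
    -- The shifted sequence of derivatives has one order fewer to expand; integrating its estimate
    -- raises the order by one.
    have ih' := ih (D := fun j => D (j + 1)) (fun j => h (j + 1)) hC
    have hftc := integral_eq_sub_of_hasDerivWithinAt
      (G := fun s => D 0 s - ∑ j ∈ Finset.range (N + 1), (s ^ j / j.factorial) • D j 0)
      (g := fun s => D 1 s - ∑ j ∈ Finset.range N, (s ^ j / j.factorial) • D (j + 1) 0)
      (fun r hr => by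
        refine (h 0 r hr).sub ?_
        simp only [Finset.sum_range_succ']
        have h1 : HasDerivWithinAt (fun s : ℝ => ∑ j ∈ Finset.range N,
            (s ^ (j + 1) / (j + 1).factorial) • D (j + 1) 0)
            (∑ j ∈ Finset.range N, (r ^ j / j.factorial) • D (j + 1) 0) (Icc 0 1) r := by
          refine HasDerivWithinAt.fun_sum fun j _ => HasDerivWithinAt.smul_const ?_ _
          have h2 := ((hasDerivAt_pow (j + 1) r).div_const
            ((j + 1).factorial : ℝ)).hasDerivWithinAt (s := Icc 0 1)
          convert! h2 using 1
          rw [Nat.factorial_succ]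
          have : (j.factorial : ℝ) ≠ 0 := by positivity
          have : (j : ℝ) + 1 ≠ 0 := by positivity
          push_cast
          field_simp
        simpa using h1.add_const ((1 : ℝ) • D 0 0))
      ((hcont 1).sub (by fun_prop)) hs
    have h0 : D 0 0 - ∑ j ∈ Finset.range (N + 1), ((0 : ℝ) ^ j / j.factorial) • D j 0 = 0 := by
      rw [Finset.sum_range_succ']
      simp
    rw [h0, sub_zero] at hftc
    rw [← hftc]
    have h3 : ‖∫ s in (0 : ℝ)..s, D 1 s -
        ∑ j ∈ Finset.range N, (s ^ j / j.factorial) • D (j + 1) 0‖ ≤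
        ∫ s in (0 : ℝ)..s, C * s ^ N / N.factorial := by
      apply intervalIntegral.norm_integral_le_of_norm_le hs.1
      · exact ae_of_all _ fun r hr => ih' r ⟨hr.1.le, hr.2.trans hs.2⟩
      · exact Continuous.intervalIntegrable (by fun_prop) _ _
    refine h3.trans (le_of_eq ?_)
    simp only [mul_div_assoc]
    rw [intervalIntegral.integral_const_mul, intervalIntegral.integral_div, integral_pow,
      Nat.factorial_succ]
    push_cast
    rw [zero_pow (Nat.succ_ne_zero N), sub_zero]
    field_simp

end UnitIntervalCalculus

namespace FockSchwingerGauge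

open LinearODE UnitIntervalCalculus MeasureTheory

variable {E : Type*} [NormedRing E] [NormedAlgebra ℝ E]
variable {X : Type*} [NormedAddCommGroup X] [NormedSpace ℝ X]

/-! ### Bounds for iterated covariant derivatives -/

/-- Bounds for the derivatives of iterated covariant derivatives, in terms of bounds `α` for the
derivatives of the connection and `β` for those of the differentiated function. -/
def covBound (α β : ℕ → ℝ) : ℕ → ℕ → ℝ
  | 0, m => β m
  | j + 1, m => covBound α β j (m + 1) +
      2 * ∑ i ∈ Finset.range (m + 1), (m.choose i : ℝ) * α i * covBound α β j (m - i)

/-- Leibniz' rule; the two products in the commutator give the same binomial sum, hence the factor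
2. The constant `c` is kept apart so that iteration only multiplies it by `‖w‖`. -/
lemma norm_iteratedFDeriv_cov_le {𝒜 : X → X →L[ℝ] E} {S : Set X} (hS : IsOpen S)
    (h𝒜 : ContDiffOn ℝ ∞ 𝒜 S) {H : X → E} (hH : ContDiffOn ℝ ∞ H S) {α β : ℕ → ℝ}
    (hα : ∀ m, ∀ p ∈ S, ‖iteratedFDeriv ℝ m 𝒜 p‖ ≤ α m) {c : ℝ}
    (hβ : ∀ m, ∀ p ∈ S, ‖iteratedFDeriv ℝ m H p‖ ≤ c * β m) (w : X) (m : ℕ) {p : X}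
    (hp : p ∈ S) :
    ‖iteratedFDeriv ℝ m (cov 𝒜 w H) p‖ ≤ c * ‖w‖ * (β (m + 1) +
      2 * ∑ i ∈ Finset.range (m + 1), (m.choose i : ℝ) * α i * β (m - i)) := by
  have hu := hS.uniqueDiffOn (𝕜 := ℝ)
  have hm : (m : WithTop ℕ∞) ≤ ∞ := by exact_mod_cast le_top
  have hle : ∀ k : ℕ, (k : WithTop ℕ∞) ≤ ∞ := fun k => by exact_mod_cast le_top
  simp only [← iteratedFDerivWithin_of_isOpen _ hS hp]
  have hα' : ∀ m, ‖iteratedFDerivWithin ℝ m 𝒜 S p‖ ≤ α m := fun m => by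
    rw [iteratedFDerivWithin_of_isOpen m hS hp]; exact hα m p hp
  have hβ' : ∀ m, ‖iteratedFDerivWithin ℝ m H S p‖ ≤ c * β m := fun m => by
    rw [iteratedFDerivWithin_of_isOpen m hS hp]; exact hβ m p hp
  have hdH : ContDiffOn ℝ ∞ (fderivWithin ℝ H S) S := hH.fderivWithin hu (by simp)
  have h𝒜w : ContDiffOn ℝ ∞ (fun q => 𝒜 q w) S := h𝒜.clm_apply contDiffOn_const
  have hAw : ∀ i, ‖iteratedFDerivWithin ℝ i (fun q => 𝒜 q w) S p‖ ≤ ‖w‖ * α i := fun i =>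
    (norm_iteratedFDerivWithin_clm_apply_const (h𝒜 p hp) hu hp (hle i)).trans
      (mul_le_mul_of_nonneg_left (hα' i) (norm_nonneg w))
  have h1 : ‖iteratedFDerivWithin ℝ m (fun q => fderivWithin ℝ H S q w) S p‖ ≤
      ‖w‖ * (c * β (m + 1)) := by
    refine (norm_iteratedFDerivWithin_clm_apply_const (hdH p hp) hu hp hm).trans ?_
    rw [norm_iteratedFDerivWithin_fderivWithin hu hp]
    exact mul_le_mul_of_nonneg_left (hβ' _) (norm_nonneg w)
  have h2 : ‖iteratedFDerivWithin ℝ m (fun q => 𝒜 q w * H q) S p‖ ≤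
      ∑ i ∈ Finset.range (m + 1), (m.choose i : ℝ) * (‖w‖ * α i) * (c * β (m - i)) := by
    refine (norm_iteratedFDerivWithin_mul_le h𝒜w hH hu hp hm).trans ?_
    refine Finset.sum_le_sum fun i _ => ?_
    exact mul_le_mul (mul_le_mul_of_nonneg_left (hAw i) (by positivity)) (hβ' _) (norm_nonneg _)
      (mul_nonneg (by positivity) ((norm_nonneg _).trans (hAw i)))
  have h3 : ‖iteratedFDerivWithin ℝ m (fun q => H q * 𝒜 q w) S p‖ ≤
      ∑ i ∈ Finset.range (m + 1), (m.choose i : ℝ) * (‖w‖ * α i) * (c * β (m - i)) := by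
    refine (norm_iteratedFDerivWithin_mul_le hH h𝒜w hu hp hm).trans ?_
    -- Leibniz' rule for the opposite order of factors counts derivatives of `H` first; reflection
    -- restores the common form.
    rw [← Finset.sum_range_reflect]
    refine Finset.sum_le_sum fun i hi => ?_
    have hi' : i ≤ m := Nat.lt_succ_iff.1 (Finset.mem_range.1 hi)
    have e1 : m + 1 - 1 - i = m - i := by omega
    have e2 : m - (m - i) = i := by omega
    rw [e1, e2, Nat.choose_symm hi', mul_assoc, mul_assoc]
    refine mul_le_mul_of_nonneg_left ?_ (by positivity)
    rw [mul_comm]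
    exact mul_le_mul (hAw i) (hβ' _) (norm_nonneg _) ((norm_nonneg _).trans (hAw i))
  have he : EqOn (cov 𝒜 w H) (fun q => fderivWithin ℝ H S q w +
      (𝒜 q w * H q - H q * 𝒜 q w)) S := fun q hq => by
    simp only [cov, fderivWithin_of_isOpen hS hq]
  have hc1 : ContDiffWithinAt ℝ m (fun q => fderivWithin ℝ H S q w) S p :=
    (hdH.clm_apply contDiffOn_const p hp).of_le hm
  have hc2 : ContDiffWithinAt ℝ m (fun q => 𝒜 q w * H q) S p := (h𝒜w.mul hH p hp).of_le hm
  have hc3 : ContDiffWithinAt ℝ m (fun q => H q * 𝒜 q w) S p := (hH.mul h𝒜w p hp).of_le hm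
  rw [iteratedFDerivWithin_congr he hp,
    fun_iteratedFDerivWithin_add_apply hc1 (hc2.sub hc3) hu hp,
    fun_iteratedFDerivWithin_sub_apply hc2 hc3 hu hp]
  refine (norm_add_le _ _).trans ((add_le_add h1 ((norm_sub_le _ _).trans
    (add_le_add h2 h3))).trans (le_of_eq ?_))
  rw [← two_mul, mul_add, mul_left_comm _ (2 : ℝ), Finset.mul_sum, Finset.mul_sum]
  congr 1
  · ring
  · rw [Finset.mul_sum]
    exact Finset.sum_congr rfl fun i _ => by ring

lemma norm_iteratedFDeriv_cov_iterate_le {𝒜 : X → X →L[ℝ] E} {S : Set X} (hS : IsOpen S)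
    (h𝒜 : ContDiffOn ℝ ∞ 𝒜 S) {H : X → E} (hH : ContDiffOn ℝ ∞ H S) {α β : ℕ → ℝ}
    (hα : ∀ m, ∀ p ∈ S, ‖iteratedFDeriv ℝ m 𝒜 p‖ ≤ α m) {c : ℝ}
    (hβ : ∀ m, ∀ p ∈ S, ‖iteratedFDeriv ℝ m H p‖ ≤ c * β m) (w : X) (j m : ℕ) {p : X}
    (hp : p ∈ S) :
    ‖iteratedFDeriv ℝ m ((cov 𝒜 w)^[j] H) p‖ ≤ c * ‖w‖ ^ j * covBound α β j m := by
  induction j generalizing m p with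
  | zero => simpa [covBound] using hβ m p hp
  | succ j ih =>
    rw [Function.iterate_succ_apply', pow_succ, ← mul_assoc]
    exact norm_iteratedFDeriv_cov_le hS h𝒜 (contDiffOn_cov_iterate hS h𝒜 w hH j) hα
      (fun m p hp => ih m hp) w m hp

lemma norm_cov_iterate_curvature_le {𝒜 : X → X →L[ℝ] E} {S : Set X} (hS : IsOpen S)
    (h𝒜 : ContDiffOn ℝ ∞ 𝒜 S) {α β : ℕ → ℝ}
    (hα : ∀ m, ∀ p ∈ S, ‖iteratedFDeriv ℝ m 𝒜 p‖ ≤ α m)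
    (hβ : ∀ m, ∀ p ∈ S, ‖iteratedFDeriv ℝ m (curvature 𝒜) p‖ ≤ β m) (w v : X) (j : ℕ) {p : X}
    (hp : p ∈ S) :
    ‖(cov 𝒜 w)^[j] (fun q => curvature 𝒜 q w v) p‖ ≤
      covBound α β j 0 * ‖w‖ ^ (j + 1) * ‖v‖ := by
  have hu := hS.uniqueDiffOn (𝕜 := ℝ)
  have hΩ : ContDiffOn ℝ ∞ (curvature 𝒜) S := contDiffOn_curvature hS h𝒜 (by simp)
  have hΩw : ContDiffOn ℝ ∞ (fun q => curvature 𝒜 q w) S := hΩ.clm_apply contDiffOn_const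
  have hb : ∀ m, ∀ q ∈ S, ‖iteratedFDeriv ℝ m (fun q => curvature 𝒜 q w v) q‖ ≤
      (‖v‖ * ‖w‖) * β m := fun m q hq => by
    have hm : (m : WithTop ℕ∞) ≤ ∞ := by exact_mod_cast le_top
    have h1 := norm_iteratedFDeriv_clm_apply_const (c := v)
      (hΩw.contDiffAt (hS.mem_nhds hq)) hm
    have h2 := norm_iteratedFDeriv_clm_apply_const (c := w)
      (hΩ.contDiffAt (hS.mem_nhds hq)) hm
    rw [mul_assoc]
    exact h1.trans (mul_le_mul_of_nonneg_left (h2.trans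
      (mul_le_mul_of_nonneg_left (hβ m q hq) (norm_nonneg _))) (norm_nonneg _))
  have h3 := norm_iteratedFDeriv_cov_iterate_le hS h𝒜 (hΩw.clm_apply contDiffOn_const) hα hb w j 0 hp
  rw [norm_iteratedFDeriv_zero] at h3
  exact h3.trans (le_of_eq (by ring))

variable [CompleteSpace E] [IsDedekindFiniteMonoid E]

/-! ### The radial Taylor expansion -/

/-- The coefficient of order `j + 1` of the connection in Fock–Schwinger gauge. -/
def gaugeTerm (𝒜 : X → X →L[ℝ] E) (z w v : X) (j : ℕ) : E :=
  (1 / ((j.factorial : ℝ) * ((j : ℝ) + 2))) • (cov 𝒜 w)^[j] (fun q => curvature 𝒜 q w v) z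

lemma line_mem_ball {z x : X} {r s : ℝ} (hx : x ∈ Metric.ball z r) (hs : s ∈ Icc (0 : ℝ) 1) :
    z + s • (x - z) ∈ Metric.ball z r := by
  rw [mem_ball_iff_norm] at hx ⊢
  rw [add_sub_cancel_left, norm_smul, Real.norm_of_nonneg hs.1]
  exact (mul_le_of_le_one_left (norm_nonneg _) hs.2).trans_lt hx

/-- The functions `D j = Q (cov^j H) P` are successive derivatives of each other, so Taylor's
formula applies to `D 0`; multiplying by `s` and integrating turns `s^j/j!` into `1/(j!(j+2))`. The
constant is explicit in `N` because the analytic case lets `N` tend to infinity. -/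
lemma norm_gaugePotential_sub_sum_le {𝒜 : X → X →L[ℝ] E} {z : X} {r : ℝ}
    (h𝒜 : ContDiffOn ℝ ∞ 𝒜 (Metric.ball z r)) {α β : ℕ → ℝ}
    (hα : ∀ m, ∀ p ∈ Metric.ball z r, ‖iteratedFDeriv ℝ m 𝒜 p‖ ≤ α m)
    (hβ : ∀ m, ∀ p ∈ Metric.ball z r, ‖iteratedFDeriv ℝ m (curvature 𝒜) p‖ ≤ β m) {x : X}
    (hx : x ∈ Metric.ball z r) (v : X) (N : ℕ) :
    ‖gaugePotential 𝒜 z x v - ∑ j ∈ Finset.range N, gaugeTerm 𝒜 z (x - z) v j‖ ≤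
      (‖(1 : E)‖ * Real.exp (α 0 * r)) ^ 2 * (covBound α β N 0 / N.factorial) *
        ‖x - z‖ ^ (N + 1) * ‖v‖ := by
  have hS : IsOpen (Metric.ball z r) := Metric.isOpen_ball
  have h1 : (1 : ℝ) ∈ Icc (0 : ℝ) 1 := ⟨zero_le_one, le_rfl⟩
  have hfam := isC1Family_radial hS h𝒜 (z := z) fun x hx s hs => line_mem_ball hx hs
  have ha := hfam.continuousOn_section hx
  set w := x - z with hw
  set H : X → E := fun q => curvature 𝒜 q w v with hH
  have hHc : ContDiffOn ℝ ∞ H (Metric.ball z r) :=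
    ((contDiffOn_curvature hS h𝒜 (M := ∞) (by simp)).clm_apply contDiffOn_const).clm_apply
      contDiffOn_const
  have hbound : ∀ s ∈ Icc (0 : ℝ) 1, ‖radial 𝒜 z x s‖ ≤ α 0 * r := fun s hs => by
    have h2 := hα 0 _ (line_mem_ball hx hs)
    rw [norm_iteratedFDeriv_zero] at h2
    refine (ContinuousLinearMap.le_opNorm _ _).trans ?_
    have h3 : ‖x - z‖ ≤ r := (mem_ball_iff_norm.1 hx).le
    exact mul_le_mul h2 h3 (norm_nonneg _) ((norm_nonneg _).trans h2)
  set K := ‖(1 : E)‖ * Real.exp (α 0 * r) with hK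
  set D : ℕ → ℝ → E := fun j s => transportInv (radial 𝒜 z x) s *
    ((cov 𝒜 w)^[j] H) (z + s • w) * transport (radial 𝒜 z x) s with hD
  have hderiv : ∀ j, ∀ s ∈ Icc (0 : ℝ) 1, HasDerivWithinAt (D j) (D (j + 1) s) (Icc 0 1) s := by
    intro j s hs
    have hd := ((contDiffOn_cov_iterate hS h𝒜 w hHc j).differentiableOn (by simp) _
      (line_mem_ball hx hs)).differentiableAt (hS.mem_nhds (line_mem_ball hx hs))
    have h2 := hasDerivWithinAt_conj ha hs hd
    simp only [hD, Function.iterate_succ_apply']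
    exact h2
  have hDcont : ∀ j, ContinuousOn (D j) (Icc 0 1) := fun j s hs =>
    (hderiv j s hs).continuousWithinAt
  have hDN : ∀ s ∈ Icc (0 : ℝ) 1, ‖D N s‖ ≤
      K * (covBound α β N 0 * ‖w‖ ^ (N + 1) * ‖v‖) * K := fun s hs => by
    have h2 := norm_cov_iterate_curvature_le hS h𝒜 hα hβ w v N (line_mem_ball hx hs)
    refine norm_mul₃_le.trans ?_
    gcongr
    · exact mul_nonneg (by positivity) ((norm_nonneg _).trans h2)
    · exact norm_transportInv_le hbound hs
    · exact norm_transport_le hbound hs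
  have htaylor := norm_sub_taylor_le N hderiv hDN
  have hD0 : ∀ j, D j 0 = (cov 𝒜 w)^[j] H z := fun j => by simp [hD]
  have hi0 : IntervalIntegrable (fun s : ℝ => s • D 0 s) volume 0 1 :=
    intervalIntegrable_of_continuousOn (continuousOn_id.smul (hDcont 0)) h1
  have hterm : ∀ j, ∫ s in (0 : ℝ)..1, s • ((s ^ j / j.factorial) • D j 0) =
      gaugeTerm 𝒜 z w v j := fun j => by
    have h2 : ∀ s : ℝ, s • ((s ^ j / j.factorial) • D j 0) =
        (s ^ (j + 1) / j.factorial) • D j 0 := fun s => by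
      rw [smul_smul, pow_succ]; congr 1; ring
    simp only [h2]
    rw [intervalIntegral.integral_smul_const, intervalIntegral.integral_div, integral_pow, hD0,
      gaugeTerm]
    congr 1
    push_cast
    simp
    field_simp
    ring
  have hint : gaugePotential 𝒜 z x v - ∑ j ∈ Finset.range N, gaugeTerm 𝒜 z w v j =
      ∫ s in (0 : ℝ)..1, s • (D 0 s - ∑ j ∈ Finset.range N, (s ^ j / j.factorial) • D j 0) := by
    simp only [smul_sub, Finset.smul_sum]
    rw [intervalIntegral.integral_sub hi0 (Continuous.intervalIntegrable (by fun_prop) _ _),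
      intervalIntegral.integral_finsetSum fun j _ =>
        Continuous.intervalIntegrable (by fun_prop) _ _]
    simp only [hterm]
    rfl
  rw [hint]
  refine norm_integral_le_of_norm_le (fun s hs => ?_) h1
  have hCnn := (norm_nonneg _).trans (hDN s hs)
  rw [norm_smul, Real.norm_of_nonneg hs.1]
  calc _ ≤ 1 * (K * (covBound α β N 0 * ‖w‖ ^ (N + 1) * ‖v‖) * K * s ^ N / N.factorial) :=
        mul_le_mul hs.2 (htaylor s hs) (norm_nonneg _) zero_le_one
    _ ≤ K * (covBound α β N 0 * ‖w‖ ^ (N + 1) * ‖v‖) * K * 1 / N.factorial := by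
        rw [one_mul]
        gcongr
        exact pow_le_one₀ hs.1 hs.2
    _ = _ := by ring

end FockSchwingerGauge

namespace FockSchwingerGauge

open LinearODE UnitIntervalCalculus MeasureTheory

/-! ### Cauchy estimates for analytic functions -/

section Cauchy

open scoped NNReal ENNReal

variable {X F : Type*} [NormedAddCommGroup X] [NormedSpace ℝ X] [NormedAddCommGroup F]
  [NormedSpace ℝ F]

/-- The re-expansion is an absolutely convergent double series when `2 r` is below the radius. Its
total sum at `‖y‖ = r` dominates each part of degree `k` multiplied by `r ^ k`, which gives a
constant independent of `y` and `k`. -/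
lemma exists_changeOrigin_le (p : FormalMultilinearSeries ℝ X F) {r : ℝ≥0} (hr : 0 < r)
    (hp : (r + r : ℝ≥0∞) < p.radius) :
    ∃ C : ℝ≥0, ∀ y : X, ‖y‖₊ ≤ r → ∀ k, ‖p.changeOrigin y k‖₊ ≤ C * r⁻¹ ^ k := by
  have hsum := p.changeOriginSeries_summable_aux₁ hp
  have hfib := NNReal.summable_sigma.1 hsum
  refine ⟨∑' s : Σ k l : ℕ, { s : Finset (Fin (k + l)) // s.card = l },
    ‖p (s.1 + s.2.1)‖₊ * r ^ s.2.1 * r ^ s.1, fun y hy k => ?_⟩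
  have hr' : (r : ℝ≥0∞) < p.radius := lt_of_le_of_lt le_self_add hp
  have hy' : (‖y‖₊ : ℝ≥0∞) < p.radius := lt_of_le_of_lt (by exact_mod_cast hy) hr'
  have hs := p.changeOriginSeries_summable_aux₂ hr' k
  have h1 : ∑' s : Σ l : ℕ, { s : Finset (Fin (k + l)) // s.card = l },
      ‖p (k + s.1)‖₊ * ‖y‖₊ ^ s.1 ≤
      ∑' s : Σ l : ℕ, { s : Finset (Fin (k + l)) // s.card = l }, ‖p (k + s.1)‖₊ * r ^ s.1 := by
    refine Summable.tsum_le_tsum (fun s => ?_) ?_ hs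
    · gcongr
    · refine NNReal.summable_of_le (fun s => ?_) hs
      gcongr
  have h2 : (∑' s : Σ l : ℕ, { s : Finset (Fin (k + l)) // s.card = l },
      ‖p (k + s.1)‖₊ * r ^ s.1) * r ^ k ≤
      ∑' s : Σ k l : ℕ, { s : Finset (Fin (k + l)) // s.card = l },
        ‖p (s.1 + s.2.1)‖₊ * r ^ s.2.1 * r ^ s.1 := by
    rw [← NNReal.tsum_mul_right, hsum.tsum_sigma' hfib.1]
    exact hfib.2.le_tsum' k
  rw [inv_pow, ← div_eq_mul_inv, le_div_iff₀ (by positivity)]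
  refine le_trans ?_ h2
  gcongr
  exact (p.nnnorm_changeOrigin_le k hy').trans h1

/-- The `m`-th derivative is the sum of the `m`-th coefficient over the `m!` permutations of its
arguments. -/
lemma norm_iteratedFDeriv_le_of_hasFPowerSeriesOnBall [CompleteSpace F] {f : X → F}
    {p : FormalMultilinearSeries ℝ X F} {x : X} {r : ℝ≥0∞} (h : HasFPowerSeriesOnBall f p x r)
    (m : ℕ) : ‖iteratedFDeriv ℝ m f x‖ ≤ m.factorial * ‖p m‖ := by
  refine ContinuousMultilinearMap.opNorm_le_bound (by positivity) fun v => ?_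
  rw [h.iteratedFDeriv_eq_sum_of_completeSpace]
  refine (norm_sum_le _ _).trans ?_
  have h1 : ∀ σ ∈ (Finset.univ : Finset (Equiv.Perm (Fin m))),
      ‖p m fun i => v (σ i)‖ ≤ ‖p m‖ * ∏ i, ‖v i‖ := fun σ _ => by
    refine ((p m).le_opNorm _).trans (le_of_eq ?_)
    rw [Equiv.prod_comp σ fun i => ‖v i‖]
  refine (Finset.sum_le_card_nsmul _ _ _ h1).trans (le_of_eq ?_)
  rw [Finset.card_univ, Fintype.card_perm, Fintype.card_fin, nsmul_eq_mul, mul_assoc]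

/-- The derivatives of an analytic function satisfy Cauchy estimates, locally uniformly. -/
lemma exists_cauchy_estimate [CompleteSpace F] {f : X → F} {z : X} (hf : AnalyticAt ℝ f z) :
    ∃ C K : ℝ, ∀ᶠ p in 𝓝 z, ∀ m : ℕ, ‖iteratedFDeriv ℝ m f p‖ ≤ C * K ^ m * m.factorial := by
  obtain ⟨p, R, hp⟩ := hf
  obtain ⟨r, hr0, hr⟩ : ∃ r : ℝ≥0, 0 < r ∧ (r + r : ℝ≥0∞) < R := by
    obtain ⟨q, hq0, hq⟩ := ENNReal.lt_iff_exists_nnreal_btwn.1 hp.r_pos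
    refine ⟨q / 2, by simpa using hq0, ?_⟩
    rw [← ENNReal.coe_add, add_halves]
    exact hq
  obtain ⟨C, hC⟩ := exists_changeOrigin_le p hr0 (hr.trans_le hp.r_le)
  refine ⟨C, (r⁻¹ : ℝ≥0), ?_⟩
  filter_upwards [Metric.ball_mem_nhds z (NNReal.coe_pos.2 hr0)] with q hq m
  have hy : ‖q - z‖₊ ≤ r := (mem_ball_iff_norm.1 hq).le
  have h1 := hp.changeOrigin (y := q - z)
    (lt_of_le_of_lt (ENNReal.coe_le_coe.2 hy) (lt_of_le_of_lt le_self_add hr))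
  rw [add_sub_cancel] at h1
  refine (norm_iteratedFDeriv_le_of_hasFPowerSeriesOnBall h1 m).trans ?_
  rw [mul_comm]
  gcongr
  exact_mod_cast hC (q - z) hy m

end Cauchy

/-! ### Growth of covariant derivatives and convergence of the radial expansion. -/

variable {E : Type*} [NormedRing E] [NormedAlgebra ℝ E]
variable {X : Type*} [NormedAddCommGroup X] [NormedSpace ℝ X]

/-- Induction on `j`: each of the `m + 1` Leibniz terms is at most a multiple of `(m + j)!`, and `(m
+ 1) (m + j)! ≤ (m + j + 1)!`. The plain derivative and the two products thus each contribute 1 to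
the factor 3 per step. -/
lemma covBound_le {C K : ℝ} (hC : 0 ≤ C) (hK : 0 ≤ K) (j m : ℕ) :
    covBound (fun m => K * K ^ m * m.factorial) (fun m => C * K ^ m * m.factorial) j m ≤
      C * 3 ^ j * K ^ (m + j) * (m + j).factorial := by
  induction j generalizing m with
  | zero => simp [covBound]
  | succ j ih =>
    have h1 : ∀ i ∈ Finset.range (m + 1), (m.choose i : ℝ) * (K * K ^ i * i.factorial) *
        covBound (fun m => K * K ^ m * m.factorial) (fun m => C * K ^ m * m.factorial) j (m - i) ≤
        C * 3 ^ j * K ^ (m + j + 1) * (m + j).factorial := fun i hi => by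
      have hi' : i ≤ m := Nat.lt_succ_iff.1 (Finset.mem_range.1 hi)
      -- The left factors are a descending factorial of `m`, bounded by the corresponding one of `m
      -- + j`.
      have h2 : m.choose i * i.factorial * (m - i + j).factorial ≤ (m + j).factorial := by
        have e1 : m - i + j = m + j - i := by omega
        rw [e1, mul_comm (m.choose i), ← Nat.descFactorial_eq_factorial_mul_choose,
          ← Nat.factorial_mul_descFactorial (show i ≤ m + j by omega), mul_comm]
        exact Nat.mul_le_mul_left _ (Nat.descFactorial_le i (Nat.le_add_right m j))
      have h2' : (m.choose i : ℝ) * i.factorial * (m - i + j).factorial ≤ (m + j).factorial := by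
        exact_mod_cast h2
      calc _ ≤ (m.choose i : ℝ) * (K * K ^ i * i.factorial) *
            (C * 3 ^ j * K ^ (m - i + j) * (m - i + j).factorial) := by
              gcongr
              exact ih (m - i)
        _ = C * 3 ^ j * K ^ (i + (m - i) + j + 1) *
            ((m.choose i : ℝ) * i.factorial * (m - i + j).factorial) := by ring
        _ ≤ _ := by
              rw [Nat.add_sub_cancel' hi']
              gcongr
    have h3 := Finset.sum_le_card_nsmul _ _ _ h1
    rw [Finset.card_range, nsmul_eq_mul] at h3
    have h4 := ih (m + 1)
    have e2 : m + 1 + j = m + j + 1 := by ring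
    rw [e2] at h4
    have h5 : ((m + 1 : ℕ) : ℝ) * (m + j).factorial ≤ (m + j + 1).factorial := by
      rw [Nat.factorial_succ]
      push_cast
      gcongr
      linarith [(Nat.cast_nonneg j : (0 : ℝ) ≤ j)]
    simp only [covBound]
    have e3 : m + (j + 1) = m + j + 1 := by ring
    rw [e3]
    calc _ ≤ C * 3 ^ j * K ^ (m + j + 1) * (m + j + 1).factorial +
          2 * (((m + 1 : ℕ) : ℝ) * (C * 3 ^ j * K ^ (m + j + 1) * (m + j).factorial)) := by
            gcongr
      _ = C * 3 ^ j * K ^ (m + j + 1) * (m + j + 1).factorial +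
          2 * (C * 3 ^ j * K ^ (m + j + 1)) * (((m + 1 : ℕ) : ℝ) * (m + j).factorial) := by ring
      _ ≤ C * 3 ^ j * K ^ (m + j + 1) * (m + j + 1).factorial +
          2 * (C * 3 ^ j * K ^ (m + j + 1)) * (m + j + 1).factorial := by gcongr
      _ = _ := by ring

lemma exists_iteratedFDeriv_le [ProperSpace X] {F : Type*} [NormedAddCommGroup F]
    [NormedSpace ℝ F] {H : X → F} {V : Set X} (hV : IsOpen V) (hH : ContDiffOn ℝ ∞ H V) {z : X}
    {r : ℝ} (hr : Metric.closedBall z r ⊆ V) :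
    ∃ β : ℕ → ℝ, ∀ m, ∀ p ∈ Metric.ball z r, ‖iteratedFDeriv ℝ m H p‖ ≤ β m := by
  have h : ∀ m : ℕ, ∃ C, ∀ p ∈ Metric.closedBall z r, ‖iteratedFDerivWithin ℝ m H V p‖ ≤ C :=
    fun m => (isCompact_closedBall z r).exists_bound_of_continuousOn
      ((hH.continuousOn_iteratedFDerivWithin (by exact_mod_cast le_top) hV.uniqueDiffOn).mono hr)
  choose β hβ using h
  refine ⟨β, fun m p hp => ?_⟩
  have hp' := Metric.ball_subset_closedBall hp
  rw [← iteratedFDerivWithin_of_isOpen m hV (hr hp')]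
  exact hβ m p hp'

variable [CompleteSpace E] [IsDedekindFiniteMonoid E]

/-- The Taylor expansion of the connection in Fock–Schwinger gauge, to every finite order. -/
lemma exists_norm_gaugePotential_sub_sum_le [ProperSpace X] {𝒜 : X → X →L[ℝ] E} {V : Set X}
    (hV : IsOpen V) (h𝒜 : ContDiffOn ℝ ∞ 𝒜 V) {z : X} (hz : z ∈ V) :
    ∃ r > 0, Metric.ball z r ⊆ V ∧ ∀ N, ∃ C, 0 ≤ C ∧ ∀ x ∈ Metric.ball z r, ∀ v,
      ‖gaugePotential 𝒜 z x v - ∑ j ∈ Finset.range N, gaugeTerm 𝒜 z (x - z) v j‖ ≤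
        C * ‖x - z‖ ^ (N + 1) * ‖v‖ := by
  obtain ⟨r, hr0, hr⟩ := Metric.nhds_basis_closedBall.mem_iff.1 (hV.mem_nhds hz)
  have hrV := Metric.ball_subset_closedBall.trans hr
  obtain ⟨α, hα⟩ := exists_iteratedFDeriv_le hV h𝒜 hr
  obtain ⟨β, hβ⟩ := exists_iteratedFDeriv_le hV
    (contDiffOn_curvature hV h𝒜 (M := ∞) (by simp)) hr
  refine ⟨r, hr0, hrV, fun N => ⟨|(‖(1 : E)‖ * Real.exp (α 0 * r)) ^ 2 *
    (covBound α β N 0 / N.factorial)|, abs_nonneg _, fun x hx v => ?_⟩⟩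
  refine (norm_gaugePotential_sub_sum_le (h𝒜.mono hrV) hα hβ hx v N).trans ?_
  gcongr
  exact le_abs_self _

/-- For an analytic connection the Taylor series converges to the connection in
Fock–Schwinger gauge. -/
lemma hasSum_gaugeTerm [FiniteDimensional ℝ X] {𝒜 : X → X →L[ℝ] E} {z : X}
    (h𝒜 : AnalyticAt ℝ 𝒜 z) :
    ∀ᶠ x in 𝓝 z, ∀ v, HasSum (gaugeTerm 𝒜 z (x - z) v) (gaugePotential 𝒜 z x v) := by
  have hcurv : AnalyticAt ℝ (curvature 𝒜) z := by
    obtain ⟨U, hU, hUo, hzU⟩ := eventually_nhds_iff.1 h𝒜.eventually_analyticAt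
    have h1 : ContDiffOn ℝ ω 𝒜 U := fun p hp => (hU p hp).contDiffAt.contDiffWithinAt
    have h2 : ContDiffOn ℝ ω (curvature 𝒜) U := contDiffOn_curvature hUo h1 (M := ω) (by simp)
    exact ((h2 z hzU).contDiffAt (hUo.mem_nhds hzU)).analyticAt
  obtain ⟨C₁, K₁, h1⟩ := exists_cauchy_estimate h𝒜
  obtain ⟨C₂, K₂, h2⟩ := exists_cauchy_estimate hcurv
  obtain ⟨r, hr0, hr⟩ := Metric.eventually_nhds_iff_ball.1
    (h1.and (h2.and h𝒜.eventually_analyticAt))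
  -- `covBound_le` wants a single `K` as constant and rate for the connection and as rate for the
  -- curvature; the 1 keeps `K` positive.
  set K := max 1 (max (|C₁|) (max (|K₁|) (|K₂|))) with hK
  have hK1 : 1 ≤ K := le_max_left _ _
  have hKC : |C₁| ≤ K := (le_max_left _ _).trans (le_max_right _ _)
  have hKK : |K₁| ≤ K := (le_max_left _ _).trans ((le_max_right _ _).trans (le_max_right _ _))
  have hKK' : |K₂| ≤ K := (le_max_right _ _).trans ((le_max_right _ _).trans (le_max_right _ _))
  have hK0 : 0 ≤ K := zero_le_one.trans hK1
  set α : ℕ → ℝ := fun m => K * K ^ m * m.factorial with hαdef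
  set β : ℕ → ℝ := fun m => |C₂| * K ^ m * m.factorial with hβdef
  have hα : ∀ m, ∀ p ∈ Metric.ball z r, ‖iteratedFDeriv ℝ m 𝒜 p‖ ≤ α m := fun m p hp => by
    refine ((hr p hp).1 m).trans ((le_abs_self _).trans ?_)
    rw [abs_mul, abs_mul, abs_pow, Nat.abs_cast]
    change _ ≤ K * K ^ m * m.factorial
    gcongr
  have hβ : ∀ m, ∀ p ∈ Metric.ball z r, ‖iteratedFDeriv ℝ m (curvature 𝒜) p‖ ≤ β m :=
    fun m p hp => by
    refine ((hr p hp).2.1 m).trans ((le_abs_self _).trans ?_)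
    rw [abs_mul, abs_mul, abs_pow, Nat.abs_cast]
    change _ ≤ |C₂| * K ^ m * m.factorial
    gcongr
  have hsm : ContDiffOn ℝ ∞ 𝒜 (Metric.ball z r) := fun p hp =>
    ((hr p hp).2.2.contDiffAt).contDiffWithinAt
  -- This radius makes the ratio `3 K ‖x - z‖` at most `1/2`.
  have hδ : 0 < min r (1 / (6 * K)) := lt_min hr0 (by positivity)
  filter_upwards [Metric.ball_mem_nhds z hδ] with x hx v
  have hxr : x ∈ Metric.ball z r := Metric.ball_subset_ball (min_le_left _ _) hx
  have hxK : 3 * K * ‖x - z‖ ≤ 1 / 2 := by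
    have : ‖x - z‖ ≤ 1 / (6 * K) := (mem_ball_iff_norm.1 hx).le.trans (min_le_right _ _)
    rw [le_div_iff₀ (by positivity)] at this
    linarith
  have hpow : ∀ N : ℕ, covBound α β N 0 / N.factorial * ‖x - z‖ ^ (N + 1) * ‖v‖ ≤
      (|C₂| * ‖x - z‖ * ‖v‖) * (1 / 2) ^ N := fun N => by
    have h3 := covBound_le (abs_nonneg C₂) hK0 N 0
    rw [zero_add] at h3
    calc _ ≤ (|C₂| * 3 ^ N * K ^ N * N.factorial) / N.factorial * ‖x - z‖ ^ (N + 1) * ‖v‖ := by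
          gcongr
      _ = (|C₂| * ‖x - z‖ * ‖v‖) * (3 * K * ‖x - z‖) ^ N := by
          have : (N.factorial : ℝ) ≠ 0 := by positivity
          field_simp
          ring
      _ ≤ _ := by gcongr
  have hterm : ∀ j, ‖gaugeTerm 𝒜 z (x - z) v j‖ ≤ (|C₂| * ‖x - z‖ * ‖v‖) * (1 / 2) ^ j :=
    fun j => by
    refine le_trans ?_ (hpow j)
    have h4 := norm_cov_iterate_curvature_le Metric.isOpen_ball hsm hα hβ (x - z) v j
      (Metric.mem_ball_self hr0)
    rw [gaugeTerm, norm_smul, Real.norm_of_nonneg (by positivity)]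
    have h5 : 1 / ((j.factorial : ℝ) * ((j : ℝ) + 2)) ≤ 1 / j.factorial := by
      apply one_div_le_one_div_of_le (by positivity)
      have : (0 : ℝ) ≤ j := Nat.cast_nonneg j
      have : (0 : ℝ) < j.factorial := by positivity
      nlinarith
    calc _ ≤ 1 / (j.factorial : ℝ) * (covBound α β j 0 * ‖x - z‖ ^ (j + 1) * ‖v‖) := by gcongr
      _ = _ := by ring
  have hgeo : Summable fun j : ℕ => (|C₂| * ‖x - z‖ * ‖v‖) * (1 / 2 : ℝ) ^ j :=
    summable_geometric_two.mul_left _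
  have hnorm : Summable fun j => ‖gaugeTerm 𝒜 z (x - z) v j‖ :=
    Summable.of_nonneg_of_le (fun _ => norm_nonneg _) hterm hgeo
  rw [hasSum_iff_tendsto_nat_of_summable_norm hnorm, tendsto_iff_norm_sub_tendsto_zero]
  set K' := (‖(1 : E)‖ * Real.exp (α 0 * r)) ^ 2 with hK'
  have hlim : Tendsto (fun N : ℕ => K' * ((|C₂| * ‖x - z‖ * ‖v‖) * (1 / 2 : ℝ) ^ N)) atTop
      (𝓝 0) := by
    have := (hgeo.tendsto_atTop_zero).const_mul K'
    simpa using this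
  refine squeeze_zero (fun _ => norm_nonneg _) (fun N => ?_) hlim
  rw [norm_sub_rev]
  refine (norm_gaugePotential_sub_sum_le hsm hα hβ hxr v N).trans ?_
  rw [mul_assoc, mul_assoc, ← mul_assoc (covBound α β N 0 / _)]
  exact mul_le_mul_of_nonneg_left (hpow N) (by positivity)

end FockSchwingerGauge

/-! ### Second-order expansion of a transport with small coefficient. -/

namespace LinearODE

open UnitIntervalCalculus MeasureTheory

variable {E : Type*} [NormedRing E] [NormedAlgebra ℝ E] [CompleteSpace E]

/-- Expansion to second order of the solution of `P' = -φ P` for a small coefficient `φ` which is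
nearly constant. -/
lemma exists_norm_transport_sub_le {K : ℝ} (hK : 0 ≤ K) :
    ∃ C, 0 ≤ C ∧ ∀ (φ : ℝ → E) (c₀ c₁ c₂ κ : E) (ρ : ℝ), ContinuousOn φ (Icc 0 1) → 0 ≤ ρ → ρ ≤ 1 →
      ‖κ‖ ≤ K * ρ ^ 2 → (∀ s ∈ Icc (0 : ℝ) 1, ‖φ s - κ‖ ≤ K * ρ ^ 3) →
      (∀ s ∈ Icc (0 : ℝ) 1, ‖φ s - (c₀ + s • c₁ + s ^ 2 • c₂)‖ ≤ K * ρ ^ 5) →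
      ‖transport φ 1 - (1 - (c₀ + (1 / 2 : ℝ) • c₁ + (1 / 3 : ℝ) • c₂) +
        (1 / 2 : ℝ) • (κ * κ))‖ ≤ C * ρ ^ 5 := by
  set w := ‖(1 : E)‖ * Real.exp (2 * K) with hw
  have hw0 : 0 ≤ w := by positivity
  -- The three summands are the constants of the three error terms in the final decomposition of `φ
  -- P - ψ`.
  refine ⟨K + K * K + 2 * K * (K * w + K * (2 * K * w)), by positivity,
    fun φ c₀ c₁ c₂ κ ρ hφ hρ0 hρ1 hκ h1 h2 => ?_⟩
  have hu : (1 : ℝ) ∈ Icc (0 : ℝ) 1 := ⟨zero_le_one, le_rfl⟩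
  have hP := continuousOn_transport hφ
  have hφP : ContinuousOn (fun s => φ s * transport φ s) (Icc 0 1) := hφ.mul hP
  have hρ3 : ρ ^ 3 ≤ ρ ^ 2 := pow_le_pow_of_le_one hρ0 hρ1 (by norm_num)
  have hφ2 : ∀ s ∈ Icc (0 : ℝ) 1, ‖φ s‖ ≤ 2 * K * ρ ^ 2 := fun s hs => by
    calc ‖φ s‖ = ‖(φ s - κ) + κ‖ := by rw [sub_add_cancel]
      _ ≤ K * ρ ^ 3 + K * ρ ^ 2 := norm_add_le_of_le (h1 s hs) hκ
      _ ≤ K * ρ ^ 2 + K * ρ ^ 2 := by gcongr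
      _ = _ := by ring
  have hPw : ∀ s ∈ Icc (0 : ℝ) 1, ‖transport φ s‖ ≤ w := fun s hs => by
    refine norm_transport_le (fun s hs => (hφ2 s hs).trans ?_) hs
    exact mul_le_of_le_one_right (by positivity) (pow_le_one₀ hρ0 hρ1)
  have hP1 : ∀ s ∈ Icc (0 : ℝ) 1, ‖transport φ s - 1‖ ≤ 2 * K * ρ ^ 2 * w := fun s hs => by
    rw [transport_eq hφ hs, sub_sub_cancel_left, norm_neg]
    exact norm_integral_le_of_norm_le (fun r hr => (norm_mul_le _ _).trans
      (mul_le_mul (hφ2 r hr) (hPw r hr) (norm_nonneg _) (by positivity))) hs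
  have hP2 : ∀ s ∈ Icc (0 : ℝ) 1,
      ‖transport φ s - 1 + s • κ‖ ≤ (K * w + K * (2 * K * w)) * ρ ^ 3 := fun s hs => by
    have e : transport φ s - 1 + s • κ = -∫ r in (0 : ℝ)..s, (φ r * transport φ r - κ) := by
      rw [intervalIntegral.integral_sub (intervalIntegrable_of_continuousOn hφP hs)
        (intervalIntegrable_of_continuousOn continuousOn_const hs), transport_eq hφ hs]
      simp
      abel
    rw [e, norm_neg]
    refine norm_integral_le_of_norm_le (fun r hr => ?_) hs
    calc ‖φ r * transport φ r - κ‖ = ‖(φ r - κ) * transport φ r + κ * (transport φ r - 1)‖ := by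
          congr 1; noncomm_ring
      _ ≤ K * ρ ^ 3 * w + K * ρ ^ 2 * (2 * K * ρ ^ 2 * w) :=
          norm_add_le_of_le
            ((norm_mul_le _ _).trans (mul_le_mul (h1 r hr) (hPw r hr) (norm_nonneg _)
              (by positivity)))
            ((norm_mul_le _ _).trans (mul_le_mul hκ (hP1 r hr) (norm_nonneg _) (by positivity)))
      _ = K * w * ρ ^ 3 + K * (2 * K * w) * ρ ^ 4 := by ring
      _ ≤ K * w * ρ ^ 3 + K * (2 * K * w) * ρ ^ 3 := by
          have : ρ ^ 4 ≤ ρ ^ 3 := pow_le_pow_of_le_one hρ0 hρ1 (by norm_num)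
          gcongr
      _ = _ := by ring
  -- Since `P = 1 - s κ + O(ρ³)` and `φ = κ + O(ρ³)`, the product `φ P` is the polynomial part of
  -- `φ` minus `s κ²`, up to `O(ρ⁵)`.
  set ψ : ℝ → E := fun s => c₀ + s • c₁ + s ^ 2 • c₂ - s • (κ * κ) with hψ
  have hψc : ContinuousOn ψ (Icc 0 1) := by fun_prop
  have hint : ∫ s in (0 : ℝ)..1, ψ s = c₀ + (1 / 2 : ℝ) • c₁ + (1 / 3 : ℝ) • c₂ -
      (1 / 2 : ℝ) • (κ * κ) := by
    have h := integral_eq_sub_of_hasDerivWithinAt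
      (G := fun s : ℝ => s • c₀ + (s ^ 2 / 2) • c₁ + (s ^ 3 / 3) • c₂ - (s ^ 2 / 2) • (κ * κ))
      (g := ψ) (fun s hs => by
        have a1 := (hasDerivWithinAt_id s (Icc (0 : ℝ) 1)).smul_const c₀
        have a2 : HasDerivWithinAt (fun s : ℝ => s ^ 2 / 2) s (Icc 0 1) s := by
          have := ((hasDerivAt_pow 2 s).div_const 2).hasDerivWithinAt (s := Icc 0 1)
          convert! this using 1; norm_num
        have a3 : HasDerivWithinAt (fun s : ℝ => s ^ 3 / 3) (s ^ 2) (Icc 0 1) s := by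
          have := ((hasDerivAt_pow 3 s).div_const 3).hasDerivWithinAt (s := Icc 0 1)
          convert! this using 1; norm_num
        convert! ((a1.add (a2.smul_const c₁)).add (a3.smul_const c₂)).sub
          (a2.smul_const (κ * κ)) using 1
        simp [hψ]) hψc hu
    rw [h]
    simp
  have e : transport φ 1 - (1 - (c₀ + (1 / 2 : ℝ) • c₁ + (1 / 3 : ℝ) • c₂) +
        (1 / 2 : ℝ) • (κ * κ)) = -∫ s in (0 : ℝ)..1, (φ s * transport φ s - ψ s) := by
    rw [intervalIntegral.integral_sub (intervalIntegrable_of_continuousOn hφP hu)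
      (intervalIntegrable_of_continuousOn hψc hu), transport_eq hφ hu, hint]
    abel
  rw [e, norm_neg]
  refine norm_integral_le_of_norm_le (fun s hs => ?_) hu
  have hs1 : ‖s‖ ≤ 1 := by rw [Real.norm_of_nonneg hs.1]; exact hs.2
  calc ‖φ s * transport φ s - ψ s‖ = ‖(φ s - (c₀ + s • c₁ + s ^ 2 • c₂)) - s • ((φ s - κ) * κ) +
        φ s * (transport φ s - 1 + s • κ)‖ := by
        congr 1
        simp only [hψ, mul_add, mul_sub, sub_mul, smul_sub, mul_smul_comm, mul_one]
        abel
    _ ≤ K * ρ ^ 5 + 1 * (K * ρ ^ 3 * (K * ρ ^ 2)) +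
        2 * K * ρ ^ 2 * ((K * w + K * (2 * K * w)) * ρ ^ 3) := by
        refine norm_add_le_of_le (norm_sub_le_of_le (h2 s hs) ?_) ?_
        · rw [norm_smul]
          exact mul_le_mul hs1 ((norm_mul_le _ _).trans
            (mul_le_mul (h1 s hs) hκ (norm_nonneg _) (by positivity))) (norm_nonneg _) zero_le_one
        · exact (norm_mul_le _ _).trans
            (mul_le_mul (hφ2 s hs) (hP2 s hs) (norm_nonneg _) (by positivity))
    _ = _ := by ring

end LinearODE

namespace FockSchwingerGauge

open LinearODE UnitIntervalCalculus MeasureTheory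

variable {E : Type*} [NormedRing E] [NormedAlgebra ℝ E]
variable {X : Type*} [NormedAddCommGroup X] [NormedSpace ℝ X]

/-! ### Iterated covariant derivatives as multilinear maps -/

/-- The functions smooth on `V`, extended by zero. -/
def smoothOn (E : Type*) [NormedRing E] [NormedAlgebra ℝ E] (V : Set X) :
    Submodule ℝ (X → E) where
  carrier := {H | ContDiffOn ℝ ∞ H V ∧ ∀ p ∉ V, H p = 0}
  add_mem' h h' := ⟨h.1.add h'.1, fun p hp => by simp [h.2 p hp, h'.2 p hp]⟩
  zero_mem' := ⟨contDiffOn_const, fun _ _ => rfl⟩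
  smul_mem' c _ h := ⟨contDiffOn_const.smul h.1, fun p hp => by simp [h.2 p hp]⟩

/-- The restriction of a smooth function to `V`, extended by zero. -/
def restrictSmooth {V : Set X} {H : X → E} (hH : ContDiffOn ℝ ∞ H V) : smoothOn E V :=
  ⟨V.indicator H, hH.congr fun _ hp => indicator_of_mem hp H,
    fun _ hp => indicator_of_notMem hp H⟩

lemma restrictSmooth_apply {V : Set X} {H : X → E} (hH : ContDiffOn ℝ ∞ H V) {p : X}
    (hp : p ∈ V) : (restrictSmooth hH).1 p = H p := indicator_of_mem hp H

/-- Prescribing the value 0 off `V` makes agreement on `V` an equality, so that covariant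
differentiation is honestly linear. -/
lemma smoothOn_ext {V : Set X} {H H' : smoothOn E V} (h : EqOn H.1 H'.1 V) : H = H' := by
  refine Subtype.ext (funext fun p => ?_)
  by_cases hp : p ∈ V
  · exact h hp
  · rw [H.2.2 p hp, H'.2.2 p hp]

lemma cov_congr {𝒜 : X → X →L[ℝ] E} {V : Set X} (hV : IsOpen V) {H H' : X → E}
    (h : EqOn H H' V) (w : X) : EqOn (cov 𝒜 w H) (cov 𝒜 w H') V := fun p hp => by
  have he : H =ᶠ[𝓝 p] H' := Filter.eventuallyEq_of_mem (hV.mem_nhds hp) h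
  simp only [cov, he.fderiv_eq, h hp]

/-- The covariant derivative on the functions smooth on `V`. -/
def covLin {𝒜 : X → X →L[ℝ] E} {V : Set X} (hV : IsOpen V) (h𝒜 : ContDiffOn ℝ ∞ 𝒜 V) :
    X →ₗ[ℝ] smoothOn E V →ₗ[ℝ] smoothOn E V :=
  LinearMap.mk₂ ℝ (fun w H => restrictSmooth (contDiffOn_cov hV h𝒜 w H.2.1))
    (fun w w' H => smoothOn_ext fun p hp => by
      simp only [Submodule.coe_add, Pi.add_apply, restrictSmooth_apply _ hp, cov, map_add]
      noncomm_ring)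
    (fun c w H => smoothOn_ext fun p hp => by
      simp only [Submodule.coe_smul, Pi.smul_apply, restrictSmooth_apply _ hp, cov, map_smul,
        smul_mul_assoc, mul_smul_comm, smul_add, smul_sub])
    (fun w H H' => smoothOn_ext fun p hp => by
      have h1 := (H.2.1.differentiableOn (by simp)).differentiableAt (hV.mem_nhds hp)
      have h2 := (H'.2.1.differentiableOn (by simp)).differentiableAt (hV.mem_nhds hp)
      simp only [Submodule.coe_add, Pi.add_apply, restrictSmooth_apply _ hp, cov,
        fderiv_add h1 h2, add_apply]
      noncomm_ring)
    (fun c w H => smoothOn_ext fun p hp => by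
      have h1 := (H.2.1.differentiableOn (by simp)).differentiableAt (hV.mem_nhds hp)
      simp only [Submodule.coe_smul, Pi.smul_apply, restrictSmooth_apply _ hp, cov,
        fderiv_const_smul h1, smul_apply, smul_mul_assoc, mul_smul_comm, smul_add, smul_sub])

lemma covLin_apply {𝒜 : X → X →L[ℝ] E} {V : Set X} (hV : IsOpen V) (h𝒜 : ContDiffOn ℝ ∞ 𝒜 V)
    (w : X) (H : smoothOn E V) {p : X} (hp : p ∈ V) :
    (covLin hV h𝒜 w H).1 p = cov 𝒜 w H.1 p :=
  restrictSmooth_apply (contDiffOn_cov hV h𝒜 w H.2.1) hp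

lemma contDiffOn_curvature_apply {𝒜 : X → X →L[ℝ] E} {V : Set X} (hV : IsOpen V)
    (h𝒜 : ContDiffOn ℝ ∞ 𝒜 V) (u v : X) : ContDiffOn ℝ ∞ (fun p => curvature 𝒜 p u v) V :=
  ((contDiffOn_curvature hV h𝒜 (M := ∞) (by simp)).clm_apply contDiffOn_const).clm_apply
    contDiffOn_const

/-- The curvature as a bilinear map with values in the functions smooth on `V`. -/
def curvatureLin {𝒜 : X → X →L[ℝ] E} {V : Set X} (hV : IsOpen V) (h𝒜 : ContDiffOn ℝ ∞ 𝒜 V) :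
    X →ₗ[ℝ] X →ₗ[ℝ] smoothOn E V :=
  LinearMap.mk₂ ℝ (fun u v => restrictSmooth (contDiffOn_curvature_apply hV h𝒜 u v))
    (fun u u' v => smoothOn_ext fun p hp => by
      simp only [Submodule.coe_add, Pi.add_apply, restrictSmooth_apply _ hp, map_add, add_apply])
    (fun c u v => smoothOn_ext fun p hp => by
      simp only [Submodule.coe_smul, Pi.smul_apply, restrictSmooth_apply _ hp, map_smul,
        smul_apply])
    (fun u v v' => smoothOn_ext fun p hp => by
      simp only [Submodule.coe_add, Pi.add_apply, restrictSmooth_apply _ hp, map_add])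
    (fun c u v => smoothOn_ext fun p hp => by
      simp only [Submodule.coe_smul, Pi.smul_apply, restrictSmooth_apply _ hp, map_smul])

lemma curvatureLin_apply {𝒜 : X → X →L[ℝ] E} {V : Set X} (hV : IsOpen V)
    (h𝒜 : ContDiffOn ℝ ∞ 𝒜 V) (u v : X) {p : X} (hp : p ∈ V) :
    (curvatureLin hV h𝒜 u v).1 p = curvature 𝒜 p u v :=
  restrictSmooth_apply (contDiffOn_curvature_apply hV h𝒜 u v) hp

lemma curvatureLin_swap {𝒜 : X → X →L[ℝ] E} {V : Set X} (hV : IsOpen V)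
    (h𝒜 : ContDiffOn ℝ ∞ 𝒜 V) (u v : X) :
    curvatureLin hV h𝒜 u v = -curvatureLin hV h𝒜 v u := smoothOn_ext fun p hp => by
  simp only [Submodule.coe_neg, Pi.neg_apply, curvatureLin_apply _ _ _ _ hp, curvature_apply]
  abel

lemma curvatureLin_self {𝒜 : X → X →L[ℝ] E} {V : Set X} (hV : IsOpen V)
    (h𝒜 : ContDiffOn ℝ ∞ 𝒜 V) (u : X) : curvatureLin hV h𝒜 u u = 0 := smoothOn_ext fun p hp => by
  simp only [curvatureLin_apply _ _ _ _ hp, curvature_apply]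
  simp

lemma covLin_iterate_apply {𝒜 : X → X →L[ℝ] E} {V : Set X} (hV : IsOpen V)
    (h𝒜 : ContDiffOn ℝ ∞ 𝒜 V) (w : X) {H : smoothOn E V} {H' : X → E} (h : EqOn H.1 H' V)
    (j : ℕ) : EqOn ((covLin hV h𝒜 w)^[j] H).1 ((cov 𝒜 w)^[j] H') V := by
  induction j with
  | zero => exact h
  | succ j ih =>
    intro p hp
    rw [Function.iterate_succ_apply', Function.iterate_succ_apply', covLin_apply _ _ _ _ hp]
    exact cov_congr hV ih w hp

/-- Evaluation at a point. -/
def evalAt {V : Set X} (z : X) : smoothOn E V →ₗ[ℝ] E :=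
  (LinearMap.proj z : (X → E) →ₗ[ℝ] E) ∘ₗ (smoothOn E V).subtype

lemma evalAt_apply {V : Set X} (z : X) (H : smoothOn E V) : evalAt z H = H.1 z := rfl

/-! ### The holonomy of a small triangle to fourth order. -/

variable [CompleteSpace E] [IsDedekindFiniteMonoid E]

lemma gaugeTerm_eq {𝒜 : X → X →L[ℝ] E} {V : Set X} (hV : IsOpen V) (h𝒜 : ContDiffOn ℝ ∞ 𝒜 V)
    {z : X} (hz : z ∈ V) (w v : X) (j : ℕ) :
    gaugeTerm 𝒜 z w v j = (1 / ((j.factorial : ℝ) * ((j : ℝ) + 2))) •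
      evalAt z ((covLin hV h𝒜 w)^[j] (curvatureLin hV h𝒜 w v)) := by
  rw [gaugeTerm, evalAt_apply, covLin_iterate_apply hV h𝒜 w
    (fun p hp => curvatureLin_apply hV h𝒜 w v hp) j hz]

/-- The expansion to fourth order of the holonomy around the triangle with vertices `0`, `u`, `v`,
in terms of the curvature `Ω` and its covariant derivatives `D Ω` and `D D Ω`. -/
def holonomyExpansion {S : Type*} [AddCommGroup S] [Module ℝ S] (ev : S →ₗ[ℝ] E)
    (D : X →ₗ[ℝ] S →ₗ[ℝ] S) (Ω : X →ₗ[ℝ] X →ₗ[ℝ] S) (u v : X) : E :=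
  1 + (1 / 2 : ℝ) • ev (Ω u v)
    + (1 / 6 : ℝ) • (ev (D (-v) (Ω (-u) (v - u))) + ev (D (-u) (Ω (-v) (v - u))))
    + (1 / 8 : ℝ) • (ev (Ω u v) * ev (Ω u v))
    - (1 / 24 : ℝ) • ev (D (v - u) (D (v - u) (Ω (v - u) u)))
    - (1 / 16 : ℝ) • (ev (D u (D v (Ω (v - u) u))) + ev (D v (D u (Ω (v - u) u))))

/-- The left side is `1 - ∫(c₀ + s c₁ + s² c₂) + κ²/2`. Bilinearity and antisymmetry of `Ω` suffice:
neither the Bianchi identity nor any commutation of covariant derivatives enters. -/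
lemma holonomyExpansion_eq {S : Type*} [AddCommGroup S] [Module ℝ S] (ev : S →ₗ[ℝ] E)
    (D : X →ₗ[ℝ] S →ₗ[ℝ] S) (Ω : X →ₗ[ℝ] X →ₗ[ℝ] S) (hΩ : ∀ u, Ω u u = 0)
    (hΩ' : ∀ u v, Ω u v = -Ω v u) (u v : X) :
    1 - ((1 / 2 : ℝ) • ev (Ω v (u - v)) + (1 / 3 : ℝ) • ev (D v (Ω v (u - v))) +
        (1 / 8 : ℝ) • ev (D v (D v (Ω v (u - v)))) +
      (1 / 2 : ℝ) • ((1 / 3 : ℝ) • ev (D (u - v) (Ω v (u - v))) +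
        (1 / 8 : ℝ) • (ev (D (u - v) (D v (Ω v (u - v)))) +
          ev (D v (D (u - v) (Ω v (u - v)))))) +
      (1 / 3 : ℝ) • ((1 / 8 : ℝ) • ev (D (u - v) (D (u - v) (Ω v (u - v)))))) +
      (1 / 2 : ℝ) • (((1 / 2 : ℝ) • ev (Ω v (u - v))) * ((1 / 2 : ℝ) • ev (Ω v (u - v)))) =
    holonomyExpansion ev D Ω u v := by
  simp only [holonomyExpansion, map_sub, map_neg, LinearMap.sub_apply, LinearMap.neg_apply, hΩ,
    hΩ' v u, map_zero, sub_zero, smul_neg, neg_mul, mul_neg, smul_mul_assoc,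
    mul_smul_comm, neg_neg]
  module

/-- The weights are `1/(0!·2)`, `1/(1!·3)` and `1/(2!·4)`; the order of the two covariant
derivatives is preserved throughout. -/
lemma sum_iterate_affine {S : Type*} [AddCommGroup S] [Module ℝ S] (ev : S →ₗ[ℝ] E)
    (D : X →ₗ[ℝ] S →ₗ[ℝ] S) (v e : X) (o : S) (s : ℝ) :
    ∑ j ∈ Finset.range 3, (1 / ((j.factorial : ℝ) * ((j : ℝ) + 2))) •
        ev ((D (v + s • e))^[j] o) =
      (1 / 2 : ℝ) • ev o + (1 / 3 : ℝ) • ev (D v o) + (1 / 8 : ℝ) • ev (D v (D v o)) +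
      s • ((1 / 3 : ℝ) • ev (D e o) + (1 / 8 : ℝ) • (ev (D e (D v o)) + ev (D v (D e o)))) +
      s ^ 2 • ((1 / 8 : ℝ) • ev (D e (D e o))) := by
  simp only [Finset.sum_range_succ, Finset.range_zero, Finset.sum_empty, zero_add,
    Function.iterate_succ, Function.iterate_zero, Function.comp, id, map_add, map_smul,
    LinearMap.add_apply, LinearMap.smul_apply]
  norm_num [Nat.factorial]
  module

/-- The parallel transport with respect to the connection in Fock–Schwinger gauge along a short
segment. -/
lemma exists_norm_transport_gaugePotential_sub_le [ProperSpace X] {𝒜 : X → X →L[ℝ] E} {V : Set X}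
    (hV : IsOpen V) (h𝒜 : ContDiffOn ℝ ∞ 𝒜 V) {z : X} (hz : z ∈ V) {Γ : X → X →L[ℝ] E}
    (hΓ : ContinuousOn Γ V) (hΓ' : ∀ x ∈ V, ∀ v, Γ x v = gaugePotential 𝒜 z x v) :
    ∃ r > 0, ∃ C, ∀ x ∈ Metric.ball z r, ∀ y ∈ Metric.ball z r,
      ‖transport (fun s : ℝ => Γ (y + s • (x - y)) (x - y)) 1 -
        holonomyExpansion (evalAt z) (covLin hV h𝒜) (curvatureLin hV h𝒜) (x - z) (y - z)‖ ≤
      C * (‖x - z‖ + ‖y - z‖) ^ 5 := by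
  obtain ⟨r, hr0, hrV, hN⟩ := exists_norm_gaugePotential_sub_sum_le hV h𝒜 hz
  obtain ⟨C₁, hC₁, h1⟩ := hN 1
  obtain ⟨C₃, hC₃, h3⟩ := hN 3
  set Ω := curvatureLin hV h𝒜 with hΩ
  set D := covLin hV h𝒜 with hD
  set ev : smoothOn E V →ₗ[ℝ] E := evalAt z with hev
  set K := max (‖curvature 𝒜 z‖) (max C₁ C₃) with hK
  have hK0 : 0 ≤ K := hC₁.trans ((le_max_left _ _).trans (le_max_right _ _))
  have hC₁K : C₁ ≤ K := (le_max_left _ _).trans (le_max_right _ _)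
  have hC₃K : C₃ ≤ K := (le_max_right _ _).trans (le_max_right _ _)
  obtain ⟨C, hC, hmain⟩ := exists_norm_transport_sub_le (E := E) hK0
  -- The bound `1/2` on both distances ensures `ρ ≤ 1`.
  refine ⟨min r (1 / 2), lt_min hr0 (by norm_num), C, fun x hx y hy => ?_⟩
  set u := x - z with hu
  set v := y - z with hv
  set ρ := ‖u‖ + ‖v‖ with hρ
  have huv : x - y = u - v := by simp [hu, hv]
  have hun : ‖u‖ ≤ 1 / 2 := (mem_ball_iff_norm.1 hx).le.trans (min_le_right _ _)
  have hvn : ‖v‖ ≤ 1 / 2 := (mem_ball_iff_norm.1 hy).le.trans (min_le_right _ _)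
  have hρ0 : 0 ≤ ρ := by positivity
  have huvρ : ‖u - v‖ ≤ ρ := norm_sub_le _ _
  have hseg : ∀ s ∈ Icc (0 : ℝ) 1, y + s • (x - y) ∈ Metric.ball z r := fun s hs => by
    refine (convex_ball z r).add_smul_sub_mem ?_ ?_ hs
    · exact Metric.ball_subset_ball (min_le_left _ _) hy
    · exact Metric.ball_subset_ball (min_le_left _ _) hx
  have hw : ∀ s : ℝ, y + s • (x - y) - z = v + s • (u - v) := fun s => by
    rw [huv, hv]; abel
  have hwρ : ∀ s ∈ Icc (0 : ℝ) 1, ‖v + s • (u - v)‖ ≤ ρ := fun s hs => by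
    have e : v + s • (u - v) = (1 - s) • v + s • u := by module
    rw [e]
    refine (norm_add_le _ _).trans ?_
    rw [norm_smul, norm_smul, Real.norm_of_nonneg hs.1, Real.norm_of_nonneg (by linarith [hs.2])]
    nlinarith [norm_nonneg u, norm_nonneg v, hs.1, hs.2]
  -- The displacement along the segment is parallel to its direction and drops out by antisymmetry.
  have hΩs : ∀ s : ℝ, Ω (v + s • (u - v)) (u - v) = Ω v (u - v) := fun s => by
    rw [map_add, map_smul, LinearMap.add_apply, LinearMap.smul_apply, hΩ, curvatureLin_self,
      smul_zero, add_zero]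
  -- The remainder supplies `N + 1` powers of `ρ` and the direction `x - y` one more. Taking `N = 1`
  -- gives the approximation by `κ` to order `ρ³`, and `N = 3` the quadratic polynomial to order
  -- `ρ⁵`.
  have hexp : ∀ s ∈ Icc (0 : ℝ) 1, ∀ N C', 0 ≤ C' → C' ≤ K → (∀ x ∈ Metric.ball z r, ∀ v,
      ‖gaugePotential 𝒜 z x v - ∑ j ∈ Finset.range N, gaugeTerm 𝒜 z (x - z) v j‖ ≤
        C' * ‖x - z‖ ^ (N + 1) * ‖v‖) →
      ‖Γ (y + s • (x - y)) (x - y) - ∑ j ∈ Finset.range N,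
        (1 / ((j.factorial : ℝ) * ((j : ℝ) + 2))) •
          ev ((D (v + s • (u - v)))^[j] (Ω v (u - v)))‖ ≤ K * ρ ^ (N + 2) :=
    fun s hs N C' hC' hCK h => by
    have h' := h _ (hseg s hs) (x - y)
    rw [← hΓ' _ (hrV (hseg s hs)), hw, huv] at h'
    simp only [gaugeTerm_eq hV h𝒜 hz] at h'
    simp only [← hΩ, hΩs] at h'
    rw [huv]
    refine h'.trans ?_
    calc _ ≤ K * ρ ^ (N + 1) * ρ := by
          gcongr
          exact hwρ s hs
      _ = _ := by ring
  rw [← holonomyExpansion_eq ev D Ω (curvatureLin_self hV h𝒜) (curvatureLin_swap hV h𝒜)]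
  refine hmain _ _ _ _ _ ρ ?_ hρ0 (by linarith) ?_ (fun s hs => ?_) fun s hs => ?_
  · exact (hΓ.comp (by fun_prop) fun s hs => hrV (hseg s hs)).clm_apply continuousOn_const
  · have e : ev (Ω v (u - v)) = curvature 𝒜 z v (u - v) := curvatureLin_apply hV h𝒜 _ _ hz
    rw [e, norm_smul]
    have h4 : ‖curvature 𝒜 z v (u - v)‖ ≤ K * ρ * ρ := by
      refine ((curvature 𝒜 z v).le_opNorm _).trans ?_
      refine mul_le_mul ?_ huvρ (norm_nonneg _) (by positivity)
      refine ((curvature 𝒜 z).le_opNorm _).trans ?_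
      exact mul_le_mul (le_max_left _ _) (by linarith [norm_nonneg u]) (norm_nonneg _) hK0
    have h5 : ‖(1 / 2 : ℝ)‖ ≤ 1 := by norm_num
    calc _ ≤ 1 * (K * ρ * ρ) := mul_le_mul h5 h4 (norm_nonneg _) zero_le_one
      _ = _ := by ring
  · have h4 := hexp s hs 1 C₁ hC₁ hC₁K h1
    convert! h4 using 3
    simp
  · have h4 := hexp s hs 3 C₃ hC₃ hC₃K h3
    convert! h4 using 3
    exact (sum_iterate_affine ev D v (u - v) (Ω v (u - v)) s).symm

end FockSchwingerGauge

namespace OrderedExponential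

open LinearODE UnitIntervalCalculus FockSchwingerGauge

variable {d n : ℕ}

local notation "𝕏" => EuclideanSpace ℝ (Fin d)

variable {G : EuclideanSpace ℝ (Fin d) → Matrix (Fin d) (Fin d) ℝ}
  {V : Set (EuclideanSpace ℝ (Fin d))} {γ : ℝ → EuclideanSpace ℝ (Fin d)}
  {x y z : EuclideanSpace ℝ (Fin d)}

/-! ### Flat metrics -/

lemma christoffel_eq_zero (hV : IsOpen V) (hG : ∀ p ∈ V, G p = 1) (hx : x ∈ V)
    (ρ μ ν : Fin d) : christoffel G ρ μ ν x = 0 := by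
  have h : ∀ κ α β, pd κ (fun p => G p α β) x = 0 := fun κ α β => by
    have he : (fun p => G p α β) =ᶠ[𝓝 x] fun _ => (1 : Matrix (Fin d) (Fin d) ℝ) α β := by
      filter_upwards [hV.mem_nhds hx] with p hp
      rw [hG p hp]
    simp [pd, he.fderiv_eq]
  simp [christoffel, h]

/-- Geodesics of a flat metric are straight lines. -/
lemma IsGeodesic.eqOn_line (h : IsGeodesic G V γ y x) (hV : IsOpen V) (hG : ∀ p ∈ V, G p = 1) :
    EqOn γ (fun s => y + s • (x - y)) (Icc 0 1) := by
  have hu := uniqueDiffOn_Icc (zero_lt_one (α := ℝ))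
  have hd : DifferentiableOn ℝ (derivWithin γ (Icc 0 1)) (Icc 0 1) :=
    (h.contDiffOn.derivWithin hu (m := 1) (by norm_num)).differentiableOn (by norm_num)
  have h2 : ∀ s ∈ Icc (0 : ℝ) 1, HasDerivWithinAt (derivWithin γ (Icc 0 1)) 0 (Icc 0 1) s :=
    fun s hs => by
      have e : derivWithin (derivWithin γ (Icc 0 1)) (Icc 0 1) s = 0 := by
        rw [← iteratedDerivWithin_two]
        ext ρ
        have h3 := h.equation s hs ρ
        simpa [christoffel_eq_zero hV hG (h.mem s hs)] using h3
      exact e ▸ (hd s hs).hasDerivWithinAt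
  set w := derivWithin γ (Icc 0 1) 0 with hw
  have h3 : ∀ s ∈ Icc (0 : ℝ) 1, γ s = y + s • w := fun s hs => by
    have h4 := eq_of_hasDerivWithinAt_zero (G := fun s => γ s - (y + s • w)) (fun s hs => by
      have h5 := ((h.contDiffOn.differentiableOn (by norm_num)) s hs).hasDerivWithinAt
      rw [eq_of_hasDerivWithinAt_zero h2 hs] at h5
      have h6 := h5.fun_sub (hasDerivWithinAt_line y w s)
      rwa [← hw, sub_self] at h6) hs
    simpa [h.source, sub_eq_zero] using h4
  have h4 : x - y = w := by
    rw [← h.target, h3 1 ⟨zero_le_one, le_rfl⟩, one_smul, add_sub_cancel_left]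
  intro s hs
  rw [h3 s hs, h4]

lemma IsGeodesic.formAlong_eq (h : IsGeodesic G V γ y x) (hV : IsOpen V) (hG : ∀ p ∈ V, G p = 1)
    (𝒜 : 𝕏 → 𝕏 →L[ℝ] NMat n) : EqOn (formAlong 𝒜 γ) (radial 𝒜 y x) (Icc 0 1) := fun s hs => by
  rw [formAlong_congr 𝒜 (h.eqOn_line hV hG) hs]
  simp only [formAlong, radial]
  rw [(hasDerivWithinAt_line y (x - y) s).derivWithin (uniqueDiffOn_Icc zero_lt_one s hs)]

lemma IsConvexDomain.line_mem (hV : IsConvexDomain G V) (hG : ∀ p ∈ V, G p = 1) (hy : y ∈ V)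
    (hx : x ∈ V) {s : ℝ} (hs : s ∈ Icc (0 : ℝ) 1) : y + s • (x - y) ∈ V := by
  obtain ⟨γ, hγ⟩ := hV.exists_isGeodesic hy hx
  have h := hγ.eqOn_line hV.1 hG hs
  simp only at h
  exact h ▸ hγ.mem s hs

lemma IsConvexDomain.orderedExp_eq_radial (hV : IsConvexDomain G V) (hG : ∀ p ∈ V, G p = 1)
    (hy : y ∈ V) (hx : x ∈ V) {A : Fin d → 𝕏 → NMat n} (hA : ∀ μ, ContinuousOn (A μ) V) :
    orderedExpN G V A x y = transport (radial (form A) y x) 1 := by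
  obtain ⟨γ, hγ⟩ := hV.exists_isGeodesic hy hx
  rw [hV.orderedExp_eq hy hx hγ hA]
  exact transport_congr (hγ.formAlong_eq hV.1 hG _) ⟨zero_le_one, le_rfl⟩

lemma IsConvexDomain.orderedExp_eq_radial_inv (hV : IsConvexDomain G V) (hG : ∀ p ∈ V, G p = 1)
    (hy : y ∈ V) (hx : x ∈ V) {A : Fin d → 𝕏 → NMat n} (hA : ∀ μ, ContinuousOn (A μ) V) :
    orderedExpN G V A y x = transportInv (radial (form A) y x) 1 := by
  obtain ⟨γ, hγ⟩ := hV.exists_isGeodesic hy hx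
  rw [hV.orderedExp_reverse hy hx hγ hA]
  exact transportInv_congr (hγ.formAlong_eq hV.1 hG _) ⟨zero_le_one, le_rfl⟩

lemma IsConvexDomain.form_fockSchwingerN (hV : IsConvexDomain G V) (hG : ∀ p ∈ V, G p = 1)
    {A : Fin d → 𝕏 → NMat n} (hA : ∀ μ, ContDiffOn ℝ ∞ (A μ) V) (hz : z ∈ V) (hx : x ∈ V)
    (v : 𝕏) : form (fockSchwingerN G V A z) x v = gaugePotential (form A) z x v := by
  have hAc : ∀ μ, ContinuousOn (A μ) V := fun μ => (hA μ).continuousOn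
  have hstar : ∀ x ∈ V, ∀ s ∈ Icc (0 : ℝ) 1, z + s • (x - z) ∈ V := fun x hx s hs =>
    hV.line_mem hG hz hx hs
  rw [fockSchwingerN_eq (isC1Family_radial hV.1 (contDiffOn_form hA) hstar)
    (fun x hx => hV.orderedExp_eq_radial hG hz hx hAc)
    (fun x hx => hV.orderedExp_eq_radial_inv hG hz hx hAc) hx,
    gaugePotential_eq hV.1 (contDiffOn_form hA) hstar hx]

lemma IsConvexDomain.fockSchwingerN_eq_gaugePotential (hV : IsConvexDomain G V)
    (hG : ∀ p ∈ V, G p = 1) {A : Fin d → 𝕏 → NMat n} (hA : ∀ μ, ContDiffOn ℝ ∞ (A μ) V)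
    (hz : z ∈ V) (hx : x ∈ V) (σ : Fin d) :
    fockSchwingerN G V A z σ x = gaugePotential (form A) z x (EuclideanSpace.single σ 1) := by
  rw [← hV.form_fockSchwingerN hG hA hz hx, form_single]

lemma IsConvexDomain.fockSchwingerN_isBigO (hV : IsConvexDomain G V) (hG : ∀ p ∈ V, G p = 1)
    {A : Fin d → 𝕏 → NMat n} (hA : ∀ μ, ContDiffOn ℝ ∞ (A μ) V) (hz : z ∈ V) (σ : Fin d)
    (N : ℕ) :
    (fun x => fockSchwingerN G V A z σ x - ∑ j ∈ Finset.range N,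
        gaugeTerm (form A) z (x - z) (EuclideanSpace.single σ 1) j)
      =O[𝓝 z] fun x => ‖x - z‖ ^ (N + 1) := by
  obtain ⟨r, hr0, hrV, h⟩ := exists_norm_gaugePotential_sub_sum_le hV.1 (contDiffOn_form hA) hz
  obtain ⟨C, -, hC⟩ := h N
  refine IsBigO.of_bound (C * ‖EuclideanSpace.single σ (1 : ℝ)‖) ?_
  filter_upwards [Metric.ball_mem_nhds z hr0] with x hx
  rw [hV.fockSchwingerN_eq_gaugePotential hG hA hz (hrV hx), norm_pow, norm_norm]
  refine (hC x hx _).trans (le_of_eq ?_)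
  ring

lemma IsConvexDomain.hasSum_fockSchwingerN (hV : IsConvexDomain G V) (hG : ∀ p ∈ V, G p = 1)
    {A : Fin d → 𝕏 → NMat n} (hA : ∀ μ, ContDiffOn ℝ ∞ (A μ) V) (hz : z ∈ V)
    (ha : AnalyticAt ℝ (form A) z) :
    ∀ᶠ x in 𝓝 z, ∀ σ, HasSum (gaugeTerm (form A) z (x - z) (EuclideanSpace.single σ 1))
      (fockSchwingerN G V A z σ x) := by
  filter_upwards [hasSum_gaugeTerm ha, hV.1.mem_nhds hz] with x hx hxV σ
  rw [hV.fockSchwingerN_eq_gaugePotential hG hA hz hxV]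
  exact hx _

lemma IsConvexDomain.triple_product_isBigO (hV : IsConvexDomain G V) (hG : ∀ p ∈ V, G p = 1)
    {A : Fin d → 𝕏 → NMat n} (hA : ∀ μ, ContDiffOn ℝ ∞ (A μ) V) (hz : z ∈ V) :
    (fun p : 𝕏 × 𝕏 => orderedExpN G V A z p.1 * orderedExpN G V A p.1 p.2 *
        orderedExpN G V A p.2 z -
        holonomyExpansion (evalAt z) (covLin hV.1 (contDiffOn_form hA))
          (curvatureLin hV.1 (contDiffOn_form hA)) (p.1 - z) (p.2 - z))
      =O[𝓝 (z, z)] fun p => (‖p.1 - z‖ + ‖p.2 - z‖) ^ 5 := by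
  have hfc := hV.continuousOn_fockSchwingerN hA hz
  obtain ⟨r, hr0, C, hC⟩ := exists_norm_transport_gaugePotential_sub_le hV.1 (contDiffOn_form hA)
    hz (continuousOn_form hfc) fun x hx v => hV.form_fockSchwingerN hG hA hz hx v
  refine IsBigO.of_bound C ?_
  rw [nhds_prod_eq]
  filter_upwards [prod_mem_prod (inter_mem (Metric.ball_mem_nhds z hr0) (hV.1.mem_nhds hz))
    (inter_mem (Metric.ball_mem_nhds z hr0) (hV.1.mem_nhds hz))] with p hp
  rw [hV.triple_product hA hp.1.2 hp.2.2 hz, hV.orderedExp_eq_radial hG hp.2.2 hp.1.2 hfc,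
    Real.norm_of_nonneg (by positivity)]
  exact hC _ hp.1.1 _ hp.2.1

end OrderedExponential

namespace OrderedExponential

open LinearODE UnitIntervalCalculus FockSchwingerGauge

/-! ### The adjoint representation -/

section Adjoint

variable {n : ℕ} {𝔤 : Type*} [LieRing 𝔤] [LieAlgebra ℝ 𝔤] (t : Module.Basis (Fin n) ℝ 𝔤)

lemma killingForm_lie_eq (ht : ∀ a b, killingForm ℝ 𝔤 (t a) (t b) = if a = b then -2 else 0)
    (a b c : Fin n) : killingForm ℝ 𝔤 ⁅t a, t b⁆ (t c) = -2 * structConst t a b c := by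
  conv_lhs => rw [← t.sum_repr ⁅t a, t b⁆]
  simp only [map_sum, map_smul, LinearMap.sum_apply, LinearMap.smul_apply, ht, smul_eq_mul,
    mul_ite, mul_zero, Finset.sum_ite_eq', Finset.mem_univ, if_true, structConst]
  ring

/-- In this basis the structure constants are, up to the factor `-2`, the values of the Killing form
on a bracket and a generator; invariance and symmetry of the form rotate the indices. -/
lemma structConst_cyclic (ht : ∀ a b, killingForm ℝ 𝔤 (t a) (t b) = if a = b then -2 else 0)
    (a b c : Fin n) : structConst t a b c = structConst t b c a := by
  have h1 := killingForm_lie_eq t ht a b c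
  have h2 := killingForm_lie_eq t ht b c a
  have h3 : killingForm ℝ 𝔤 ⁅t a, t b⁆ (t c) = killingForm ℝ 𝔤 ⁅t b, t c⁆ (t a) :=
    (LieModule.traceForm_apply_lie_apply ℝ 𝔤 𝔤 _ _ _).trans (LieModule.traceForm_comm ℝ 𝔤 𝔤 _ _)
  linarith

/-- The matrices are those of the representation dual to the adjoint one. As `X ↦ -Xᵀ` preserves
commutators, brackets are respected. -/
lemma adMat_eq (h : Fin n → ℝ) :
    adMat t h = -(LinearMap.toMatrix t t (LieAlgebra.ad ℝ 𝔤 (t.equivFun.symm h)))ᵀ := by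
  ext a b
  have e : ∀ c, structConst t a c b = -structConst t c a b := fun c => by
    rw [structConst, structConst, ← lie_skew, map_neg, Finsupp.neg_apply]
  rw [Matrix.neg_apply, Matrix.transpose_apply, LinearMap.toMatrix_apply, LieAlgebra.ad_apply,
    Module.Basis.equivFun_symm_apply, sum_lie]
  simp only [adMat, Matrix.of_apply, e, smul_lie, map_sum, map_smul, Finsupp.coe_finsetSum, Finset.sum_apply, Finsupp.smul_apply,
    smul_eq_mul, ← Finset.sum_neg_distrib]
  refine Finset.sum_congr rfl fun c _ => ?_
  rw [structConst]
  ring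

/-- The adjoint representation as a linear map. -/
def adLin : (Fin n → ℝ) →L[ℝ] NMat n :=
  LinearMap.toContinuousLinearMap
    { toFun := fun h => adMat t h
      map_add' := fun h h' => Matrix.ext fun a b => by
        show adMat t _ a b = adMat t h a b + adMat t h' a b
        simp [adMat, mul_add, Finset.sum_add_distrib]
      map_smul' := fun c h => Matrix.ext fun a b => by
        show adMat t _ a b = c • adMat t h a b
        simp [adMat, Finset.mul_sum, mul_left_comm] }

/-- The bracket in components. -/
def bracket (u v : Fin n → ℝ) (a : Fin n) : ℝ := ∑ b, ∑ c, structConst t a b c * u b * v c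

/-- In `f^{abc} u^b v^c` the free index stands first, in the bracket of generators last; cyclicity
reconciles the two. -/
lemma equivFun_symm_bracket
    (ht : ∀ a b, killingForm ℝ 𝔤 (t a) (t b) = if a = b then -2 else 0) (u v : Fin n → ℝ) :
    t.equivFun.symm (bracket t u v) = ⁅t.equivFun.symm u, t.equivFun.symm v⁆ := by
  apply t.repr.injective
  ext a
  have e : ∀ b c, structConst t a b c = t.repr ⁅t b, t c⁆ a := fun b c =>
    structConst_cyclic t ht a b c
  have e' : t.repr (t.equivFun.symm (bracket t u v)) a = bracket t u v a :=
    congrFun (t.equivFun.apply_symm_apply (bracket t u v)) a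
  rw [e']
  simp only [Module.Basis.equivFun_symm_apply, sum_lie, lie_sum, smul_lie, lie_smul, map_sum,
    map_smul, Finsupp.coe_finsetSum, Finset.sum_apply, Finsupp.smul_apply, smul_eq_mul,
    bracket, e, Finset.mul_sum]
  rw [Finset.sum_comm]
  refine Finset.sum_congr rfl fun b _ => Finset.sum_congr rfl fun c _ => ?_
  ring

lemma adLin_bracket (ht : ∀ a b, killingForm ℝ 𝔤 (t a) (t b) = if a = b then -2 else 0)
    (u v : Fin n → ℝ) :
    adLin t (bracket t u v) = adLin t u * adLin t v - adLin t v * adLin t u := by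
  have h : adMat t (bracket t u v) = adMat t u * adMat t v - adMat t v * adMat t u := by
    simp only [adMat_eq, equivFun_symm_bracket t ht, LieHom.map_lie, Ring.lie_def, map_sub,
      LinearMap.toMatrix_mul, Matrix.transpose_sub, Matrix.transpose_mul, neg_mul_neg]
    abel
  exact h

end Adjoint

variable {d n : ℕ}

local notation "𝕏" => EuclideanSpace ℝ (Fin d)
local notation "𝐞" μ:max => EuclideanSpace.single μ (1 : ℝ)

/-! ### Components of multilinear expressions -/

section Components

variable {Y : Type*} [AddCommGroup Y] [Module ℝ Y]

lemma eq_sum_single (v : 𝕏) : v = ∑ μ, v μ • 𝐞 μ := by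
  ext ν
  simp [Finset.sum_apply, Pi.single_apply]

lemma eq_sum_of_isLinearMap {q : 𝕏 → Y} (h : IsLinearMap ℝ q) (u : 𝕏) :
    q u = ∑ μ, u μ • q (𝐞 μ) := by
  have h1 := map_sum h.mk' (fun μ => u μ • 𝐞 μ) Finset.univ
  rw [← eq_sum_single u] at h1
  simpa using h1

lemma eq_sum_of_isLinearMap₂ {q : 𝕏 → 𝕏 → Y} (h1 : ∀ b, IsLinearMap ℝ fun a => q a b)
    (h2 : ∀ a, IsLinearMap ℝ (q a)) (a b : 𝕏) :
    q a b = ∑ μ, ∑ ν, (a μ * b ν) • q (𝐞 μ) (𝐞 ν) := by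
  rw [eq_sum_of_isLinearMap (h1 b)]
  simp only [fun μ => eq_sum_of_isLinearMap (h2 (𝐞 μ)) b, Finset.smul_sum, smul_smul]

lemma eq_sum_of_isLinearMap₃ {q : 𝕏 → 𝕏 → 𝕏 → Y} (h1 : ∀ b c, IsLinearMap ℝ fun a => q a b c)
    (h2 : ∀ a c, IsLinearMap ℝ fun b => q a b c) (h3 : ∀ a b, IsLinearMap ℝ (q a b))
    (a b c : 𝕏) :
    q a b c = ∑ μ, ∑ ν, ∑ σ, (a μ * b ν * c σ) • q (𝐞 μ) (𝐞 ν) (𝐞 σ) := by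
  rw [eq_sum_of_isLinearMap₂ (fun b => h1 b c) (fun a => h2 a c)]
  simp only [fun μ ν => eq_sum_of_isLinearMap (h3 (𝐞 μ) (𝐞 ν)) c, Finset.smul_sum, smul_smul]

lemma eq_sum_of_isLinearMap₄ {q : 𝕏 → 𝕏 → 𝕏 → 𝕏 → Y}
    (h1 : ∀ b c e, IsLinearMap ℝ fun a => q a b c e)
    (h2 : ∀ a c e, IsLinearMap ℝ fun b => q a b c e)
    (h3 : ∀ a b e, IsLinearMap ℝ fun c => q a b c e) (h4 : ∀ a b c, IsLinearMap ℝ (q a b c))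
    (a b c e : 𝕏) :
    q a b c e = ∑ μ, ∑ ν, ∑ σ, ∑ ρ, (a μ * b ν * c σ * e ρ) • q (𝐞 μ) (𝐞 ν) (𝐞 σ) (𝐞 ρ) := by
  rw [eq_sum_of_isLinearMap₃ (fun b c => h1 b c e) (fun a c => h2 a c e) (fun a b => h3 a b e)]
  simp only [fun μ ν σ => eq_sum_of_isLinearMap (h4 (𝐞 μ) (𝐞 ν) (𝐞 σ)) e, Finset.smul_sum,
    smul_smul]

/-- The outermost derivative is expanded in coordinates and its index prepended to the multi-index.
-/
lemma iterate_eq_sum (D : 𝕏 →ₗ[ℝ] Y →ₗ[ℝ] Y) (O : 𝕏 →ₗ[ℝ] Y) (w : 𝕏) (j : ℕ) :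
    (D w)^[j] (O w) = ∑ m : Fin (j + 1) → Fin d, (∏ i, w (m i)) •
      (List.ofFn fun i : Fin j => m i.castSucc).foldr (fun μ => D (𝐞 μ))
        (O (𝐞 (m (Fin.last j)))) := by
  induction j with
  | zero =>
    rw [Function.iterate_zero, id, eq_sum_of_isLinearMap O.isLinear w]
    refine (Fintype.sum_equiv (Equiv.funUnique (Fin 1) (Fin d)) _ _ fun m => ?_).symm
    simp
  | succ j ih =>
    have hD : D w = ∑ μ, w μ • D (𝐞 μ) := eq_sum_of_isLinearMap D.isLinear w
    rw [Function.iterate_succ_apply', ih, hD,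
      ← (Fin.consEquiv fun _ : Fin (j + 2) => Fin d).sum_comp, Fintype.sum_prod_type]
    simp only [LinearMap.sum_apply, LinearMap.smul_apply, map_sum, map_smul, Finset.smul_sum,
      smul_smul]
    rw [Finset.sum_comm]
    refine Finset.sum_congr rfl fun μ _ => Finset.sum_congr rfl fun m _ => ?_
    rw [mul_comm]
    simp [Fin.consEquiv, Fin.prod_univ_succ, List.ofFn_succ, ← Fin.succ_last]

end Components

/-! ### Covariant derivatives in components -/

/-- The covariant derivative as an element of `NMat n`. -/
def covDN (A : Fin d → 𝕏 → NMat n) (μ : Fin d) (H : 𝕏 → NMat n) (x : 𝕏) : NMat n :=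
  covD (n := n) A μ H x

lemma covDN_def (A : Fin d → 𝕏 → NMat n) (μ : Fin d) (H : 𝕏 → NMat n) (x : 𝕏) :
    covDN A μ H x = pdN μ H x + (A μ x * H x - H x * A μ x) := rfl

lemma covDN_eq {A : Fin d → 𝕏 → NMat n} {μ : Fin d} {H : 𝕏 → NMat n} {x : 𝕏}
    (hH : DifferentiableAt ℝ H x) : covDN A μ H x = cov (form A) (𝐞 μ) H x := by
  rw [covDN_def, pdN_eq hH, cov, form_single]

variable {V : Set (EuclideanSpace ℝ (Fin d))} {A : Fin d → EuclideanSpace ℝ (Fin d) → NMat n}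

lemma covDN_eqOn (hV : IsOpen V) (hA : ContDiffOn ℝ ∞ (form A) V) {H : 𝕏 → NMat n}
    {H' : smoothOn (NMat n) V} (h : EqOn H H'.1 V) (μ : Fin d) :
    EqOn (covDN A μ H) (covLin hV hA (𝐞 μ) H').1 V := fun p hp => by
  have h1 : DifferentiableAt ℝ H p :=
    ((H'.2.1.congr h).differentiableOn (by simp)).differentiableAt (hV.mem_nhds hp)
  rw [covDN_eq h1, covLin_apply hV hA _ _ hp]
  exact cov_congr hV h _ hp

lemma foldr_covDN_eqOn (hV : IsOpen V) (hA : ContDiffOn ℝ ∞ (form A) V) {H : 𝕏 → NMat n}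
    {H' : smoothOn (NMat n) V} (h : EqOn H H'.1 V) (l : List (Fin d)) :
    EqOn (l.foldr (covDN A) H) (l.foldr (fun μ => covLin hV hA (𝐞 μ)) H').1 V := by
  induction l with
  | nil => exact h
  | cons μ l ih => exact covDN_eqOn hV hA ih μ

variable {F : Fin d → Fin d → EuclideanSpace ℝ (Fin d) → NMat n} {z : EuclideanSpace ℝ (Fin d)}

/-- The terms of the expansion of the connection in Fock–Schwinger gauge, as elements of
`NMat n`. -/
def fockSchwingerTermN (A : Fin d → 𝕏 → NMat n) (F : Fin d → Fin d → 𝕏 → NMat n) (z : 𝕏)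
    (σ : Fin d) (x : 𝕏) (j : ℕ) : NMat n :=
  fockSchwingerTerm (n := n) A F z σ x j

lemma fockSchwingerTermN_def (A : Fin d → 𝕏 → NMat n) (F : Fin d → Fin d → 𝕏 → NMat n) (z : 𝕏)
    (σ : Fin d) (x : 𝕏) (j : ℕ) :
    fockSchwingerTermN A F z σ x j = ∑ m : Fin (j + 1) → Fin d,
      ((∏ i, (x - z) (m i)) / ((j.factorial : ℝ) * ((j : ℝ) + 2))) •
        (List.ofFn fun i : Fin j => m i.castSucc).foldr (covDN A) (F (m (Fin.last j)) σ) z :=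
  rfl

lemma fockSchwingerTermN_eq (hV : IsOpen V) (hA : ContDiffOn ℝ ∞ (form A) V)
    (hF : ∀ μ ν, EqOn (F μ ν) (fun p => curvature (form A) p (𝐞 μ) (𝐞 ν)) V) (hz : z ∈ V)
    (σ : Fin d) (x : 𝕏) (j : ℕ) :
    fockSchwingerTermN A F z σ x j = gaugeTerm (form A) z (x - z) (𝐞 σ) j := by
  have h1 : ∀ μ ν, EqOn (F μ ν) (curvatureLin hV hA (𝐞 μ) (𝐞 ν)).1 V := fun μ ν p hp => by
    rw [curvatureLin_apply hV hA _ _ hp, hF μ ν hp]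
  have h2 := iterate_eq_sum (covLin hV hA) ((curvatureLin hV hA).flip (𝐞 σ)) (x - z) j
  simp only [LinearMap.flip_apply] at h2
  rw [gaugeTerm_eq hV hA hz, h2, fockSchwingerTermN_def, map_sum, Finset.smul_sum]
  refine Finset.sum_congr rfl fun m _ => ?_
  rw [map_smul, smul_smul, evalAt_apply, foldr_covDN_eqOn hV hA (h1 _ _) _ hz]
  congr 1
  ring

/-- The explicit monomials of the triple product, as an element of `NMat n`. -/
def tripleExpansionN (A : Fin d → 𝕏 → NMat n) (F : Fin d → Fin d → 𝕏 → NMat n) (x y z : 𝕏) :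
    NMat n :=
  tripleExpansion (n := n) A F x y z

lemma tripleExpansionN_def (A : Fin d → 𝕏 → NMat n) (F : Fin d → Fin d → 𝕏 → NMat n)
    (x y z : 𝕏) :
    tripleExpansionN A F x y z =
  1 + (1 / 2 : ℝ) • (∑ ν, ∑ μ, ((x - z) ν * (y - z) μ) • F ν μ z)
    + (1 / 6 : ℝ) • (∑ ν, ∑ σ, ∑ μ, ((z - y) ν * (z - x) σ * (y - x) μ) •
        (covDN A ν (F σ μ) z + covDN A σ (F ν μ) z))
    + (1 / 8 : ℝ) • (∑ ν, ∑ σ, ∑ μ, ∑ ρ,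
        ((x - z) ν * (x - z) σ * (y - z) μ * (y - z) ρ) • (F ν μ z * F σ ρ z))
    - (1 / 24 : ℝ) • (∑ μ, ∑ ν, ∑ σ, ∑ ρ,
        ((y - x) μ * (y - x) ν * (y - x) σ * (x - z) ρ) • covDN A μ (covDN A ν (F σ ρ)) z)
    - (1 / 16 : ℝ) • (∑ μ, ∑ ρ, ∑ σ, ∑ ν,
        ((x - z) μ * (x - z) ρ * (y - x) σ * (y - z) ν) •
        (covDN A μ (covDN A ν (F σ ρ)) z + covDN A ν (covDN A μ (F σ ρ)) z)) :=
  rfl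

lemma tripleExpansionN_eq (hV : IsOpen V) (hA : ContDiffOn ℝ ∞ (form A) V)
    (hF : ∀ μ ν, EqOn (F μ ν) (fun p => curvature (form A) p (𝐞 μ) (𝐞 ν)) V) (hz : z ∈ V)
    (x y : 𝕏) :
    tripleExpansionN A F x y z =
      holonomyExpansion (evalAt z) (covLin hV hA) (curvatureLin hV hA) (x - z) (y - z) := by
  have h0 : ∀ μ ν, EqOn (F μ ν) (curvatureLin hV hA (𝐞 μ) (𝐞 ν)).1 V := fun μ ν p hp => by
    rw [curvatureLin_apply hV hA _ _ hp, hF μ ν hp]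
  have h1 := fun μ σ ρ => covDN_eqOn hV hA (h0 σ ρ) μ
  have h2 := fun μ ν σ ρ => covDN_eqOn hV hA (h1 ν σ ρ) μ
  have e0 : ∀ μ ν, F μ ν z = evalAt z (curvatureLin hV hA (𝐞 μ) (𝐞 ν)) := fun μ ν => h0 μ ν hz
  have e1 : ∀ μ σ ρ, covDN A μ (F σ ρ) z =
      evalAt z (covLin hV hA (𝐞 μ) (curvatureLin hV hA (𝐞 σ) (𝐞 ρ))) := fun μ σ ρ => h1 μ σ ρ hz
  have e2 : ∀ μ ν σ ρ, covDN A μ (covDN A ν (F σ ρ)) z =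
      evalAt z (covLin hV hA (𝐞 μ) (covLin hV hA (𝐞 ν) (curvatureLin hV hA (𝐞 σ) (𝐞 ρ)))) :=
    fun μ ν σ ρ => h2 μ ν σ ρ hz
  rw [tripleExpansionN_def]
  simp only [e0, e1, e2]
  -- Only linearity in each argument matters from here on.
  generalize covLin hV hA = D
  generalize curvatureLin hV hA = Ω
  generalize (evalAt z : smoothOn (NMat n) V →ₗ[ℝ] NMat n) = ev
  have hyx : y - x = (y - z) - (x - z) := by abel
  have hzx : z - x = -(x - z) := by abel
  have hzy : z - y = -(y - z) := by abel
  rw [hyx, hzx, hzy]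
  generalize x - z = u
  generalize y - z = v
  -- Each index sum is folded back into a multilinear map, with arguments in the order of the
  -- summation indices; in the last one the second argument sits in the second slot of `Ω`.
  rw [holonomyExpansion,
    ← eq_sum_of_isLinearMap₂ (q := fun a b => ev (Ω a b)) (fun _ => ⟨by simp, by simp⟩)
      (fun _ => ⟨by simp, by simp⟩),
    ← eq_sum_of_isLinearMap₃ (q := fun a b c => ev (D a (Ω b c)) + ev (D b (Ω a c)))
      (fun _ _ => ⟨fun _ _ => by simp; abel, by simp⟩)
      (fun _ _ => ⟨fun _ _ => by simp; abel, by simp⟩)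
      (fun _ _ => ⟨fun _ _ => by simp; abel, by simp⟩),
    ← eq_sum_of_isLinearMap₄ (q := fun a b c e => ev (Ω a c) * ev (Ω b e))
      (fun _ _ _ => ⟨by simp [add_mul], by simp⟩) (fun _ _ _ => ⟨by simp [mul_add], by simp⟩)
      (fun _ _ _ => ⟨by simp [add_mul], by simp⟩) (fun _ _ _ => ⟨by simp [mul_add], by simp⟩),
    ← eq_sum_of_isLinearMap₄ (q := fun a b c e => ev (D a (D b (Ω c e))))
      (fun _ _ _ => ⟨by simp, by simp⟩) (fun _ _ _ => ⟨by simp, by simp⟩)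
      (fun _ _ _ => ⟨by simp, by simp⟩) (fun _ _ _ => ⟨by simp, by simp⟩),
    ← eq_sum_of_isLinearMap₄
      (q := fun a b c e => ev (D a (D e (Ω c b))) + ev (D e (D a (Ω c b))))
      (fun _ _ _ => ⟨fun _ _ => by simp; abel, by simp⟩)
      (fun _ _ _ => ⟨fun _ _ => by simp; abel, by simp⟩)
      (fun _ _ _ => ⟨fun _ _ => by simp; abel, by simp⟩)
      (fun _ _ _ => ⟨fun _ _ => by simp; abel, by simp⟩)]

/-! ### The field strength as a curvature -/

lemma pd_apply_eq {b : 𝕏 → Fin n → ℝ} {p : 𝕏} (hb : DifferentiableAt ℝ b p) (μ : Fin d)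
    (a : Fin n) : pd μ (fun q => b q a) p = fderiv ℝ b p (𝐞 μ) a := by
  rw [pd, (hasFDerivAt_pi'.1 hb.hasFDerivAt a).fderiv]
  rfl

lemma fderiv_form_apply {p : 𝕏} (hA : DifferentiableAt ℝ (form A) p) (u : 𝕏) (ν : Fin d) :
    fderiv ℝ (form A) p u (𝐞 ν) = fderiv ℝ (A ν) p u := by
  have h := (hA.hasFDerivAt.clm_apply (hasFDerivAt_const (𝐞 ν) p)).fderiv
  simp only [form_single] at h
  rw [h]
  simp

/-- `adLin` is linear, so it commutes with partial derivatives, and `adLin_bracket` turns the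
structure-constant term into a commutator. -/
lemma fieldStrength_eq_curvature {𝔤 : Type*} [LieRing 𝔤] [LieAlgebra ℝ 𝔤]
    (t : Module.Basis (Fin n) ℝ 𝔤)
    (ht : ∀ a b, killingForm ℝ 𝔤 (t a) (t b) = if a = b then -2 else 0)
    {b : Fin d → 𝕏 → Fin n → ℝ} {p : 𝕏} (hb : ∀ μ, DifferentiableAt ℝ (b μ) p)
    (hA : DifferentiableAt ℝ (form fun μ p => adLin t (b μ p)) p) (μ ν : Fin d) :
    adLin t (fieldStrength t b μ ν p) =
      curvature (form fun μ p => adLin t (b μ p)) p (𝐞 μ) (𝐞 ν) := by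
  have h1 : fieldStrength t b μ ν p = fderiv ℝ (b ν) p (𝐞 μ) - fderiv ℝ (b μ) p (𝐞 ν) +
      bracket t (b μ p) (b ν p) := by
    ext a
    simp only [fieldStrength, pd_apply_eq (hb _), bracket, Pi.add_apply, Pi.sub_apply]
  have h2 : ∀ μ u, fderiv ℝ (fun p => adLin t (b μ p)) p u = adLin t (fderiv ℝ (b μ) p u) :=
    fun μ u => by
      have h := ((adLin t).hasFDerivAt.comp p (hb μ).hasFDerivAt).fderiv
      exact congrArg (fun L : 𝕏 →L[ℝ] NMat n => L u) h
  rw [h1, map_add, map_sub, adLin_bracket t ht, curvature_apply, fderiv_form_apply hA,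
    fderiv_form_apply hA, h2, h2, form_single, form_single]

end OrderedExponential

namespace OrderedExponential

open LinearODE UnitIntervalCalculus FockSchwingerGauge

lemma analyticAt_form {d n : ℕ} {A : Fin d → EuclideanSpace ℝ (Fin d) → NMat n}
    {z : EuclideanSpace ℝ (Fin d)} (hA : ∀ μ, AnalyticAt ℝ (A μ) z) :
    AnalyticAt ℝ (form A) z := by
  have h : form A = fun p => ∑ μ, ContinuousLinearMap.smulRightL ℝ (EuclideanSpace ℝ (Fin d))
      (NMat n) (EuclideanSpace.proj μ) (A μ p) := rfl
  rw [h]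
  exact Finset.analyticAt_fun_sum _ fun μ _ =>
    ((ContinuousLinearMap.smulRightL ℝ (EuclideanSpace ℝ (Fin d)) (NMat n)
      (EuclideanSpace.proj μ)).analyticAt _).comp (hA μ)

end OrderedExponential

end

/-! ### The theorem, assembled in the chart. -/

theorem lemma4
    -- the compact semisimple Lie algebra with its generators
    {n : ℕ} {𝔤 : Type*} [LieRing 𝔤] [LieAlgebra ℝ 𝔤] (t : Module.Basis (Fin n) ℝ 𝔤)
    (ht : ∀ a b, killingForm ℝ 𝔤 (t a) (t b) = if a = b then -2 else 0)
    -- the Riemannian manifold and a convex coordinate domain `U` in it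
    {d : ℕ} {M : Type*} [TopologicalSpace M] [ChartedSpace (EuclideanSpace ℝ (Fin d)) M]
    [IsManifold (𝓡 d) ∞ M]
    (g : Bundle.ContMDiffRiemannianMetric (𝓡 d) ∞ (EuclideanSpace ℝ (Fin d))
      (fun x : M => TangentSpace (𝓡 d) x))
    (U : Set M) (φ : OpenPartialHomeomorph M (EuclideanSpace ℝ (Fin d)))
    (hφ : φ ∈ IsManifold.maximalAtlas (𝓡 d) ∞ M) (hU : φ.source = U)
    (G : EuclideanSpace ℝ (Fin d) → Matrix (Fin d) (Fin d) ℝ)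
    (hG : G = OrderedExponential.metricComponents g φ)
    (V : Set (EuclideanSpace ℝ (Fin d))) (hV : V = φ.target)
    (hconv : OrderedExponential.IsConvexDomain G V)
    -- the connection form `B_μ = B^a_μ t^a`, smooth on `U`
    (B : Fin d → M → 𝔤)
    (hB : ∀ μ a, ContMDiffOn (𝓡 d) 𝓘(ℝ, ℝ) ∞ (fun x => t.repr (B μ x) a) U)
    -- its components `b`, and the matrix-valued operators `A_μ = f^{adb} B^d_μ`,
    -- `F_{μν} = f^{adb} F^d_{μν}`, in the coordinates
    (b : Fin d → EuclideanSpace ℝ (Fin d) → Fin n → ℝ)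
    (hb : b = fun μ p a => t.repr (B μ (φ.symm p)) a)
    (A : Fin d → EuclideanSpace ℝ (Fin d) → Matrix (Fin n) (Fin n) ℝ)
    (hA : A = fun μ p => OrderedExponential.adMat t (b μ p))
    (F : Fin d → Fin d → EuclideanSpace ℝ (Fin d) → Matrix (Fin n) (Fin n) ℝ)
    (hF : F = fun μ ν p => OrderedExponential.adMat t (OrderedExponential.fieldStrength t b μ ν p))
    -- the ordered exponential of `B`, and the gauge-transformed connection
    (Φ : EuclideanSpace ℝ (Fin d) → EuclideanSpace ℝ (Fin d) → Matrix (Fin n) (Fin n) ℝ)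
    (hΦ : Φ = OrderedExponential.orderedExp G V A)
    (f : EuclideanSpace ℝ (Fin d) → Fin d → EuclideanSpace ℝ (Fin d) → Matrix (Fin n) (Fin n) ℝ)
    (hf : f = OrderedExponential.fockSchwinger G V A) :
    -- all objects are well defined: the series converge to the ordered exponentials,
    -- and the function that is differentiated in `f` is continuously differentiable
    ((∀ x ∈ V, ∀ y ∈ V, ∀ γ, OrderedExponential.IsGeodesic G V γ y x →
        HasSum (fun k : ℕ => (-1 : ℝ) ^ k • OrderedExponential.iterInt A γ k 1) (Φ x y) ∧
        ∀ z ∈ V, HasSum (fun k : ℕ => (-1 : ℝ) ^ k • OrderedExponential.iterInt (f z) γ k 1)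
          (OrderedExponential.orderedExp G V (f z) x y)) ∧
      ∀ z ∈ V, ∀ i j, ContDiffOn ℝ 1 (fun x => Φ x z i j) V) ∧
    -- the triple product is the ordered exponential of the gauge-transformed connection
    (∀ x ∈ U, ∀ y ∈ U, ∀ z ∈ U,
      Φ (φ z) (φ x) * Φ (φ x) (φ y) * Φ (φ y) (φ z) =
        OrderedExponential.orderedExp G V (f (φ z)) (φ x) (φ y)) ∧
    -- the expansions for a flat metric
    ((∀ p ∈ V, G p = 1) → ∀ z ∈ V,
      (∀ σ i j, ∀ N : ℕ,
        (fun x => f z σ x i j -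
            ∑ k ∈ Finset.range N, OrderedExponential.fockSchwingerTerm A F z σ x k i j)
          =O[𝓝 z] fun x => ‖x - z‖ ^ (N + 1)) ∧
      ((∀ μ a, AnalyticAt ℝ (fun p => b μ p a) z) →
        ∀ᶠ x in 𝓝 z, ∀ σ,
          HasSum (fun k => OrderedExponential.fockSchwingerTerm A F z σ x k) (f z σ x)) ∧
      ∀ i j,
        (fun p : EuclideanSpace ℝ (Fin d) × EuclideanSpace ℝ (Fin d) =>
            (Φ z p.1 * Φ p.1 p.2 * Φ p.2 z - OrderedExponential.tripleExpansion A F p.1 p.2 z) i j)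
          =O[𝓝 (z, z)] fun p => (‖p.1 - z‖ + ‖p.2 - z‖) ^ 5) := by
  have hbs : ∀ μ, ContDiffOn ℝ ∞ (b μ) V := fun μ => contDiffOn_pi.2 fun a => by
    have h := (hB μ a).comp (contMDiffOn_symm_of_mem_maximalAtlas hφ)
      (fun p hp => hU ▸ φ.map_target hp)
    subst hb hV
    exact contMDiffOn_iff_contDiffOn.1 h
  subst hΦ hf
  -- The matrix-valued data are retyped in `NMat n`, where a norm is available; the functions
  -- themselves are unchanged.
  obtain ⟨AN, hAN⟩ : ∃ AN : Fin d → EuclideanSpace ℝ (Fin d) → OrderedExponential.NMat n,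
    AN = fun μ p => OrderedExponential.adLin t (b μ p) := ⟨_, rfl⟩
  obtain ⟨FN, hFN⟩ : ∃ FN : Fin d → Fin d → EuclideanSpace ℝ (Fin d) → OrderedExponential.NMat n,
    FN = fun μ ν p => OrderedExponential.adLin t (OrderedExponential.fieldStrength t b μ ν p) := ⟨_, rfl⟩
  have hAA : AN = A := hAN.trans hA.symm
  have hFF : FN = F := hFN.trans hF.symm
  clear hA hF
  subst hAA hFF
  have hAs : ∀ μ, ContDiffOn ℝ ∞ (AN μ) V := fun μ => by
    rw [hAN]
    exact (OrderedExponential.adLin t).contDiff.comp_contDiffOn (hbs μ)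
  have hAc : ∀ μ, ContinuousOn (AN μ) V := fun μ => (hAs μ).continuousOn
  have hform := OrderedExponential.contDiffOn_form hAs
  have hFc : ∀ μ ν, EqOn (FN μ ν) (fun p => FockSchwingerGauge.curvature (OrderedExponential.form AN) p (EuclideanSpace.single μ 1)
      (EuclideanSpace.single ν 1)) V := fun μ ν p hp => by
    have h1 : DifferentiableAt ℝ (OrderedExponential.form AN) p :=
      (hform.differentiableOn (by simp)).differentiableAt (hconv.1.mem_nhds hp)
    rw [hAN] at h1 ⊢
    rw [hFN]
    exact OrderedExponential.fieldStrength_eq_curvature t ht (fun μ =>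
      ((hbs μ).differentiableOn (by simp)).differentiableAt (hconv.1.mem_nhds hp)) h1 μ ν
  have hmem : ∀ x ∈ U, φ x ∈ V := fun x hx => by
    subst hU hV
    exact φ.map_source hx
  refine ⟨⟨fun x hx y hy γ hγ => ⟨?_, fun z hz => ?_⟩, fun z hz i j => ?_⟩,
    fun x hx y hy z hz => hconv.triple_product hAs (hmem x hx) (hmem y hy) (hmem z hz),
    fun hflat z hz => ⟨fun σ i j N => ?_, fun ha => ?_, fun i j => ?_⟩⟩
  · have h := OrderedExponential.hasSum_matrix (hγ.hasSum_iterInt hAc)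
    rw [← hconv.orderedExp_eq hy hx hγ hAc] at h
    exact h
  · have hfc := hconv.continuousOn_fockSchwingerN hAs hz
    have h := OrderedExponential.hasSum_matrix (hγ.hasSum_iterInt hfc)
    rw [← hconv.orderedExp_eq hy hx hγ hfc] at h
    exact h
  · exact (OrderedExponential.entry i j).contDiff.comp_contDiffOn (hconv.contDiffOn_orderedExpN hAs hz)
  · have h := hconv.fockSchwingerN_isBigO hflat hAs hz σ N
    simp only [← OrderedExponential.fockSchwingerTermN_eq hconv.1 hform hFc hz] at h
    -- Entries are bounded linear functionals, so the norm estimate passes to each of them.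
    refine (((OrderedExponential.entry i j).isBigO_comp _ _).trans h).congr_left fun x => ?_
    rw [map_sub, map_sum]
    rfl
  · have hAa : AnalyticAt ℝ (OrderedExponential.form AN) z := OrderedExponential.analyticAt_form fun μ => by
      rw [hAN]
      exact ((OrderedExponential.adLin t).analyticAt _).comp (analyticAt_pi_iff.2 fun a => ha μ a)
    filter_upwards [hconv.hasSum_fockSchwingerN hflat hAs hz hAa] with x hx σ
    have h := hx σ
    simp only [funext fun j => (OrderedExponential.fockSchwingerTermN_eq hconv.1 hform hFc hz σ x j).symm] at h
    exact OrderedExponential.hasSum_matrix h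
  · have h := hconv.triple_product_isBigO hflat hAs hz
    simp only [← OrderedExponential.tripleExpansionN_eq hconv.1 hform hFc hz] at h
    refine (((OrderedExponential.entry i j).isBigO_comp _ _).trans h).congr_left fun p => ?_
    rfl
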